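/- Let $\mathbb H$ be the real quaternions and $\mathbb S$ the sphere of imaginary units. For a quaternionic Hermitian matrix $A$, let ${\rm sq}_-(A)$ be the number of its strictly negative (right) eigenvalues, counted with multiplicity. Let $J_1\in\mathbb H^{N\times N}$ and $J_2\in\mathbb H^{M\times M}$ be signature matrices (self-adjoint and unitary) with ${\rm sq}_-(J_1)={\rm sq}_-(J_2)$, and let $\kappa\ge 0$ be an integer. Let $\mathcal V$ be a neighborhood of the origin, contained in the open unit ball of $\mathbb H$, which is an axially symmetric s-domain: $\mathcal V$ is open and connected, $\mathcal V\cap(\mathbb R+I\mathbb R)$ is connected for every $I\in\mathbb S$, and $\mathcal V$ contains with each $p$ the sphere $\{{\rm Re}(p)+J|{\rm Im}(p)| : J\in\mathbb S\}$. Let $\Theta:\mathcal V\to\mathbb H^{M\times N}$ be (left) slice hyperholomorphic, i.e. each entry $f$ is real differentiable and satisfies $(\partial_x+I\partial_y)f(x+Iy)=0$ on $\mathcal V\cap(\mathbb R+I\mathbb R)$ for every $I\in\mathbb S$. Then $\Theta$ belongs to $\mathscr S_\kappa(J_2,J_1)$, i.e. the kernel $$K_\Theta(p,q)=\sum_{\ell=0}^\infty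 p^\ell\big(J_2-\Theta(p)J_1\Theta(q)^*\big)\overline q^{\,\ell}$$ has $\kappa$ negative squares in $\mathcal V$ (it is Hermitian, and the matrices with entries $c_\ell^*K_\Theta(z_\ell,z_j)c_j$, where $z_1,\dots,z_n\in\mathcal V$ and $c_1,\dots,c_n\in\mathbb H^M$, have at most $\kappa$ strictly negative eigenvalues, and exactly $\kappa$ for some choice), if and only if there exist a right quaternionic Pontryagin space $\mathscr P$ of index $\kappa$ and bounded right linear operators $A:\mathscr P\to\mathscr P$, $B:\mathbb H^N\to\mathscr P$, $C:\mathscr P\to\mathbb H^M$, $D:\mathbb H^N\to\mathbb H^M$ such that: 1. $(C,A)$ is observable: $\bigcap_{n\ge0}\ker CA^n=\{0\}$; 2. $$\begin{pmatrix}A&B\\ C&D\end{pmatrix}\begin{pmatrix}I_{\mathscr P}&0\\0&J_1\end{pmatrix}\begin{pmatrix}A&B\\ C&D\end{pmatrix}^*=\begin{pmatrix}I_{\mathscr P}&0\\0&J_2\end{pmatrix},$$ where the adjoint is taken with respect to the form of $\mathscr P$ and the standard inner products of $\mathbb H^N$ and $\mathbb H^M$; 3. $\Theta(p)=D+pC\star(I_{\mathscr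 P}-pA)^{-\star}B$ for every $p\in\mathcal V$ such that $|p|^2A^2-2{\rm Re}(p)A+I_{\mathscr P}$ is invertible (in particular for all $p$ near the origin). Here $C\star(I_{\mathscr P}-pA)^{-\star}$ denotes the operator $CR-\overline p\,CAR:\mathscr P\to\mathbb H^M$ with $R=(|p|^2A^2-2{\rm Re}(p)A+I_{\mathscr P})^{-1}$, which equals $\sum_{n\ge0}p^nCA^n$ for small $p$. A right quaternionic Pontryagin space of index $\kappa$ is a right $\mathbb H$-vector space with an $\mathbb H$-valued Hermitian form $[\cdot,\cdot]$ that is a direct orthogonal sum $\mathscr P_++\mathscr P_-$, where $(\mathscr P_+,[\cdot,\cdot])$ is a Hilbert space and $(\mathscr P_-,-[\cdot,\cdot])$ is a Hilbert space of finite dimension $\kappa$. -/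

import Mathlib

open Quaternion
open scoped RightActions

noncomputable section

namespace SliceSchur

/-! ### Slice hyperholomorphic functions -/

/-- The 2-sphere of unit purely imaginary quaternions. -/
def unitSphere : Set ℍ[ℝ] := {I | I.re = 0 ∧ ‖I‖ = 1}

/-- The complex plane `ℝ + Iℝ` in the quaternions. -/
def slicePlane (I : ℍ[ℝ]) : Set ℍ[ℝ] := {p | ∃ x y : ℝ, p = (x : ℍ[ℝ]) + I * (y : ℍ[ℝ])}

/-- An s-domain: a domain meeting the real axis whose intersection with each plane
`ℝ + Iℝ` is a domain of that plane (relative openness is automatic). -/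
structure IsSliceDomain (V : Set ℍ[ℝ]) : Prop where
  isOpen : IsOpen V
  isConnected : IsConnected V
  real_nonempty : ∃ x : ℝ, (x : ℍ[ℝ]) ∈ V
  slice_connected : ∀ I ∈ unitSphere, IsConnected (V ∩ slicePlane I)

/-- `V` contains, with each `p`, the whole 2-sphere `{Re p + J |Im p|}`. -/
def IsAxiallySymmetric (V : Set ℍ[ℝ]) : Prop :=
  ∀ p ∈ V, ∀ J ∈ unitSphere, (p.re : ℍ[ℝ]) + J * (‖p.im‖ : ℍ[ℝ]) ∈ V

/-- Left slice hyperholomorphic functions on an open set: real differentiable functions with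
`(∂/∂x + I ∂/∂y) f(x + Iy) / 2 = 0` for every imaginary unit `I`. -/
def SliceRegularOn (f : ℍ[ℝ] → ℍ[ℝ]) (V : Set ℍ[ℝ]) : Prop :=
  DifferentiableOn ℝ f V ∧
    ∀ I ∈ unitSphere, ∀ x y : ℝ, (x : ℍ[ℝ]) + I * (y : ℍ[ℝ]) ∈ V →
      (2⁻¹ : ℝ) • (deriv (fun t : ℝ => f ((t : ℍ[ℝ]) + I * (y : ℍ[ℝ]))) x
        + I * deriv (fun t : ℝ => f ((x : ℍ[ℝ]) + I * (t : ℍ[ℝ]))) y) = 0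

/-- A matrix-valued function is slice hyperholomorphic if its entries are. -/
def MatrixSliceRegularOn {M N : ℕ} (Θ : ℍ[ℝ] → Matrix (Fin M) (Fin N) ℍ[ℝ])
    (V : Set ℍ[ℝ]) : Prop :=
  ∀ i j, SliceRegularOn (fun p => Θ p i j) V

/-! ### Quaternionic Hermitian matrices and negative squares -/

/-- The right eigenspace `{v | A v = v t}` of a quaternionic matrix for a real number `t`. -/
def rightEigenspace {n : ℕ} (A : Matrix (Fin n) (Fin n) ℍ[ℝ]) (t : ℝ) :
    Submodule ℍ[ℝ]ᵐᵒᵖ (Fin n → ℍ[ℝ]) where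
  carrier := {v | A.mulVec v = v <• (t : ℍ[ℝ])}
  add_mem' := by
    intro v w hv hw
    simp only [Set.mem_ofPred_eq] at *
    rw [Matrix.mulVec_add, hv, hw, smul_add]
  zero_mem' := by simp
  smul_mem' := by
    intro a v hv
    simp only [Set.mem_ofPred_eq] at *
    rw [Matrix.mulVec_smul, hv]
    ext1 i
    simp only [Pi.smul_apply, MulOpposite.smul_eq_mul_unop, MulOpposite.unop_op, mul_assoc]
    rw [(Quaternion.coe_commutes t (MulOpposite.unop a))]

/-- The number of strictly negative eigenvalues of a Hermitian matrix, counted with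
multiplicity: the dimension of the sum of the eigenspaces for negative eigenvalues. -/
def sqNeg {n : ℕ} (A : Matrix (Fin n) (Fin n) ℍ[ℝ]) : ℕ :=
  Module.finrank ℍ[ℝ]ᵐᵒᵖ
    ((⨆ t : Set.Iio (0 : ℝ), rightEigenspace A (t : ℝ)) : Submodule ℍ[ℝ]ᵐᵒᵖ (Fin n → ℍ[ℝ]))

/-- A signature matrix: self-adjoint and unitary. -/
def IsSignature {n : ℕ} (J : Matrix (Fin n) (Fin n) ℍ[ℝ]) : Prop :=
  J.conjTranspose = J ∧ J.conjTranspose * J = 1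

/-- The matrix with `l, j` entry `c_l^* K(z_l, z_j) c_j`. -/
def kernelGram {M n : ℕ} (K : ℍ[ℝ] → ℍ[ℝ] → Matrix (Fin M) (Fin M) ℍ[ℝ])
    (z : Fin n → ℍ[ℝ]) (c : Fin n → Fin M → ℍ[ℝ]) : Matrix (Fin n) (Fin n) ℍ[ℝ] :=
  Matrix.of fun l j => star (c l) ⬝ᵥ (K (z l) (z j)).mulVec (c j)

/-- The kernel `K` has (exactly) `κ` negative squares in `V`. -/
structure HasNegativeSquares {M : ℕ} (K : ℍ[ℝ] → ℍ[ℝ] → Matrix (Fin M) (Fin M) ℍ[ℝ])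
    (V : Set ℍ[ℝ]) (κ : ℕ) : Prop where
  hermitian : ∀ p ∈ V, ∀ q ∈ V, K p q = (K q p).conjTranspose
  le : ∀ (n : ℕ) (z : Fin n → ℍ[ℝ]) (c : Fin n → Fin M → ℍ[ℝ]),
    (∀ i, z i ∈ V) → sqNeg (kernelGram K z c) ≤ κ
  attained : ∃ (n : ℕ) (z : Fin n → ℍ[ℝ]) (c : Fin n → Fin M → ℍ[ℝ]),
    (∀ i, z i ∈ V) ∧ sqNeg (kernelGram K z c) = κ

/-- The kernel `∑ p^ℓ (J₂ - Θ(p) J₁ Θ(q)^*) q̄^ℓ`; it converges when `|p| |q| < 1`. -/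
def schurKernel {M N : ℕ} (J₁ : Matrix (Fin N) (Fin N) ℍ[ℝ]) (J₂ : Matrix (Fin M) (Fin M) ℍ[ℝ])
    (Θ : ℍ[ℝ] → Matrix (Fin M) (Fin N) ℍ[ℝ]) (p q : ℍ[ℝ]) : Matrix (Fin M) (Fin M) ℍ[ℝ] :=
  Matrix.of fun i j =>
    ∑' l : ℕ, p ^ l * (J₂ - Θ p * J₁ * (Θ q).conjTranspose) i j * (star q) ^ l

/-- `Θ`, slice hyperholomorphic in the neighbourhood `V` of the origin, belongs to the
generalized Schur class `S_κ(J₂, J₁)`. -/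
structure IsGeneralizedSchur {M N : ℕ} (J₁ : Matrix (Fin N) (Fin N) ℍ[ℝ])
    (J₂ : Matrix (Fin M) (Fin M) ℍ[ℝ]) (V : Set ℍ[ℝ]) (κ : ℕ)
    (Θ : ℍ[ℝ] → Matrix (Fin M) (Fin N) ℍ[ℝ]) : Prop where
  sliceRegular : MatrixSliceRegularOn Θ V
  negativeSquares : HasNegativeSquares (schurKernel J₁ J₂ Θ) V κ

/-! ### Right quaternionic Pontryagin spaces -/

/-- An `ℍ`-valued Hermitian form on a right quaternionic vector space. -/
structure HermForm (P : Type*) [AddCommGroup P] [Module ℍ[ℝ]ᵐᵒᵖ P] where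
  toFun : P → P → ℍ[ℝ]
  add_left : ∀ u v w, toFun (u + v) w = toFun u w + toFun v w
  smul_smul : ∀ v w (a b : ℍ[ℝ]), toFun (v <• a) (w <• b) = star b * toFun v w * a
  conj_symm : ∀ v w, toFun w v = star (toFun v w)

/-- A fundamental decomposition `P = P₊ + P₋`: direct, orthogonal, `P₊` a Hilbert space for the
form, `P₋` a finite dimensional Hilbert space for minus the form. (Values `[v, v]` are real.) -/
structure IsFundamentalDecomposition {P : Type*} [AddCommGroup P] [Module ℍ[ℝ]ᵐᵒᵖ P]
    (F : HermForm P) (Pp Pm : Submodule ℍ[ℝ]ᵐᵒᵖ P) : Prop where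
  isCompl : IsCompl Pp Pm
  orthogonal : ∀ v ∈ Pp, ∀ w ∈ Pm, F.toFun v w = 0
  pos : ∀ v ∈ Pp, v ≠ 0 → 0 < (F.toFun v v).re
  complete : ∀ u : ℕ → P, (∀ n, u n ∈ Pp) →
    (∀ ε > 0, ∃ n₀, ∀ m ≥ n₀, ∀ n ≥ n₀, (F.toFun (u m - u n) (u m - u n)).re < ε) →
    ∃ v ∈ Pp, Filter.Tendsto (fun n => (F.toFun (u n - v) (u n - v)).re) Filter.atTop (nhds 0)
  neg : ∀ v ∈ Pm, v ≠ 0 → (F.toFun v v).re < 0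
  finite : Module.Finite ℍ[ℝ]ᵐᵒᵖ Pm

/-- `(P, F)` is a right quaternionic Pontryagin space of index `κ`. -/
def IsPontryaginSpace {P : Type*} [AddCommGroup P] [Module ℍ[ℝ]ᵐᵒᵖ P]
    (F : HermForm P) (κ : ℕ) : Prop :=
  ∃ Pp Pm : Submodule ℍ[ℝ]ᵐᵒᵖ P,
    IsFundamentalDecomposition F Pp Pm ∧ Module.finrank ℍ[ℝ]ᵐᵒᵖ Pm = κ

/-! ### Colligations -/

section Colligation

variable {P : Type*} [AddCommGroup P] [Module ℍ[ℝ]ᵐᵒᵖ P] {M N : ℕ}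

/-- The block operator `(x, u) ↦ (A x + B u, C x + D u)` from `P ⊕ ℍ^N` to `P ⊕ ℍ^M`. -/
def colligation (A : P →ₗ[ℍ[ℝ]ᵐᵒᵖ] P) (B : (Fin N → ℍ[ℝ]) →ₗ[ℍ[ℝ]ᵐᵒᵖ] P)
    (C : P →ₗ[ℍ[ℝ]ᵐᵒᵖ] (Fin M → ℍ[ℝ])) (D : Matrix (Fin M) (Fin N) ℍ[ℝ])
    (x : P × (Fin N → ℍ[ℝ])) : P × (Fin M → ℍ[ℝ]) :=
  (A x.1 + B x.2, C x.1 + D.mulVec x.2)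

/-- The operator `diag(I, J)` on `P ⊕ ℍ^N`. -/
def diagOp (J : Matrix (Fin N) (Fin N) ℍ[ℝ]) (x : P × (Fin N → ℍ[ℝ])) : P × (Fin N → ℍ[ℝ]) :=
  (x.1, J.mulVec x.2)

/-- The form `[x, y] + v^* u` on `P ⊕ ℍ^N`, for the vectors `(x, u)` and `(y, v)`. -/
def sumForm (F : HermForm P) (x y : P × (Fin N → ℍ[ℝ])) : ℍ[ℝ] :=
  F.toFun x.1 y.1 + star y.2 ⬝ᵥ x.2

/-- `S : P ⊕ ℍ^M → P ⊕ ℍ^N` is the adjoint of `T : P ⊕ ℍ^N → P ⊕ ℍ^M`, with respect to the form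
of `P` and the standard inner products of `ℍ^N` and `ℍ^M`. -/
def IsAdjointOp (F : HermForm P) (T : P × (Fin N → ℍ[ℝ]) → P × (Fin M → ℍ[ℝ]))
    (S : P × (Fin M → ℍ[ℝ]) → P × (Fin N → ℍ[ℝ])) : Prop :=
  ∀ x y, sumForm F (T x) y = sumForm F x (S y)

/-- `T diag(I, J₁) T^* = diag(I, J₂)`. -/
def IsCoisometric (F : HermForm P) (J₁ : Matrix (Fin N) (Fin N) ℍ[ℝ])
    (J₂ : Matrix (Fin M) (Fin M) ℍ[ℝ])
    (T : P × (Fin N → ℍ[ℝ]) → P × (Fin M → ℍ[ℝ])) : Prop :=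
  ∃ S : P × (Fin M → ℍ[ℝ]) → P × (Fin N → ℍ[ℝ]),
    IsAdjointOp F T S ∧ ∀ y, T (diagOp J₁ (S y)) = diagOp J₂ y

/-- The squared Hilbert space norm `[v₊, v₊] - [v₋, v₋]` of `v = v₊ + v₋`. -/
def hilbertNormSq (F : HermForm P) {Pp Pm : Submodule ℍ[ℝ]ᵐᵒᵖ P} (h : IsCompl Pp Pm) (v : P) : ℝ :=
  (F.toFun (Pp.projection Pm h v) (Pp.projection Pm h v)).re
    - (F.toFun (Pm.projection Pp h.symm v) (Pm.projection Pp h.symm v)).re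

/-- The operator `T : P ⊕ ℍ^N → P ⊕ ℍ^M` (equivalently each of its blocks) is bounded for the
Hilbert space norm given by a fundamental decomposition; all of these norms are equivalent. -/
def IsBoundedOp (F : HermForm P) (T : P × (Fin N → ℍ[ℝ]) → P × (Fin M → ℍ[ℝ])) : Prop :=
  ∃ (Pp Pm : Submodule ℍ[ℝ]ᵐᵒᵖ P) (h : IsFundamentalDecomposition F Pp Pm) (c : ℝ), ∀ x,
    hilbertNormSq F h.isCompl (T x).1 + ∑ i, ‖(T x).2 i‖ ^ 2
      ≤ c * (hilbertNormSq F h.isCompl x.1 + ∑ j, ‖x.2 j‖ ^ 2)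

/-- Observability: `⋂ ker C Aⁿ = {0}`. -/
def IsObservable (C : P →ₗ[ℍ[ℝ]ᵐᵒᵖ] (Fin M → ℍ[ℝ])) (A : P →ₗ[ℍ[ℝ]ᵐᵒᵖ] P) : Prop :=
  ∀ x : P, (∀ n : ℕ, C ((A ^ n) x) = 0) → x = 0

/-- The operator `|p|² A² - 2 Re(p) A + I`. -/
def sOperator (A : P →ₗ[ℍ[ℝ]ᵐᵒᵖ] P) (p : ℍ[ℝ]) : P →ₗ[ℍ[ℝ]ᵐᵒᵖ] P where
  toFun x := A (A x) <• ((‖p‖ ^ 2 : ℝ) : ℍ[ℝ]) - A x <• ((2 * p.re : ℝ) : ℍ[ℝ]) + x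
  map_add' x y := by
    simp only [map_add, smul_add]
    abel
  map_smul' a x := by
    have key : ∀ (r : ℝ) (w : P), (a • w) <• (r : ℍ[ℝ]) = a • (w <• (r : ℍ[ℝ])) := by
      intro r w
      rw [smul_smul, smul_smul]
      congr 1
      apply MulOpposite.unop_injective
      simp only [MulOpposite.unop_mul, MulOpposite.unop_op]
      exact (Quaternion.coe_commutes r _).symm
    simp only [map_smul, key, RingHom.id_apply, smul_add, smul_sub]

/-- `C ⋆ (I - pA)^{-⋆}`, where `(I - pA)^{-⋆} = (I - p̄ A) (|p|² A² - 2 Re(p) A + I)⁻¹`. In the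
`⋆`-product with the constant `C` the powers of `p` stand on the left, so this is the operator
`C R - p̄ C A R : P → ℍ^M` with `R` the inverse of `|p|² A² - 2 Re(p) A + I`; for small `p` it is the
sum of the series `∑ pⁿ C Aⁿ`. -/
def starResolvent (C : P →ₗ[ℍ[ℝ]ᵐᵒᵖ] (Fin M → ℍ[ℝ])) (A : P →ₗ[ℍ[ℝ]ᵐᵒᵖ] P) (p : ℍ[ℝ])
    (h : Function.Bijective (sOperator A p)) (x : P) : Fin M → ℍ[ℝ] :=
  C ((LinearEquiv.ofBijective (sOperator A p) h).symm x)
    - star p • C (A ((LinearEquiv.ofBijective (sOperator A p) h).symm x))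

/-- `Θ(p) = D + p C ⋆ (I - pA)^{-⋆} B` at every `p ∈ V` for which `|p|² A² - 2 Re(p) A + I` is
invertible (for bounded `A` this includes a neighbourhood of the origin). -/
def IsRealizationOn (V : Set ℍ[ℝ]) (Θ : ℍ[ℝ] → Matrix (Fin M) (Fin N) ℍ[ℝ])
    (A : P →ₗ[ℍ[ℝ]ᵐᵒᵖ] P) (B : (Fin N → ℍ[ℝ]) →ₗ[ℍ[ℝ]ᵐᵒᵖ] P)
    (C : P →ₗ[ℍ[ℝ]ᵐᵒᵖ] (Fin M → ℍ[ℝ])) (D : Matrix (Fin M) (Fin N) ℍ[ℝ]) : Prop :=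
  ∀ p ∈ V, ∀ h : Function.Bijective (sOperator A p), ∀ u : Fin N → ℍ[ℝ],
    (Θ p).mulVec u = D.mulVec u + p • starResolvent C A p h (B u)

end Colligation

end SliceSchur

end

/-!
The kernel `K(p, q) = ∑ p^l (J₂ - Θ(p) J₁ Θ(q)^*) q̄^l` is a Gram kernel: with `R(p) = (I, Θ(p))`
and `h(p) c = (R(p)^* p̄^l c)_l`, a square summable sequence, `c^* K(p, q) d` is the value at
`(h(q) d, h(p) c)` of the indefinite form `∑ y_l^* diag(J₂, -J₁) x_l` (`coeffForm_schurVec`). Hence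
its negative squares are counted by the negative definite subspaces of the span of the vectors
`h(p) c` (`hasNegativeSquares_iff`). On a slice `ℝ + Iℝ`, pairing a fixed sequence with `h(p) c`
produces the real part of a holomorphic function of `p`, because slice hyperholomorphic entries
become holomorphic under functionals that turn left multiplication by `I` into multiplication by
`i`. The identity theorem (`inner_coeffVec_eq_zero`) then shows that the vectors at small positive
reals are total in the span (`kernelSpan_subset_closure`), so only real points, where the star
products are ordinary products, need to be compared.

If the kernel has `κ` negative squares, reversing the sign of the form on a negative definite
subspace of maximal dimension and completing gives a Pontryagin space of index `κ` with reproducing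
vectors `k_p c` (`exists_pontryagin_completion`, `exists_reproducing_space`). The identity
`K(p, q) - p K(p, q) q̄ = J₂ - Θ(p) J₁ Θ(q)^*` (`schurKernel_shift`) says that
`(k_p (p̄ c), J₂ c) ↦ (k_p c, J₁ Θ(p)^* c)` is isometric for the forms obtained by adding `J₂` and
`J₁` to that of the Pontryagin space. The two sums have the same index since the signature matrices have equally many negative
eigenvalues, so Shmulyan's theorem (`IsPontryaginSpace.exists_isometry`) extends the relation to an
everywhere defined isometry. Its adjoint `T` is the coisometric colligation (`exists_coisometry`).
Writing `x̂(p)` for the function with `c^* x̂(p) = [x, k_p c]`, duality reads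
`p (T(x, u))₁^(p) + (T(x, u))₂ = x̂(p) + Θ(p) u`, and this functional equation contains both the realization formula
and observability (`exists_realization`).

Conversely, for a coisometric realization and a small real `t > 0`, the vectors
`k = (I - tA^*)⁻¹ C^* c` satisfy `T^*(k t, c) = (k, Θ(t)^* c)` (`adjoint_kernelVec`), so coisometry gives them the
Gram kernel `K` (`form_kernelVec`). Observability makes them total in the state space, as the
functions `t ↦ C (I - tA)⁻¹ x` determine all `C Aⁿ x` (`IsPontryaginSpace.moments_eq_zero`). A
finite dimensional negative definite subspace can be moved into a dense subspace
(`exists_negDef_of_closure`) and carried along the isometric relation `h(t) c ↔ k`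
(`exists_negDef_transfer`). Thus the span of the `h(p) c` and the state space have negative
definite subspaces of the same maximal dimension `κ` (`hasNegativeSquares_of_realization`).
-/

noncomputable section

namespace SliceSchur

/-! ### Hermitian forms on right quaternionic spaces -/

namespace HermForm

variable {E : Type*} [AddCommGroup E] [Module ℍ[ℝ]ᵐᵒᵖ E] (F : HermForm E)

theorem smul_left (v w : E) (a : ℍ[ℝ]) : F.toFun (v <• a) w = F.toFun v w * a := by
  simpa using F.smul_smul v w a 1

theorem smul_right (v w : E) (b : ℍ[ℝ]) : F.toFun v (w <• b) = star b * F.toFun v w := by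
  simpa using F.smul_smul v w 1 b

theorem add_right (u v w : E) : F.toFun u (v + w) = F.toFun u v + F.toFun u w := by
  rw [F.conj_symm (v + w) u, F.add_left, star_add, ← F.conj_symm, ← F.conj_symm]

@[simp] theorem zero_left (w : E) : F.toFun 0 w = 0 := by
  have h := F.add_left 0 0 w
  rwa [add_zero, left_eq_add] at h

@[simp] theorem zero_right (w : E) : F.toFun w 0 = 0 := by
  rw [F.conj_symm 0 w, zero_left, star_zero]

theorem neg_left (v w : E) : F.toFun (-v) w = -F.toFun v w := by
  have h := F.add_left (-v) v w
  rw [neg_add_cancel, zero_left] at h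
  exact eq_neg_of_add_eq_zero_left h.symm

theorem neg_right (v w : E) : F.toFun v (-w) = -F.toFun v w := by
  rw [F.conj_symm (-w) v, neg_left, star_neg, ← F.conj_symm]

theorem sub_left (u v w : E) : F.toFun (u - v) w = F.toFun u w - F.toFun v w := by
  rw [sub_eq_add_neg, F.add_left, neg_left, sub_eq_add_neg]

theorem sub_right (u v w : E) : F.toFun u (v - w) = F.toFun u v - F.toFun u w := by
  rw [sub_eq_add_neg, F.add_right, neg_right, sub_eq_add_neg]

theorem re_symm (v w : E) : (F.toFun v w).re = (F.toFun w v).re := by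
  rw [F.conj_symm w v]; simp

theorem sum_left {ι : Type*} (s : Finset ι) (v : ι → E) (w : E) :
    F.toFun (∑ i ∈ s, v i) w = ∑ i ∈ s, F.toFun (v i) w := by
  classical
  induction s using Finset.induction_on with
  | empty => simp
  | insert a s ha ih => rw [Finset.sum_insert ha, Finset.sum_insert ha, F.add_left, ih]

theorem sum_right {ι : Type*} (s : Finset ι) (v : ι → E) (w : E) :
    F.toFun w (∑ i ∈ s, v i) = ∑ i ∈ s, F.toFun w (v i) := by
  classical
  induction s using Finset.induction_on with
  | empty => simp
  | insert a s ha ih => rw [Finset.sum_insert ha, Finset.sum_insert ha, F.add_right, ih]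

theorem re_add_self (v w : E) : (F.toFun (v + w) (v + w)).re
    = (F.toFun v v).re + 2 * (F.toFun v w).re + (F.toFun w w).re := by
  rw [F.add_left, F.add_right, F.add_right]
  simp only [Quaternion.re_add]
  rw [F.re_symm w v]; ring

/-- The form takes the same values on `N` twisted by all quaternions, so it vanishes as soon as
its real part does. -/
theorem eq_zero_of_re (N : Submodule ℍ[ℝ]ᵐᵒᵖ E) (x : E)
    (h : ∀ n ∈ N, (F.toFun x n).re = 0) : ∀ n ∈ N, F.toFun x n = 0 := by
  intro n hn
  have h1 := h (n <• (F.toFun x n)) (N.smul_mem _ hn)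
  rw [F.smul_right, Quaternion.star_mul_self] at h1
  simpa using h1

/-- The orthogonal companion of a submodule. -/
def orth (N : Submodule ℍ[ℝ]ᵐᵒᵖ E) : Submodule ℍ[ℝ]ᵐᵒᵖ E where
  carrier := {v | ∀ n ∈ N, F.toFun v n = 0}
  add_mem' := by
    intro a b ha hb n hn
    rw [F.add_left, ha n hn, hb n hn, add_zero]
  zero_mem' := by intro n _; exact F.zero_left n
  smul_mem' := by
    intro a v hv n hn
    have := F.smul_left v n a.unop
    rw [MulOpposite.op_unop] at this
    rw [this, hv n hn, zero_mul]

theorem orth_symm {N : Submodule ℍ[ℝ]ᵐᵒᵖ E} {v n : E} (hv : v ∈ F.orth N) (hn : n ∈ N) :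
    F.toFun n v = 0 := by
  rw [F.conj_symm v n, hv n hn, star_zero]

/-- The form is strictly negative on the nonzero vectors of `N`. -/
def NegDef (N : Submodule ℍ[ℝ]ᵐᵒᵖ E) : Prop := ∀ v ∈ N, v ≠ 0 → (F.toFun v v).re < 0

variable {F}

/-- The real scalar action underlying a right quaternionic module. -/
@[reducible] def _root_.SliceSchur.realModule (E : Type*) [AddCommGroup E] [Module ℍ[ℝ]ᵐᵒᵖ E] :
    Module ℝ E := Module.compHom E (algebraMap ℝ ℍ[ℝ]ᵐᵒᵖ)

theorem _root_.SliceSchur.realModule_isScalarTower (E : Type*) [AddCommGroup E]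
    [Module ℍ[ℝ]ᵐᵒᵖ E] :
    let _ := realModule E
    IsScalarTower ℝ ℍ[ℝ]ᵐᵒᵖ E := by
  let _ := realModule E
  refine ⟨fun r a x => ?_⟩
  rw [Algebra.smul_def, mul_smul]
  rfl

/-- The quaternions form a finite dimensional real space, also when they act on the right. -/
instance _root_.SliceSchur.finite_real_quaternion_op : Module.Finite ℝ ℍ[ℝ]ᵐᵒᵖ :=
  Module.Finite.equiv (MulOpposite.opLinearEquiv ℝ : ℍ[ℝ] ≃ₗ[ℝ] ℍ[ℝ]ᵐᵒᵖ)

section Real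

theorem _root_.SliceSchur.real_smul_eq {E : Type*} [AddCommGroup E] [Module ℍ[ℝ]ᵐᵒᵖ E]
    [Module ℝ E] [IsScalarTower ℝ ℍ[ℝ]ᵐᵒᵖ E] (r : ℝ) (v : E) :
    r • v = v <• (r : ℍ[ℝ]) := by
  rw [← algebraMap_smul ℍ[ℝ]ᵐᵒᵖ r v]
  rfl

variable (F) [Module ℝ E] [IsScalarTower ℝ ℍ[ℝ]ᵐᵒᵖ E]

/-- The real part of a Hermitian form, as a real bilinear form. -/
def reForm : E →ₗ[ℝ] E →ₗ[ℝ] ℝ :=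
  LinearMap.mk₂ ℝ (fun x y => (F.toFun x y).re)
    (fun x y z => by rw [F.add_left]; rfl)
    (fun r x y => by
      rw [real_smul_eq, F.smul_left, ← Quaternion.coe_commutes, Quaternion.coe_mul_eq_smul]; simp)
    (fun x y z => by rw [F.add_right]; rfl)
    (fun r x y => by
      rw [real_smul_eq, F.smul_right, Quaternion.star_coe, Quaternion.coe_mul_eq_smul]; simp)

@[simp] theorem reForm_apply (x y : E) : F.reForm x y = (F.toFun x y).re := rfl

end Real

theorem NegDef.disjoint_of_nonneg {N Q : Submodule ℍ[ℝ]ᵐᵒᵖ E} (hN : F.NegDef N)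
    (hQ : ∀ v ∈ Q, 0 ≤ (F.toFun v v).re) : Disjoint N Q := by
  rw [Submodule.disjoint_def]
  intro x hx hx'
  by_contra h0
  exact absurd (hQ x hx') (not_le.mpr (hN x hx h0))

/-- A finite dimensional negative definite subspace is orthocomplemented: orthogonality is a
nondegenerate real linear system. -/
theorem NegDef.isCompl_orth {N : Submodule ℍ[ℝ]ᵐᵒᵖ E} (hN : F.NegDef N)
    [Module.Finite ℍ[ℝ]ᵐᵒᵖ N] : IsCompl N (F.orth N) := by
  let _ := realModule E
  have _ := realModule_isScalarTower E
  have : FiniteDimensional ℝ N := Module.Finite.trans ℍ[ℝ]ᵐᵒᵖ N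
  refine ⟨?_, ?_⟩
  · rw [Submodule.disjoint_def]
    intro x hx hx'
    by_contra h0
    have := hN x hx h0
    rw [hx' x hx] at this
    exact lt_irrefl _ this
  · rw [codisjoint_iff, eq_top_iff]
    intro x _
    -- the map `N → Dual ℝ N` induced by the form is injective, hence surjective
    let φ : N →ₗ[ℝ] Module.Dual ℝ N :=
      (F.reForm.domRestrict₁₂ (N.restrictScalars ℝ) (N.restrictScalars ℝ))
    have hinj : Function.Injective φ := by
      rw [← LinearMap.ker_eq_bot, LinearMap.ker_eq_bot']
      intro m hm
      by_contra h0
      have h1 := hN m m.2 (fun h => h0 (Subtype.ext h))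
      have h2 : (F.toFun (m : E) (m : E)).re = 0 := LinearMap.congr_fun hm m
      exact absurd h1 (by rw [h2]; exact lt_irrefl _)
    have hsurj : Function.Surjective φ :=
      (LinearMap.injective_iff_surjective_of_finrank_eq_finrank
        (Subspace.dual_finrank_eq (K := ℝ) (V := N)).symm).mp hinj
    obtain ⟨n, hn⟩ := hsurj ((F.reForm x).domRestrict (N.restrictScalars ℝ))
    have hx : x - n ∈ F.orth N := by
      refine F.eq_zero_of_re N _ fun m hm => ?_
      have h2 : (F.toFun (n : E) m).re = (F.toFun x m).re := LinearMap.congr_fun hn ⟨m, hm⟩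
      rw [F.sub_left, Quaternion.re_sub, h2, sub_self]
    have := Submodule.add_mem_sup n.2 hx
    rwa [add_sub_cancel] at this

/-- A subspace on which the form is negative is no larger than `Q` when some complement of `Q` is
nonnegative. -/
theorem NegDef.finrank_le {N Q Q' : Submodule ℍ[ℝ]ᵐᵒᵖ E} (hN : F.NegDef N)
    (hQ : ∀ v ∈ Q', 0 ≤ (F.toFun v v).re) (h : IsCompl Q Q') [Module.Finite ℍ[ℝ]ᵐᵒᵖ Q] :
    Module.finrank ℍ[ℝ]ᵐᵒᵖ N ≤ Module.finrank ℍ[ℝ]ᵐᵒᵖ Q := by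
  have hd := hN.disjoint_of_nonneg hQ
  refine LinearMap.finrank_le_finrank_of_injective
    (f := (Q.projectionOnto Q' h).comp N.subtype) ?_
  rw [← LinearMap.ker_eq_bot, LinearMap.ker_eq_bot']
  intro m hm
  rw [LinearMap.comp_apply, Submodule.projectionOnto_apply_eq_zero_iff] at hm
  exact Subtype.ext (Submodule.disjoint_def.mp hd _ m.2 hm)

/-- A negative definite subspace of maximal dimension has a nonnegative orthogonal companion. -/
theorem NegDef.nonneg_of_maximal {N : Submodule ℍ[ℝ]ᵐᵒᵖ E} (hN : F.NegDef N)
    [Module.Finite ℍ[ℝ]ᵐᵒᵖ N]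
    (hmax : ∀ N' : Submodule ℍ[ℝ]ᵐᵒᵖ E, Module.Finite ℍ[ℝ]ᵐᵒᵖ N' → F.NegDef N' →
      Module.finrank ℍ[ℝ]ᵐᵒᵖ N' ≤ Module.finrank ℍ[ℝ]ᵐᵒᵖ N) :
    ∀ v ∈ F.orth N, 0 ≤ (F.toFun v v).re := by
  intro v hv
  by_contra hneg
  push Not at hneg
  -- a vector `v` of negative square orthogonal to `N` would enlarge `N`
  have him : F.toFun v v = ((F.toFun v v).re : ℍ[ℝ]) := by
    have h := F.conj_symm v v
    exact Quaternion.star_eq_self.mp h.symm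
  have hN' : F.NegDef (N ⊔ Submodule.span ℍ[ℝ]ᵐᵒᵖ {v}) := by
    intro x hx hx0
    obtain ⟨n, hn, w, hw, rfl⟩ := Submodule.mem_sup.mp hx
    obtain ⟨a, rfl⟩ := Submodule.mem_span_singleton.mp hw
    have hav := (F.orth N).smul_mem a hv
    have e1 : (F.toFun (a • v) (a • v)).re = ‖a.unop‖ ^ 2 * (F.toFun v v).re := by
      have := F.smul_smul v v a.unop a.unop
      rw [MulOpposite.op_unop] at this
      rw [this, him, mul_assoc, Quaternion.coe_commutes, ← mul_assoc, Quaternion.star_mul_self,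
        ← Quaternion.coe_mul, Quaternion.re_coe, Quaternion.re_coe,
        Quaternion.normSq_eq_norm_mul_self]
      ring
    rw [F.re_add_self, e1, F.orth_symm hav hn]
    rcases eq_or_ne n 0 with rfl | hn0
    · have ha : a.unop ≠ 0 := by
        intro h
        rw [MulOpposite.unop_eq_zero_iff] at h
        exact hx0 (by rw [h]; simp)
      have : 0 < ‖a.unop‖ ^ 2 := by positivity
      have := mul_neg_of_pos_of_neg this hneg
      simpa using this
    · have h1 := hN n hn hn0
      have h2 : ‖a.unop‖ ^ 2 * (F.toFun v v).re ≤ 0 :=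
        mul_nonpos_of_nonneg_of_nonpos (by positivity) hneg.le
      simp only [Quaternion.re_zero]
      linarith
  have h1 := hmax _ inferInstance hN'
  have hlt : N < N ⊔ Submodule.span ℍ[ℝ]ᵐᵒᵖ {v} := by
    refine lt_of_le_of_ne le_sup_left fun h => ?_
    have hvN : v ∈ N := by
      rw [h]
      exact Submodule.mem_sup_right (Submodule.mem_span_singleton_self v)
    rw [hv v hvN] at hneg
    exact lt_irrefl _ hneg
  exact absurd (Submodule.finrank_lt_finrank_of_lt hlt) (not_lt.mpr h1)

end HermForm

/-! ### Isometric linear relations -/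

section Relation

variable {E₁ E₂ : Type*} [AddCommGroup E₁] [Module ℍ[ℝ]ᵐᵒᵖ E₁] [AddCommGroup E₂]
  [Module ℍ[ℝ]ᵐᵒᵖ E₂]

/-- A subspace of the domain of a linear relation lifts linearly to the relation. -/
theorem exists_lift_relation (X : Submodule ℍ[ℝ]ᵐᵒᵖ (E₁ × E₂)) (N : Submodule ℍ[ℝ]ᵐᵒᵖ E₁)
    (hN : N ≤ X.map (LinearMap.fst ℍ[ℝ]ᵐᵒᵖ E₁ E₂)) :
    ∃ τ : N →ₗ[ℍ[ℝ]ᵐᵒᵖ] E₂, ∀ n : N, ((n : E₁), τ n) ∈ X := by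
  let Y := X ⊓ N.comap (LinearMap.fst ℍ[ℝ]ᵐᵒᵖ E₁ E₂)
  let f : Y →ₗ[ℍ[ℝ]ᵐᵒᵖ] N :=
    ((LinearMap.fst ℍ[ℝ]ᵐᵒᵖ E₁ E₂).comp Y.subtype).codRestrict N fun y => y.2.2
  have hf : LinearMap.range f = ⊤ := by
    rw [LinearMap.range_eq_top]
    intro n
    obtain ⟨x, hx, hxn⟩ := hN n.2
    exact ⟨⟨x, hx, by
      change (LinearMap.fst ℍ[ℝ]ᵐᵒᵖ E₁ E₂) x ∈ N
      rw [hxn]; exact n.2⟩, Subtype.ext hxn⟩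
  obtain ⟨g, hg⟩ := f.exists_rightInverse_of_surjective hf
  refine ⟨(LinearMap.snd ℍ[ℝ]ᵐᵒᵖ E₁ E₂).comp (Y.subtype.comp g), fun n => ?_⟩
  have h1 : ((g n : E₁ × E₂)).1 = n := congrArg Subtype.val (LinearMap.congr_fun hg n)
  have h2 := (g n).2.1
  have h3 : ((n : E₁), ((g n : E₁ × E₂)).2) = (g n : E₁ × E₂) := Prod.ext h1.symm rfl
  exact h3 ▸ h2

/-- Negative definite subspaces are carried along isometric relations. -/
theorem exists_negDef_transfer {F₁ : HermForm E₁} {F₂ : HermForm E₂}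
    (X : Submodule ℍ[ℝ]ᵐᵒᵖ (E₁ × E₂))
    (hX : ∀ x ∈ X, (F₁.toFun x.1 x.1).re = (F₂.toFun x.2 x.2).re)
    (N : Submodule ℍ[ℝ]ᵐᵒᵖ E₁) (hN : N ≤ X.map (LinearMap.fst ℍ[ℝ]ᵐᵒᵖ E₁ E₂))
    (hneg : F₁.NegDef N) :
    ∃ τ : N →ₗ[ℍ[ℝ]ᵐᵒᵖ] E₂, (∀ n : N, ((n : E₁), τ n) ∈ X) ∧ Function.Injective τ ∧
      F₂.NegDef (LinearMap.range τ) := by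
  obtain ⟨τ, hτ⟩ := exists_lift_relation X N hN
  refine ⟨τ, hτ, ?_, ?_⟩
  · rw [← LinearMap.ker_eq_bot, LinearMap.ker_eq_bot']
    intro m hm
    by_contra h0
    have h1 := hneg m m.2 (fun h => h0 (Subtype.ext h))
    have h2 := hX _ (hτ m)
    simp only [hm, HermForm.zero_left, Quaternion.re_zero] at h2
    exact absurd h1 (by rw [h2]; exact lt_irrefl _)
  · rintro _ ⟨n, rfl⟩ h0
    have h2 := hX _ (hτ n)
    rw [← h2]
    refine hneg n n.2 fun h => h0 ?_
    have : n = 0 := Subtype.ext h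
    rw [this, map_zero]

/-- Two forms that agree on the generators of a linear relation agree on the relation. -/
theorem isometric_span {F₁ : HermForm E₁} {F₂ : HermForm E₂} {s : Set (E₁ × E₂)}
    (h : ∀ x ∈ s, ∀ y ∈ s, F₁.toFun x.1 y.1 = F₂.toFun x.2 y.2) :
    ∀ x ∈ Submodule.span ℍ[ℝ]ᵐᵒᵖ s, ∀ y ∈ Submodule.span ℍ[ℝ]ᵐᵒᵖ s,
      F₁.toFun x.1 y.1 = F₂.toFun x.2 y.2 := by
  have key : ∀ x ∈ s, ∀ y ∈ Submodule.span ℍ[ℝ]ᵐᵒᵖ s, F₁.toFun x.1 y.1 = F₂.toFun x.2 y.2 := by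
    intro x hx y hy
    induction hy using Submodule.span_induction with
    | mem y hy => exact h x hx y hy
    | zero => simp
    | add y z _ _ hy hz => simp only [Prod.fst_add, Prod.snd_add, HermForm.add_right, hy, hz]
    | smul a y _ hy =>
      have h1 := F₁.smul_right x.1 y.1 a.unop
      have h2 := F₂.smul_right x.2 y.2 a.unop
      rw [MulOpposite.op_unop] at h1 h2
      simp only [Prod.smul_fst, Prod.smul_snd, h1, h2, hy]
  intro x hx y hy
  rw [F₁.conj_symm y.1 x.1, F₂.conj_symm y.2 x.2]
  congr 1
  induction hx using Submodule.span_induction with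
  | mem x hx => rw [F₁.conj_symm x.1 y.1, F₂.conj_symm x.2 y.2, key x hx y hy]
  | zero => simp
  | add u v _ _ hu hv => simp only [Prod.fst_add, Prod.snd_add, HermForm.add_right, hu, hv]
  | smul a v _ hv =>
    have h1 := F₁.smul_right y.1 v.1 a.unop
    have h2 := F₂.smul_right y.2 v.2 a.unop
    rw [MulOpposite.op_unop] at h1 h2
    simp only [Prod.smul_fst, Prod.smul_snd, h1, h2, hv]

end Relation

/-! ### The Hilbert space structure of a fundamental decomposition -/

section FundamentalSymmetry

variable {E : Type*} [AddCommGroup E] [Module ℍ[ℝ]ᵐᵒᵖ E] {Pp Pm : Submodule ℍ[ℝ]ᵐᵒᵖ E}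

/-- The fundamental symmetry `v₊ + v₋ ↦ v₊ - v₋`. -/
def fundSymm (h : IsCompl Pp Pm) : E →ₗ[ℍ[ℝ]ᵐᵒᵖ] E :=
  Pp.projection Pm h - Pm.projection Pp h.symm

theorem proj_add_proj (h : IsCompl Pp Pm) (x : E) :
    Pp.projection Pm h x + Pm.projection Pp h.symm x = x :=
  Submodule.projection_add_projection_eq_self h x

theorem fundSymm_apply (h : IsCompl Pp Pm) (x : E) :
    fundSymm h x = Pp.projection Pm h x - Pm.projection Pp h.symm x := rfl

theorem fundSymm_fundSymm (h : IsCompl Pp Pm) (x : E) : fundSymm h (fundSymm h x) = x := by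
  have h1 : ∀ y, Pp.projection Pm h (Pp.projection Pm h y) = Pp.projection Pm h y := fun y =>
    (Submodule.projection_apply_of_mem_left h (by simp))
  have h2 : ∀ y, Pp.projection Pm h (Pm.projection Pp h.symm y) = 0 := fun y =>
    (Submodule.projection_apply_eq_zero_iff h).mpr (by simp)
  have h3 : ∀ y, Pm.projection Pp h.symm (Pm.projection Pp h.symm y)
      = Pm.projection Pp h.symm y := fun y =>
    (Submodule.projection_apply_of_mem_left h.symm (by simp))
  have h4 : ∀ y, Pm.projection Pp h.symm (Pp.projection Pm h y) = 0 := fun y =>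
    (Submodule.projection_apply_eq_zero_iff h.symm).mpr (by simp)
  simp only [fundSymm_apply, map_sub, h1, h2, h3, h4]
  simpa using proj_add_proj h x

variable {F : HermForm E}

theorem form_fundSymm (h : IsCompl Pp Pm) (ho : ∀ v ∈ Pp, ∀ w ∈ Pm, F.toFun v w = 0) (x y : E) :
    F.toFun x (fundSymm h y) = F.toFun (Pp.projection Pm h x) (Pp.projection Pm h y)
      - F.toFun (Pm.projection Pp h.symm x) (Pm.projection Pp h.symm y) := by
  have ho' : ∀ v ∈ Pp, ∀ w ∈ Pm, F.toFun w v = 0 := fun v hv w hw => by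
    rw [F.conj_symm v w, ho v hv w hw, star_zero]
  conv_lhs => rw [← proj_add_proj h x]
  rw [fundSymm_apply, F.add_left, F.sub_right, F.sub_right,
    ho _ (Submodule.projection_apply_mem h x) _ (Submodule.projection_apply_mem h.symm y),
    ho' _ (Submodule.projection_apply_mem h y) _ (Submodule.projection_apply_mem h.symm x)]
  abel

theorem form_self (h : IsCompl Pp Pm) (ho : ∀ v ∈ Pp, ∀ w ∈ Pm, F.toFun v w = 0) (x : E) :
    F.toFun x x = F.toFun (Pp.projection Pm h x) (Pp.projection Pm h x)
      + F.toFun (Pm.projection Pp h.symm x) (Pm.projection Pp h.symm x) := by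
  have ho' : ∀ v ∈ Pp, ∀ w ∈ Pm, F.toFun w v = 0 := fun v hv w hw => by
    rw [F.conj_symm v w, ho v hv w hw, star_zero]
  conv_lhs => rw [← proj_add_proj h x]
  rw [F.add_left, F.add_right, F.add_right,
    ho _ (Submodule.projection_apply_mem h x) _ (Submodule.projection_apply_mem h.symm x),
    ho' _ (Submodule.projection_apply_mem h x) _ (Submodule.projection_apply_mem h.symm x)]
  abel

theorem hilbertNormSq_eq (h : IsCompl Pp Pm) (ho : ∀ v ∈ Pp, ∀ w ∈ Pm, F.toFun v w = 0) (x : E) :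
    hilbertNormSq F h x = (F.toFun x (fundSymm h x)).re := by
  rw [form_fundSymm h ho, Quaternion.re_sub]; rfl

/-- The semi-inner product `⟨x, y⟩ = Re [x, J y]` of an orthogonal decomposition into a nonnegative
and a nonpositive subspace, with `J` the fundamental symmetry. -/
@[reducible] def fundPreCore (h : IsCompl Pp Pm) (ho : ∀ v ∈ Pp, ∀ w ∈ Pm, F.toFun v w = 0)
    (hp : ∀ v ∈ Pp, 0 ≤ (F.toFun v v).re) (hm : ∀ v ∈ Pm, (F.toFun v v).re ≤ 0) :
    let _ := realModule E; PreInnerProductSpace.Core ℝ E :=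
  letI := realModule E
  haveI := realModule_isScalarTower E
  { inner := fun x y => (F.toFun x (fundSymm h y)).re
    conj_inner_symm := fun x y => by
      simp only [conj_trivial]
      rw [form_fundSymm h ho x y, form_fundSymm h ho y x,
        Quaternion.re_sub, Quaternion.re_sub, F.re_symm, F.re_symm (Pm.projection Pp _ y)]
    re_inner_nonneg := fun x => by
      change 0 ≤ (F.toFun x (fundSymm h x)).re
      rw [form_fundSymm h ho, Quaternion.re_sub, sub_nonneg]
      exact (hm _ (by simp)).trans (hp _ (by simp))
    add_left := fun x y z => by rw [F.add_left]; rfl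
    smul_left := fun x y r => by
      exact LinearMap.congr_fun (F.reForm.map_smul r x) (fundSymm h y) }

variable (hd : IsFundamentalDecomposition F Pp Pm)
include hd

theorem IsFundamentalDecomposition.nonneg : ∀ v ∈ Pp, 0 ≤ (F.toFun v v).re := fun v hv => by
  by_cases h0 : v = 0
  · rw [h0]; simp
  · exact (hd.pos v hv h0).le

theorem IsFundamentalDecomposition.nonpos : ∀ v ∈ Pm, (F.toFun v v).re ≤ 0 := fun v hv => by
  by_cases h0 : v = 0
  · rw [h0]; simp
  · exact (hd.neg v hv h0).le

/-- The inner product `⟨x, y⟩ = Re [x, J y]` of a fundamental decomposition. -/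
@[reducible] def fundCore : let _ := realModule E; InnerProductSpace.Core ℝ E :=
  letI := realModule E
  { fundPreCore hd.isCompl hd.orthogonal hd.nonneg hd.nonpos with
    definite := fun x hx => by
      change (F.toFun x (fundSymm hd.isCompl x)).re = 0 at hx
      rw [form_fundSymm hd.isCompl hd.orthogonal, Quaternion.re_sub] at hx
      have h1 := hd.nonneg (Pp.projection Pm hd.isCompl x) (by simp)
      have h2 := hd.nonpos (Pm.projection Pp hd.isCompl.symm x) (by simp)
      have h3 : Pp.projection Pm hd.isCompl x = 0 := by
        by_contra h0
        have := hd.pos _ (by simp) h0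
        linarith
      have h4 : Pm.projection Pp hd.isCompl.symm x = 0 := by
        by_contra h0
        have := hd.neg _ (by simp) h0
        linarith
      rw [← proj_add_proj hd.isCompl x, h3, h4, add_zero] }

/-- The Hilbert space norm of a fundamental decomposition. -/
@[reducible] def fundNormed : NormedAddCommGroup E :=
  letI := realModule E
  @InnerProductSpace.Core.toNormedAddCommGroup ℝ E _ _ _ (fundCore hd)

/-- The real inner product space of a fundamental decomposition. -/
@[reducible] def fundInner :
    letI := fundNormed hd
    InnerProductSpace ℝ E :=
  letI := realModule E
  letI := fundNormed hd
  InnerProductSpace.ofCore (fundCore hd).toCore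

end FundamentalSymmetry

/-- The norm of `E` is the Hilbert space norm of the orthogonal decomposition `E = E₊ + E₋` for
the form `F`. -/
structure IsKreinNorm {E : Type*} [NormedAddCommGroup E] [InnerProductSpace ℝ E]
    [Module ℍ[ℝ]ᵐᵒᵖ E] (F : HermForm E) {Pp Pm : Submodule ℍ[ℝ]ᵐᵒᵖ E} (h : IsCompl Pp Pm) :
    Prop where
  tower : IsScalarTower ℝ ℍ[ℝ]ᵐᵒᵖ E
  orthogonal : ∀ v ∈ Pp, ∀ w ∈ Pm, F.toFun v w = 0
  inner_eq : ∀ x y : E, inner ℝ x y = (F.toFun x (fundSymm h y)).re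

theorem IsFundamentalDecomposition.isKreinNorm {E : Type*} [AddCommGroup E] [Module ℍ[ℝ]ᵐᵒᵖ E]
    {Pp Pm : Submodule ℍ[ℝ]ᵐᵒᵖ E} {F : HermForm E} (hd : IsFundamentalDecomposition F Pp Pm) :
    letI := fundNormed hd
    letI := fundInner hd
    IsKreinNorm F hd.isCompl := by
  let _ := fundNormed hd
  let _ := fundInner hd
  exact ⟨realModule_isScalarTower E, hd.orthogonal, fun x y => rfl⟩

namespace IsKreinNorm

variable {E : Type*} [NormedAddCommGroup E] [InnerProductSpace ℝ E]
    [Module ℍ[ℝ]ᵐᵒᵖ E] {F : HermForm E} {Pp Pm : Submodule ℍ[ℝ]ᵐᵒᵖ E} {h : IsCompl Pp Pm}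

theorem re_eq_inner (K : IsKreinNorm F h) (x y : E) :
    (F.toFun x y).re = inner ℝ x (fundSymm h y) := by
  rw [K.inner_eq, fundSymm_fundSymm]

theorem norm_sq (K : IsKreinNorm F h) (x : E) : ‖x‖ ^ 2 = hilbertNormSq F h x := by
  rw [hilbertNormSq_eq h K.orthogonal, ← K.inner_eq, real_inner_self_eq_norm_sq]

theorem norm_fundSymm (K : IsKreinNorm F h) (x : E) : ‖fundSymm h x‖ = ‖x‖ := by
  have : ‖fundSymm h x‖ ^ 2 = ‖x‖ ^ 2 := by
    rw [← real_inner_self_eq_norm_sq, K.inner_eq, fundSymm_fundSymm, F.re_symm, ← K.inner_eq,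
      real_inner_self_eq_norm_sq]
  exact (pow_left_inj₀ (norm_nonneg _) (norm_nonneg _) two_ne_zero).mp this

theorem norm_smul_op (K : IsKreinNorm F h) (x : E) (a : ℍ[ℝ]) : ‖x <• a‖ = ‖x‖ * ‖a‖ := by
  have : ‖x <• a‖ ^ 2 = (‖x‖ * ‖a‖) ^ 2 := by
    rw [← real_inner_self_eq_norm_sq, K.inner_eq, map_smul, F.smul_smul, mul_assoc, mul_pow,
      ← real_inner_self_eq_norm_sq x, K.inner_eq]
    have : ∀ p : ℍ[ℝ], (star a * (p * a)).re = p.re * ‖a‖ ^ 2 := fun p => by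
      rw [sq, ← Quaternion.normSq_eq_norm_mul_self, Quaternion.normSq_def']
      simp; ring
    exact this _
  exact (pow_left_inj₀ (norm_nonneg _) (by positivity) two_ne_zero).mp this

theorem continuousConstSMul (K : IsKreinNorm F h) : IsBoundedSMul ℍ[ℝ]ᵐᵒᵖ E :=
  IsBoundedSMul.of_norm_smul_le fun a x => by
    have := K.norm_smul_op x a.unop
    rw [MulOpposite.op_unop] at this
    rw [this, mul_comm]; rfl

theorem norm_form_le (K : IsKreinNorm F h) (x y : E) : ‖F.toFun x y‖ ≤ ‖x‖ * ‖y‖ := by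
  have h1 : ∀ z, (F.toFun x z).re ≤ ‖x‖ * ‖z‖ := fun z => by
    rw [K.re_eq_inner, ← K.norm_fundSymm z]
    exact real_inner_le_norm _ _
  -- twisting `y` by `[x, y]` turns the bound on the real part into one on the norm
  have h2 := h1 (y <• F.toFun x y)
  rw [F.smul_right, Quaternion.star_mul_self, K.norm_smul_op, Quaternion.re_coe,
    Quaternion.normSq_eq_norm_mul_self, ← mul_assoc] at h2
  rcases (norm_nonneg (F.toFun x y)).eq_or_lt with h0 | h0
  · rw [← h0]; positivity
  · exact le_of_mul_le_mul_right h2 h0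

theorem re_self (K : IsKreinNorm F h) (x : E) : (F.toFun x x).re
    = ‖Pp.projection Pm h x‖ ^ 2 - ‖Pm.projection Pp h.symm x‖ ^ 2 := by
  have hp : Pm.projection Pp h.symm (Pp.projection Pm h x) = 0 :=
    (Submodule.projection_apply_eq_zero_iff h.symm).mpr (by simp)
  have hm : Pp.projection Pm h (Pm.projection Pp h.symm x) = 0 :=
    (Submodule.projection_apply_eq_zero_iff h).mpr (by simp)
  have hpp : Pp.projection Pm h (Pp.projection Pm h x) = Pp.projection Pm h x :=
    (Submodule.projection_apply_of_mem_left h (by simp))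
  have hmm : Pm.projection Pp h.symm (Pm.projection Pp h.symm x) = Pm.projection Pp h.symm x :=
    (Submodule.projection_apply_of_mem_left h.symm (by simp))
  rw [K.norm_sq, K.norm_sq, form_self h K.orthogonal]
  simp [hilbertNormSq, hp, hm, hpp, hmm]

theorem re_self_le (K : IsKreinNorm F h) (x : E) : (F.toFun x x).re ≤ ‖x‖ ^ 2 := by
  rw [K.re_eq_inner, sq]
  refine (real_inner_le_norm _ _).trans_eq ?_
  rw [K.norm_fundSymm]

theorem norm_sq_eq_add (K : IsKreinNorm F h) (x : E) : ‖x‖ ^ 2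
    = ‖Pp.projection Pm h x‖ ^ 2 + ‖Pm.projection Pp h.symm x‖ ^ 2 := by
  have hp : Pm.projection Pp h.symm (Pp.projection Pm h x) = 0 :=
    (Submodule.projection_apply_eq_zero_iff h.symm).mpr (by simp)
  have hm : Pp.projection Pm h (Pm.projection Pp h.symm x) = 0 :=
    (Submodule.projection_apply_eq_zero_iff h).mpr (by simp)
  have hpp : Pp.projection Pm h (Pp.projection Pm h x) = Pp.projection Pm h x :=
    (Submodule.projection_apply_of_mem_left h (by simp))
  have hmm : Pm.projection Pp h.symm (Pm.projection Pp h.symm x) = Pm.projection Pp h.symm x :=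
    (Submodule.projection_apply_of_mem_left h.symm (by simp))
  rw [K.norm_sq, K.norm_sq, K.norm_sq]
  simp [hilbertNormSq, hp, hm, hpp, hmm]
  ring

end IsKreinNorm

/-- The norm of a fundamental decomposition is complete: `E₊` is by definition, and `E₋` is finite
dimensional. -/
theorem IsFundamentalDecomposition.completeSpace {E : Type*} [AddCommGroup E] [Module ℍ[ℝ]ᵐᵒᵖ E]
    {Pp Pm : Submodule ℍ[ℝ]ᵐᵒᵖ E} {F : HermForm E} (hd : IsFundamentalDecomposition F Pp Pm) :
    letI := fundNormed hd
    CompleteSpace E := by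
  let _ := fundNormed hd
  let _ := fundInner hd
  have K : IsKreinNorm F hd.isCompl := hd.isKreinNorm
  have := K.tower
  have := hd.finite
  have hfin : FiniteDimensional ℝ Pm := Module.Finite.trans ℍ[ℝ]ᵐᵒᵖ Pm
  have hfin' : FiniteDimensional ℝ (Pm.restrictScalars ℝ) := hfin
  -- both components of a Cauchy sequence are Cauchy
  refine Metric.complete_of_cauchySeq_tendsto fun u hu => ?_
  set a : ℕ → E := fun n => Pp.projection Pm hd.isCompl (u n) with ha
  set b : ℕ → E := fun n => Pm.projection Pp hd.isCompl.symm (u n) with hb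
  have hpos : ∀ v ∈ Pp, (F.toFun v v).re = ‖v‖ ^ 2 := fun v hv => by
    rw [K.re_self, Submodule.projection_apply_of_mem_left _ hv,
      (Submodule.projection_apply_eq_zero_iff hd.isCompl.symm).mpr hv]
    simp
  have hau : ∀ m n, ‖a m - a n‖ ≤ ‖u m - u n‖ := fun m n => by
    refine le_of_sq_le_sq ?_ (norm_nonneg _)
    rw [K.norm_sq_eq_add (u m - u n), map_sub, map_sub]
    nlinarith [sq_nonneg ‖b m - b n‖]
  have hbu : ∀ m n, ‖b m - b n‖ ≤ ‖u m - u n‖ := fun m n => by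
    refine le_of_sq_le_sq ?_ (norm_nonneg _)
    rw [K.norm_sq_eq_add (u m - u n), map_sub, map_sub]
    nlinarith [sq_nonneg ‖a m - a n‖]
  have hap : ∀ n, a n ∈ Pp := fun n => by simp [a]
  have hbp : ∀ n, b n ∈ Pm := fun n => by simp [b]
  rw [Metric.cauchySeq_iff] at hu
  obtain ⟨v, hv, hv'⟩ := hd.complete a hap (fun ε hε => by
    obtain ⟨N, hN⟩ := hu (Real.sqrt ε) (Real.sqrt_pos.mpr hε)
    refine ⟨N, fun m hm n hn => ?_⟩
    rw [hpos _ (Pp.sub_mem (hap m) (hap n))]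
    have h1 := (hau m n).trans_lt ((dist_eq_norm (u m) (u n)) ▸ hN m hm n hn)
    calc ‖a m - a n‖ ^ 2 < Real.sqrt ε ^ 2 := by gcongr
      _ = ε := Real.sq_sqrt hε.le)
  have hav : Filter.Tendsto a Filter.atTop (nhds v) := by
    rw [tendsto_iff_norm_sub_tendsto_zero]
    have : (fun n => ‖a n - v‖) = fun n => Real.sqrt ((F.toFun (a n - v) (a n - v)).re) := by
      funext n
      rw [hpos _ (Pp.sub_mem (hap n) hv), Real.sqrt_sq (norm_nonneg _)]
    rw [this]
    have h0 := (Real.continuous_sqrt.tendsto 0).comp hv'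
    rwa [Real.sqrt_zero] at h0
  have hcl : IsComplete ((Pm.restrictScalars ℝ : Submodule ℝ E) : Set E) :=
    Submodule.complete_of_finiteDimensional _
  obtain ⟨w, hw, hw'⟩ := cauchySeq_tendsto_of_isComplete hcl (u := b) hbp (by
    rw [Metric.cauchySeq_iff]
    intro ε hε
    obtain ⟨N, hN⟩ := hu ε hε
    refine ⟨N, fun m hm n hn => ?_⟩
    rw [dist_eq_norm]
    exact (hbu m n).trans_lt ((dist_eq_norm (u m) (u n)) ▸ hN m hm n hn))
  refine ⟨v + w, ?_⟩
  have := hav.add hw'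
  simpa only [ha, hb, proj_add_proj] using this

/-! ### Perturbation of negative definite subspaces -/

/-- A finite dimensional negative definite subspace in the closure of `D` can be moved into `D`:
negativity on the compact unit sphere of coefficients is an open condition on a basis. -/
theorem exists_negDef_of_closure {E : Type*} [NormedAddCommGroup E] [Module ℍ[ℝ]ᵐᵒᵖ E]
    [IsBoundedSMul ℍ[ℝ]ᵐᵒᵖ E] {F : HermForm E} (hF : Continuous fun x => (F.toFun x x).re)
    (D N : Submodule ℍ[ℝ]ᵐᵒᵖ E) [Module.Finite ℍ[ℝ]ᵐᵒᵖ N] (hN : F.NegDef N)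
    (hND : (N : Set E) ⊆ closure (D : Set E)) :
    ∃ N' ≤ D, Module.Finite ℍ[ℝ]ᵐᵒᵖ N' ∧ F.NegDef N' ∧
      Module.finrank ℍ[ℝ]ᵐᵒᵖ N' = Module.finrank ℍ[ℝ]ᵐᵒᵖ N := by
  set n := Module.finrank ℍ[ℝ]ᵐᵒᵖ N with hn
  let b := Module.finBasis ℍ[ℝ]ᵐᵒᵖ N
  have : ProperSpace (Fin n → ℍ[ℝ]ᵐᵒᵖ) := FiniteDimensional.proper ℝ _
  let Φ : (Fin n → E) → (Fin n → ℍ[ℝ]ᵐᵒᵖ) → E := fun v x => ∑ i, x i • v i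
  have hΦ : Continuous fun q : (Fin n → E) × (Fin n → ℍ[ℝ]ᵐᵒᵖ) => Φ q.1 q.2 := by
    refine continuous_finsetSum _ fun i _ => ?_
    exact ((continuous_apply i).comp continuous_snd).smul ((continuous_apply i).comp continuous_fst)
  let v₀ : Fin n → E := fun i => b i
  have hv₀ : ∀ x, x ≠ 0 → (F.toFun (Φ v₀ x) (Φ v₀ x)).re < 0 := by
    intro x hx
    have h1 : Φ v₀ x = ((∑ i, x i • b i : N) : E) := by simp [Φ, v₀]
    rw [h1]
    refine hN _ (Subtype.mem _) fun h0 => hx ?_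
    have h2 := Fintype.linearIndependent_iff.mp b.linearIndependent x (Subtype.ext h0)
    exact funext h2
  have hev : ∀ᶠ v in nhds v₀, ∀ x ∈ Metric.sphere (0 : Fin n → ℍ[ℝ]ᵐᵒᵖ) 1,
      (F.toFun (Φ v x) (Φ v x)).re < 0 := by
    refine (isCompact_sphere _ _).eventually_forall_of_forall_eventually fun x hx => ?_
    have hx0 : x ≠ 0 := by
      rintro rfl
      simp at hx
    exact ((hF.comp hΦ).tendsto (v₀, x)).eventually (gt_mem_nhds (hv₀ x hx0))
  have hcl : v₀ ∈ closure (Set.univ.pi fun _ : Fin n => (D : Set E)) := by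
    rw [closure_pi_set]
    exact fun i _ => hND (b i).2
  obtain ⟨v, hv, hvD⟩ := mem_closure_iff_nhds.mp hcl _ hev
  have hneg : ∀ x, x ≠ 0 → (F.toFun (Φ v x) (Φ v x)).re < 0 := by
    intro x hx
    have hx' : 0 < ‖x‖ := norm_pos_iff.mpr hx
    have h1 := hv (‖x‖⁻¹ • x) (by
      rw [mem_sphere_zero_iff_norm, norm_smul, norm_inv, norm_norm, inv_mul_cancel₀ hx'.ne'])
    have h2 : Φ v (‖x‖⁻¹ • x) = Φ v x <• ((‖x‖⁻¹ : ℝ) : ℍ[ℝ]) := by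
      simp only [Φ, Finset.smul_sum, smul_smul]
      refine Finset.sum_congr rfl fun i _ => ?_
      congr 1
      rw [Pi.smul_apply, Algebra.smul_def]
      rfl
    rw [h2, F.smul_smul, Quaternion.star_coe, Quaternion.coe_mul_eq_smul,
      ← Quaternion.coe_commutes, Quaternion.coe_mul_eq_smul] at h1
    simp only [Quaternion.re_smul, smul_eq_mul] at h1
    have h3 : 0 < ‖x‖⁻¹ := inv_pos.mpr hx'
    by_contra hcon
    push Not at hcon
    have : 0 ≤ ‖x‖⁻¹ * (‖x‖⁻¹ * (F.toFun (Φ v x) (Φ v x)).re) := by positivity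
    linarith
  let f : (Fin n → ℍ[ℝ]ᵐᵒᵖ) →ₗ[ℍ[ℝ]ᵐᵒᵖ] E := Fintype.linearCombination ℍ[ℝ]ᵐᵒᵖ v
  have hf : ∀ x, f x = Φ v x := fun x => Fintype.linearCombination_apply ℍ[ℝ]ᵐᵒᵖ v x
  have hinj : Function.Injective f := by
    rw [← LinearMap.ker_eq_bot, LinearMap.ker_eq_bot']
    intro x hx
    by_contra h0
    have := hneg x h0
    rw [← hf, hx] at this
    simp at this
  refine ⟨LinearMap.range f, ?_, inferInstance, ?_, ?_⟩
  · rintro _ ⟨x, rfl⟩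
    rw [hf]
    exact D.sum_mem fun i _ => D.smul_mem _ (hvD i trivial)
  · rintro _ ⟨x, rfl⟩ h0
    rw [hf]
    refine hneg x fun h => h0 ?_
    rw [h, map_zero]
  · rw [LinearMap.finrank_range_of_inj hinj, Module.finrank_fin_fun]

/-- Compactness of the unit sphere: a negative definite form is uniformly negative. -/
theorem HermForm.NegDef.uniformly_neg {E : Type*} [NormedAddCommGroup E] [NormedSpace ℝ E]
    [Module ℍ[ℝ]ᵐᵒᵖ E] [IsScalarTower ℝ ℍ[ℝ]ᵐᵒᵖ E] {F : HermForm E}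
    {N : Submodule ℍ[ℝ]ᵐᵒᵖ E} [Module.Finite ℍ[ℝ]ᵐᵒᵖ N]
    (hN : F.NegDef N) (hF : Continuous fun x => (F.toFun x x).re) :
    ∃ ε > 0, ε ≤ 1 ∧ ∀ n ∈ N, (F.toFun n n).re ≤ -ε * ‖n‖ ^ 2 := by
  have : FiniteDimensional ℝ N := Module.Finite.trans ℍ[ℝ]ᵐᵒᵖ N
  have : FiniteDimensional ℝ (N.restrictScalars ℝ) := this
  have : ProperSpace (N.restrictScalars ℝ) := FiniteDimensional.proper ℝ _
  obtain ⟨ε₀, hε₀, hε₀'⟩ : ∃ ε > 0, ∀ n ∈ N, (F.toFun n n).re ≤ -ε * ‖n‖ ^ 2 := by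
    have hcont : Continuous fun n : N.restrictScalars ℝ => (F.toFun (n : E) n).re :=
      hF.comp continuous_subtype_val
    rcases (Metric.sphere (0 : N.restrictScalars ℝ) 1).eq_empty_or_nonempty with he | hne
    · refine ⟨1, one_pos, fun n hn => ?_⟩
      by_cases h0 : n = 0
      · simp [h0]
      · exfalso
        have h0' : ‖n‖ ≠ 0 := norm_ne_zero_iff.mpr h0
        have : (‖n‖⁻¹ • ⟨n, hn⟩ : N.restrictScalars ℝ) ∈
            Metric.sphere (0 : N.restrictScalars ℝ) 1 := by
          rw [mem_sphere_zero_iff_norm, norm_smul, norm_inv, norm_norm]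
          exact inv_mul_cancel₀ h0'
        rw [he] at this
        exact this
    · obtain ⟨m, hm, hmax⟩ := (isCompact_sphere (0 : N.restrictScalars ℝ) 1).exists_isMaxOn hne
        hcont.continuousOn
      have hm0 : (m : E) ≠ 0 := by
        intro h0
        have : m = 0 := Subtype.ext h0
        rw [this] at hm
        simp at hm
      refine ⟨-(F.toFun (m : E) m).re, neg_pos.mpr (hN m m.2 hm0), fun n hn => ?_⟩
      by_cases h0 : n = 0
      · simp [h0]
      · have h0' : 0 < ‖n‖ := norm_pos_iff.mpr h0
        have h1 := hmax (show (‖n‖⁻¹ • ⟨n, hn⟩ : N.restrictScalars ℝ) ∈ _ by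
          rw [mem_sphere_zero_iff_norm, norm_smul, norm_inv, norm_norm]
          exact inv_mul_cancel₀ h0'.ne')
        have h2 : (F.toFun (‖n‖⁻¹ • n) (‖n‖⁻¹ • n)).re = ‖n‖⁻¹ * (‖n‖⁻¹ * (F.toFun n n).re) := by
          rw [← F.reForm_apply, map_smul, map_smul]; rfl
        have h3 : ‖n‖⁻¹ * (‖n‖⁻¹ * (F.toFun n n).re) ≤ (F.toFun (m : E) m).re := h2 ▸ h1
        rw [neg_neg]
        calc (F.toFun n n).re = ‖n‖ ^ 2 * (‖n‖⁻¹ * (‖n‖⁻¹ * (F.toFun n n).re)) := by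
              field_simp
          _ ≤ ‖n‖ ^ 2 * (F.toFun (m : E) m).re := by gcongr
          _ = _ := mul_comm _ _
  refine ⟨min ε₀ 1, lt_min hε₀ one_pos, min_le_right _ _, fun n hn => (hε₀' n hn).trans ?_⟩
  have := min_le_left ε₀ 1
  gcongr

/-! ### Krein norms: density, Riesz representation and uniform positivity -/

namespace IsKreinNorm

variable {E : Type*} [NormedAddCommGroup E] [InnerProductSpace ℝ E]
    [Module ℍ[ℝ]ᵐᵒᵖ E] {F : HermForm E} {Pp Pm : Submodule ℍ[ℝ]ᵐᵒᵖ E} {h : IsCompl Pp Pm}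

theorem continuous_fundSymm (K : IsKreinNorm F h) : Continuous (fundSymm h) :=
  (AddMonoidHomClass.isometry_of_norm (fundSymm h) K.norm_fundSymm).continuous

theorem continuous_left (K : IsKreinNorm F h) (y : E) : Continuous fun x => F.toFun x y := by
  have := AddMonoidHomClass.continuous_of_bound
    (AddMonoidHom.mk' (fun x => F.toFun x y) fun a b => F.add_left a b y) ‖y‖
    fun x => by rw [mul_comm]; exact K.norm_form_le x y
  exact this

theorem continuous_right (K : IsKreinNorm F h) (y : E) : Continuous fun x => F.toFun y x := by
  have := AddMonoidHomClass.continuous_of_bound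
    (AddMonoidHom.mk' (fun x => F.toFun y x) fun a b => F.add_right y a b) ‖y‖
    fun x => K.norm_form_le y x
  exact this

theorem continuous_self (K : IsKreinNorm F h) : Continuous fun x => (F.toFun x x).re := by
  simp_rw [K.re_eq_inner]
  exact continuous_id.inner K.continuous_fundSymm

theorem eq_zero (K : IsKreinNorm F h) {x : E} (hx : ∀ y, (F.toFun x y).re = 0) : x = 0 := by
  have := hx (fundSymm h x)
  rwa [← K.inner_eq, inner_self_eq_zero] at this

/-- A subspace with trivial orthogonal companion for the form is dense for the norm. -/
theorem dense (K : IsKreinNorm F h) [CompleteSpace E] {D : Submodule ℍ[ℝ]ᵐᵒᵖ E}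
    (hD : ∀ x, (∀ y ∈ D, F.toFun x y = 0) → x = 0) : Dense (D : Set E) := by
  have := K.tower
  have h1 : (D.restrictScalars ℝ).topologicalClosure = ⊤ := by
    rw [Submodule.topologicalClosure_eq_top_iff, Submodule.eq_bot_iff]
    intro x hx
    rw [Submodule.mem_orthogonal] at hx
    have h2 : fundSymm h x = 0 := by
      refine hD _ (F.eq_zero_of_re D _ fun n hn => ?_)
      rw [F.re_symm, ← K.inner_eq]
      exact hx n hn
    rw [← fundSymm_fundSymm h x, h2, map_zero]
  have h3 := (Submodule.dense_iff_topologicalClosure_eq_top (s := D.restrictScalars ℝ)).mpr h1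
  exact h3

theorem negDef (K : IsKreinNorm F h) : F.NegDef Pm := fun v hv h0 => by
  rw [K.re_self, (Submodule.projection_apply_eq_zero_iff h).mpr hv,
    Submodule.projection_apply_of_mem_left h.symm hv]
  have : 0 < ‖v‖ := norm_pos_iff.mpr h0
  simp only [norm_zero]
  nlinarith

/-- A dense subspace contains a negative definite subspace of the dimension of `E₋`. -/
theorem exists_negDef (K : IsKreinNorm F h) [CompleteSpace E] [Module.Finite ℍ[ℝ]ᵐᵒᵖ Pm]
    {D : Submodule ℍ[ℝ]ᵐᵒᵖ E}
    (hD : ∀ x, (∀ y ∈ D, F.toFun x y = 0) → x = 0) :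
    ∃ N ≤ D, Module.Finite ℍ[ℝ]ᵐᵒᵖ N ∧ F.NegDef N ∧
      Module.finrank ℍ[ℝ]ᵐᵒᵖ N = Module.finrank ℍ[ℝ]ᵐᵒᵖ Pm := by
  have := K.continuousConstSMul
  exact exists_negDef_of_closure K.continuous_self D Pm K.negDef
    (by rw [(K.dense hD).closure_eq]; exact Set.subset_univ _)

/-- Riesz representation with respect to the form. -/
theorem riesz (K : IsKreinNorm F h) [CompleteSpace E] (f : StrongDual ℝ E) :
    ∃ u, ∀ x, (F.toFun u x).re = f x := by
  refine ⟨fundSymm h ((InnerProductSpace.toDual ℝ E).symm f), fun x => ?_⟩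
  rw [F.re_symm, ← K.inner_eq, real_inner_comm, InnerProductSpace.toDual_symm_apply]

theorem uniformly_neg (K : IsKreinNorm F h) {N : Submodule ℍ[ℝ]ᵐᵒᵖ E} [Module.Finite ℍ[ℝ]ᵐᵒᵖ N]
    (hN : F.NegDef N) : ∃ ε > 0, ε ≤ 1 ∧ ∀ n ∈ N, (F.toFun n n).re ≤ -ε * ‖n‖ ^ 2 := by
  have := K.tower
  exact hN.uniformly_neg K.continuous_self

/-- A negative definite subspace of full dimension is a graph over `E₋` of a strict contraction;
so its orthogonal companion is the graph over `E₊` of a strict contraction, and the form is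
uniformly positive there. -/
theorem uniformly_pos (K : IsKreinNorm F h) [Module.Finite ℍ[ℝ]ᵐᵒᵖ Pm]
    {N : Submodule ℍ[ℝ]ᵐᵒᵖ E} [Module.Finite ℍ[ℝ]ᵐᵒᵖ N] (hN : F.NegDef N)
    (hdim : Module.finrank ℍ[ℝ]ᵐᵒᵖ N = Module.finrank ℍ[ℝ]ᵐᵒᵖ Pm) :
    ∃ δ > 0, ∀ x ∈ F.orth N, δ * ‖x‖ ^ 2 ≤ (F.toFun x x).re := by
  obtain ⟨ε, hε, hε1, hε'⟩ := K.uniformly_neg hN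
  -- `N` projects onto `E₋`
  have hsurj : ∀ w ∈ Pm, ∃ n ∈ N, Pm.projection Pp h.symm n = w := by
    let g : N →ₗ[ℍ[ℝ]ᵐᵒᵖ] Pm := (Pm.projectionOnto Pp h.symm).comp N.subtype
    have hg : Function.Injective g := by
      rw [← LinearMap.ker_eq_bot, LinearMap.ker_eq_bot']
      intro m hm
      rw [LinearMap.comp_apply, Submodule.projectionOnto_apply_eq_zero_iff] at hm
      by_contra h0
      have h1 := hN m m.2 (fun h => h0 (Subtype.ext h))
      rw [K.re_self, show Pm.projection Pp h.symm (m : E) = 0 from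
        (Submodule.projection_apply_eq_zero_iff h.symm).mpr hm, norm_zero] at h1
      nlinarith [sq_nonneg ‖Pp.projection Pm h (m : E)‖]
    intro w hw
    obtain ⟨n, hn⟩ := (LinearMap.injective_iff_surjective_of_finrank_eq_finrank hdim).mp hg ⟨w, hw⟩
    exact ⟨n, n.2, congrArg Subtype.val hn⟩
  refine ⟨ε / 2, by positivity, fun x hx => ?_⟩
  obtain ⟨n, hn, hnx⟩ := hsurj (Pm.projection Pp h.symm x) (by simp)
  have h0 : (F.toFun x (fundSymm h (fundSymm h n))).re = 0 := by
    rw [fundSymm_fundSymm, hx n hn]; rfl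
  have hjn : fundSymm h n = Pp.projection Pm h n - Pm.projection Pp h.symm x := by
    rw [fundSymm_apply, hnx]
  -- `[x, n] = 0` with `n₋ = x₋` says that `⟨x₊, n₊⟩ = |x₋|²`
  have hxn : inner ℝ (Pp.projection Pm h x) (Pp.projection Pm h n)
      = ‖Pm.projection Pp h.symm x‖ ^ 2 := by
    have hp : ∀ y, Pm.projection Pp h.symm (Pp.projection Pm h y) = 0 := fun y =>
      (Submodule.projection_apply_eq_zero_iff h.symm).mpr (by simp)
    have hm : ∀ y, Pp.projection Pm h (Pm.projection Pp h.symm y) = 0 := fun y =>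
      (Submodule.projection_apply_eq_zero_iff h).mpr (by simp)
    have hpp : ∀ y, Pp.projection Pm h (Pp.projection Pm h y) = Pp.projection Pm h y := fun y =>
      (Submodule.projection_apply_of_mem_left h (by simp))
    have hmm : ∀ y, Pm.projection Pp h.symm (Pm.projection Pp h.symm y)
        = Pm.projection Pp h.symm y := fun y =>
      (Submodule.projection_apply_of_mem_left h.symm (by simp))
    rw [← real_inner_self_eq_norm_sq, K.inner_eq, K.inner_eq, fundSymm_apply, fundSymm_apply]
    simp only [hp, hm, hpp, hmm, sub_zero, zero_sub, F.neg_right, Quaternion.re_neg]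
    have h1 := form_fundSymm h K.orthogonal x (fundSymm h n)
    rw [fundSymm_fundSymm, hx n hn, fundSymm_apply] at h1
    simp only [map_sub, hp, hm, hpp, hmm, sub_zero, zero_sub, F.neg_right, hnx] at h1
    have h2 := congrArg (fun q : ℍ[ℝ] => q.re) h1
    simp only [Quaternion.re_sub, Quaternion.re_neg, Quaternion.re_zero] at h2
    linarith
  have h1 := hε' n hn
  rw [K.re_self, K.norm_sq_eq_add n, hnx] at h1
  have h2 := real_inner_le_norm (Pp.projection Pm h x) (Pp.projection Pm h n)
  rw [hxn] at h2
  rw [K.re_self, K.norm_sq_eq_add x]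
  set a := ‖Pp.projection Pm h x‖
  set b := ‖Pm.projection Pp h.symm x‖
  set c := ‖Pp.projection Pm h n‖
  have ha : 0 ≤ a := norm_nonneg _
  have hb : 0 ≤ b := norm_nonneg _
  have hc : 0 ≤ c := norm_nonneg _
  -- `c² ≤ (1 - ε) b²` on `N` and `b² ≤ a c` give `b² ≤ (1 - ε) a²`
  have h3 : c ^ 2 ≤ (1 - ε) * b ^ 2 := by nlinarith [sq_nonneg c]
  have h4 : b ^ 2 ≤ (1 - ε) * a ^ 2 := by
    rcases hb.eq_or_lt with hb0 | hb0
    · rw [← hb0]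
      have : 0 ≤ (1 - ε) * a ^ 2 := mul_nonneg (sub_nonneg.mpr hε1) (sq_nonneg a)
      simpa using this
    · have h5 : (b ^ 2) ^ 2 ≤ (a * c) ^ 2 := by gcongr
      have h6 : b ^ 2 * b ^ 2 ≤ b ^ 2 * ((1 - ε) * a ^ 2) := by nlinarith [sq_nonneg a]
      exact le_of_mul_le_mul_left h6 (by positivity)
  have h5 : b ^ 2 ≤ a ^ 2 := h4.trans (by nlinarith [sq_nonneg a])
  have h6 : ε * b ^ 2 ≤ ε * a ^ 2 := by gcongr
  linarith

end IsKreinNorm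

/-! ### Isometric relations with dense domain -/

section Isometry

/-- An isometric relation between Pontryagin spaces of the same index is bounded as soon as its
domain is dense: the domain contains a negative definite subspace of full dimension, so does the
range, and on the orthogonal companion of the latter the form controls the norm. -/
theorem IsKreinNorm.bound_of_isometric {E₁ E₂ : Type*}
    [NormedAddCommGroup E₁] [InnerProductSpace ℝ E₁] [CompleteSpace E₁] [Module ℍ[ℝ]ᵐᵒᵖ E₁]
    [NormedAddCommGroup E₂] [InnerProductSpace ℝ E₂] [Module ℍ[ℝ]ᵐᵒᵖ E₂]
    {F₁ : HermForm E₁} {Pp₁ Pm₁ : Submodule ℍ[ℝ]ᵐᵒᵖ E₁} {h₁ : IsCompl Pp₁ Pm₁}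
    {F₂ : HermForm E₂} {Pp₂ Pm₂ : Submodule ℍ[ℝ]ᵐᵒᵖ E₂} {h₂ : IsCompl Pp₂ Pm₂}
    (K₁ : IsKreinNorm F₁ h₁) (K₂ : IsKreinNorm F₂ h₂)
    [Module.Finite ℍ[ℝ]ᵐᵒᵖ Pm₁] [Module.Finite ℍ[ℝ]ᵐᵒᵖ Pm₂]
    (hdim : Module.finrank ℍ[ℝ]ᵐᵒᵖ Pm₁ = Module.finrank ℍ[ℝ]ᵐᵒᵖ Pm₂)
    (X : Submodule ℍ[ℝ]ᵐᵒᵖ (E₁ × E₂))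
    (hX : ∀ x ∈ X, ∀ y ∈ X, F₁.toFun x.1 y.1 = F₂.toFun x.2 y.2)
    (hdense : ∀ v, (∀ x ∈ X, F₁.toFun v x.1 = 0) → v = 0) :
    ∃ c, ∀ x ∈ X, ‖x.2‖ ≤ c * ‖x.1‖ := by
  have := K₁.tower
  have := K₂.tower
  have := K₁.continuousConstSMul
  obtain ⟨N, hND, hfin, hneg, hrank⟩ := K₁.exists_negDef
    (D := X.map (LinearMap.fst ℍ[ℝ]ᵐᵒᵖ E₁ E₂)) fun v hv => hdense v fun x hx =>
      hv _ ⟨x, hx, rfl⟩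
  obtain ⟨τ, hτX, hτinj, hτneg⟩ := exists_negDef_transfer X (fun x hx => by rw [hX x hx x hx])
    N hND hneg
  have hrank₂ : Module.finrank ℍ[ℝ]ᵐᵒᵖ (LinearMap.range τ) = Module.finrank ℍ[ℝ]ᵐᵒᵖ Pm₂ := by
    rw [LinearMap.finrank_range_of_inj hτinj, hrank, hdim]
  obtain ⟨δ, hδ, hpos⟩ := K₂.uniformly_pos hτneg hrank₂
  have hc := hneg.isCompl_orth
  obtain ⟨ε, hε, -, hNε⟩ := K₁.uniformly_neg hneg
  have hfinN : FiniteDimensional ℝ N := Module.Finite.trans ℍ[ℝ]ᵐᵒᵖ N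
  have hfinN' : FiniteDimensional ℝ (N.restrictScalars ℝ) := hfinN
  -- the projection onto `N` along its orthogonal companion is bounded
  have hc₁ : ∀ x, ‖N.projection (F₁.orth N) hc x‖ ≤ ε⁻¹ * ‖x‖ := by
    intro x
    set n := N.projection (F₁.orth N) hc x with hn
    have hnN : n ∈ N := Submodule.projection_apply_mem hc x
    have h0 : F₁.toFun x n = F₁.toFun n n := by
      have h1 : x - n ∈ F₁.orth N := by
        rw [← Submodule.projection_add_projection_eq_self hc x, hn, add_sub_cancel_left]
        exact Submodule.projection_apply_mem hc.symm x
      have h2 := h1 n hnN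
      rwa [F₁.sub_left, sub_eq_zero] at h2
    have h1 := hNε n hnN
    have h2 : -(F₁.toFun n n).re ≤ ‖x‖ * ‖n‖ := by
      rw [← h0, ← Quaternion.re_neg, ← F₁.neg_left, K₁.re_eq_inner]
      refine (real_inner_le_norm _ _).trans ?_
      rw [norm_neg, K₁.norm_fundSymm]
    rw [← div_eq_inv_mul, le_div_iff₀ hε]
    rcases (norm_nonneg n).eq_or_lt with h0 | h0
    · rw [← h0]; simp
    · refine le_of_mul_le_mul_right ?_ h0
      nlinarith
  obtain ⟨c₂, hc₂⟩ : ∃ c, ∀ n : N, ‖τ n‖ ≤ c * ‖(n : E₁)‖ := by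
    let g : (N.restrictScalars ℝ) →ₗ[ℝ] E₂ := τ.restrictScalars ℝ
    exact ⟨‖LinearMap.toContinuousLinearMap g‖, fun n =>
      (LinearMap.toContinuousLinearMap g).le_opNorm n⟩
  -- split `x = n + (x - n)`: `τ` is bounded on `N`, and `y - τ n` is orthogonal to `τ N`
  refine ⟨|c₂| * ε⁻¹ + (1 + ε⁻¹) / Real.sqrt δ, ?_⟩
  rintro ⟨x, y⟩ hxy
  set n := N.projection (F₁.orth N) hc x with hn
  have hnN : n ∈ N := Submodule.projection_apply_mem hc x
  have hx' : x - n ∈ F₁.orth N := by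
    rw [← Submodule.projection_add_projection_eq_self hc x, hn, add_sub_cancel_left]
    exact Submodule.projection_apply_mem hc.symm x
  have hmem : (x - n, y - τ ⟨n, hnN⟩) ∈ X := X.sub_mem hxy (hτX ⟨n, hnN⟩)
  have hy' : y - τ ⟨n, hnN⟩ ∈ F₂.orth (LinearMap.range τ) := by
    rintro _ ⟨m, rfl⟩
    rw [← hX _ hmem _ (hτX m)]
    exact hx' m m.2
  have h1 : δ * ‖y - τ ⟨n, hnN⟩‖ ^ 2 ≤ ‖x - n‖ ^ 2 := by
    refine (hpos _ hy').trans ?_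
    rw [← hX _ hmem _ hmem]
    exact K₁.re_self_le _
  have h2 : ‖x - n‖ ≤ (1 + ε⁻¹) * ‖x‖ := by
    refine (norm_sub_le _ _).trans ?_
    rw [add_mul, one_mul]
    gcongr
    exact hc₁ x
  have h3 : ‖y - τ ⟨n, hnN⟩‖ ≤ (1 + ε⁻¹) / Real.sqrt δ * ‖x‖ := by
    rw [div_mul_eq_mul_div, le_div_iff₀ (Real.sqrt_pos.mpr hδ)]
    refine le_trans (le_of_sq_le_sq ?_ (norm_nonneg _)) h2
    rw [mul_pow, Real.sq_sqrt hδ.le, mul_comm]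
    exact h1
  have h4 : ‖τ ⟨n, hnN⟩‖ ≤ |c₂| * ε⁻¹ * ‖x‖ := by
    refine (hc₂ _).trans ?_
    rw [mul_assoc]
    exact mul_le_mul (le_abs_self _) (hc₁ x) (norm_nonneg _) (abs_nonneg _)
  calc ‖y‖ = ‖τ ⟨n, hnN⟩ + (y - τ ⟨n, hnN⟩)‖ := by rw [add_sub_cancel]
    _ ≤ ‖τ ⟨n, hnN⟩‖ + ‖y - τ ⟨n, hnN⟩‖ := norm_add_le _ _
    _ ≤ _ := by rw [add_mul]; exact add_le_add h4 h3

/-- The form of `IsPontryaginSpace.exists_isometry` for fixed Krein norms: the closure of the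
relation is the graph of a bounded operator. -/
theorem IsKreinNorm.exists_isometry {E₁ E₂ : Type*}
    [NormedAddCommGroup E₁] [InnerProductSpace ℝ E₁] [CompleteSpace E₁] [Module ℍ[ℝ]ᵐᵒᵖ E₁]
    [NormedAddCommGroup E₂] [InnerProductSpace ℝ E₂] [CompleteSpace E₂] [Module ℍ[ℝ]ᵐᵒᵖ E₂]
    {F₁ : HermForm E₁} {Pp₁ Pm₁ : Submodule ℍ[ℝ]ᵐᵒᵖ E₁} {h₁ : IsCompl Pp₁ Pm₁}
    {F₂ : HermForm E₂} {Pp₂ Pm₂ : Submodule ℍ[ℝ]ᵐᵒᵖ E₂} {h₂ : IsCompl Pp₂ Pm₂}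
    (K₁ : IsKreinNorm F₁ h₁) (K₂ : IsKreinNorm F₂ h₂)
    [Module.Finite ℍ[ℝ]ᵐᵒᵖ Pm₁] [Module.Finite ℍ[ℝ]ᵐᵒᵖ Pm₂]
    (hdim : Module.finrank ℍ[ℝ]ᵐᵒᵖ Pm₁ = Module.finrank ℍ[ℝ]ᵐᵒᵖ Pm₂)
    (X : Submodule ℍ[ℝ]ᵐᵒᵖ (E₁ × E₂))
    (hX : ∀ x ∈ X, ∀ y ∈ X, F₁.toFun x.1 y.1 = F₂.toFun x.2 y.2)
    (hdense : ∀ v, (∀ x ∈ X, F₁.toFun v x.1 = 0) → v = 0) :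
    ∃ (S : E₁ →ₗ[ℍ[ℝ]ᵐᵒᵖ] E₂) (T : E₂ →ₗ[ℍ[ℝ]ᵐᵒᵖ] E₁), (∀ x ∈ X, S x.1 = x.2) ∧
      (∀ x y, F₂.toFun (S x) (S y) = F₁.toFun x y) ∧
      ∀ v x, F₁.toFun (T v) x = F₂.toFun v (S x) := by
  have := K₁.tower
  have := K₂.tower
  have := K₁.continuousConstSMul
  have := K₂.continuousConstSMul
  obtain ⟨c, hc⟩ := K₁.bound_of_isometric K₂ hdim X hX hdense
  have hD : Dense ((X.map (LinearMap.fst ℍ[ℝ]ᵐᵒᵖ E₁ E₂) : Submodule ℍ[ℝ]ᵐᵒᵖ E₁) : Set E₁) :=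
    K₁.dense fun v hv => hdense v fun x hx => hv _ ⟨x, hx, rfl⟩
  let Y := X.topologicalClosure
  have hcY : ∀ x ∈ Y, ‖x.2‖ ≤ c * ‖x.1‖ := by
    have hcl : IsClosed {x : E₁ × E₂ | ‖x.2‖ ≤ c * ‖x.1‖} :=
      isClosed_le (by fun_prop) (by fun_prop)
    exact closure_minimal (fun x hx => hc x hx) hcl
  let f : Y →ₗ[ℍ[ℝ]ᵐᵒᵖ] E₁ := (LinearMap.fst ℍ[ℝ]ᵐᵒᵖ E₁ E₂).comp Y.subtype
  have hf : AntilipschitzWith (1 + |c|).toNNReal f := by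
    refine AddMonoidHomClass.antilipschitz_of_bound f fun x => ?_
    rw [Real.coe_toNNReal _ (by positivity)]
    have h1 : ‖(x : E₁ × E₂).2‖ ≤ |c| * ‖(x : E₁ × E₂).1‖ :=
      (hcY x x.2).trans (by gcongr; exact le_abs_self c)
    change max ‖(x : E₁ × E₂).1‖ ‖(x : E₁ × E₂).2‖ ≤ (1 + |c|) * ‖(x : E₁ × E₂).1‖
    refine max_le ?_ ?_ <;> nlinarith [norm_nonneg (x : E₁ × E₂).1, abs_nonneg c]
  have hfc : UniformContinuous f := uniformContinuous_fst.comp uniformContinuous_subtype_val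
  have hYc : CompleteSpace Y := X.isClosed_topologicalClosure.completeSpace_coe
  have hsurj : Function.Surjective f := by
    rw [← Set.range_eq_univ]
    refine (hf.isClosed_range hfc).closure_eq.symm.trans (Dense.closure_eq (hD.mono ?_))
    rintro _ ⟨x, hx, rfl⟩
    exact ⟨⟨x, X.le_topologicalClosure hx⟩, rfl⟩
  let e := LinearEquiv.ofBijective f ⟨hf.injective, hsurj⟩
  let S : E₁ →ₗ[ℍ[ℝ]ᵐᵒᵖ] E₂ :=
    ((LinearMap.snd ℍ[ℝ]ᵐᵒᵖ E₁ E₂).comp Y.subtype).comp e.symm.toLinearMap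
  have hSb : ∀ x, ‖S x‖ ≤ c * ‖x‖ := fun x => by
    have h1 := hcY _ (e.symm x).2
    have h2 : ((e.symm x : Y) : E₁ × E₂).1 = x := e.apply_symm_apply x
    rwa [h2] at h1
  have hSc : Continuous S := AddMonoidHomClass.continuous_of_bound S c hSb
  have hSX : ∀ x ∈ X, S x.1 = x.2 := fun x hx => by
    have h1 : e.symm x.1 = ⟨x, X.le_topologicalClosure hx⟩ := by
      rw [LinearEquiv.symm_apply_eq]; rfl
    change ((e.symm x.1 : Y) : E₁ × E₂).2 = x.2
    rw [h1]
  have hiso : ∀ x y, F₂.toFun (S x) (S y) = F₁.toFun x y := by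
    have h1 : ∀ x ∈ X, ∀ y, F₂.toFun (S x.1) (S y) = F₁.toFun x.1 y := by
      intro x hx
      have hcl : IsClosed {y | F₂.toFun (S x.1) (S y) = F₁.toFun x.1 y} :=
        isClosed_eq ((K₂.continuous_right _).comp hSc) (K₁.continuous_right _)
      intro y
      refine closure_minimal ?_ hcl (hD y)
      rintro _ ⟨y, hy, rfl⟩
      change F₂.toFun (S x.1) (S y.1) = F₁.toFun x.1 y.1
      rw [hSX x hx, hSX y hy, hX x hx y hy]
    intro x y
    have hcl : IsClosed {x | F₂.toFun (S x) (S y) = F₁.toFun x y} :=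
      isClosed_eq ((K₂.continuous_left _).comp hSc) (K₁.continuous_left _)
    refine closure_minimal ?_ hcl (hD x)
    rintro _ ⟨x, hx, rfl⟩
    exact h1 x hx y
  have hT : ∀ v, ∃ u, ∀ x, F₁.toFun u x = F₂.toFun v (S x) := by
    intro v
    let ℓ : StrongDual ℝ E₁ :=
      { toLinearMap := (F₂.reForm v).comp (S.restrictScalars ℝ)
        cont := Quaternion.continuous_re.comp ((K₂.continuous_right v).comp hSc) }
    obtain ⟨u, hu⟩ := K₁.riesz ℓ
    refine ⟨u, fun x => ?_⟩
    have hu' : ∀ x, (F₁.toFun u x).re = (F₂.toFun v (S x)).re := hu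
    set d := F₁.toFun u x - F₂.toFun v (S x) with hd
    -- the real parts agree at all multiples of `x`, hence so do the quaternionic values
    have h1 := hu' (x <• d)
    rw [map_smul, F₁.smul_right, F₂.smul_right, ← sub_eq_zero, ← Quaternion.re_sub, ← mul_sub,
      ← hd, Quaternion.star_mul_self, Quaternion.re_coe, Quaternion.normSq_eq_zero] at h1
    exact sub_eq_zero.mp h1
  choose t ht using hT
  have hinj : ∀ u u', (∀ x, F₁.toFun u x = F₁.toFun u' x) → u = u' := fun u u' huu => by
    refine sub_eq_zero.mp (K₁.eq_zero fun y => ?_)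
    rw [F₁.sub_left, huu, sub_self]; rfl
  let T : E₂ →ₗ[ℍ[ℝ]ᵐᵒᵖ] E₁ :=
    { toFun := t
      map_add' := fun v w => hinj _ _ fun x => by rw [F₁.add_left, ht, ht, ht, F₂.add_left]
      map_smul' := fun a v => hinj _ _ fun x => by
        have e1 := F₁.smul_left (t v) x a.unop
        have e2 := F₂.smul_left v (S x) a.unop
        rw [MulOpposite.op_unop] at e1 e2
        rw [RingHom.id_apply, e1, ht, ht, e2] }
  exact ⟨S, T, hSX, hiso, ht⟩

/-- Shmulyan's extension theorem: an isometric relation with dense domain between Pontryagin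
spaces of the same index extends to an isometry, which has an adjoint. -/
theorem IsPontryaginSpace.exists_isometry {E₁ E₂ : Type*} [AddCommGroup E₁] [Module ℍ[ℝ]ᵐᵒᵖ E₁]
    [AddCommGroup E₂] [Module ℍ[ℝ]ᵐᵒᵖ E₂] {F₁ : HermForm E₁} {F₂ : HermForm E₂} {κ : ℕ}
    (hF₁ : IsPontryaginSpace F₁ κ) (hF₂ : IsPontryaginSpace F₂ κ)
    (X : Submodule ℍ[ℝ]ᵐᵒᵖ (E₁ × E₂))
    (hX : ∀ x ∈ X, ∀ y ∈ X, F₁.toFun x.1 y.1 = F₂.toFun x.2 y.2)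
    (hdense : ∀ v, (∀ x ∈ X, F₁.toFun v x.1 = 0) → v = 0) :
    ∃ (S : E₁ →ₗ[ℍ[ℝ]ᵐᵒᵖ] E₂) (T : E₂ →ₗ[ℍ[ℝ]ᵐᵒᵖ] E₁), (∀ x ∈ X, S x.1 = x.2) ∧
      (∀ x y, F₂.toFun (S x) (S y) = F₁.toFun x y) ∧
      ∀ v x, F₁.toFun (T v) x = F₂.toFun v (S x) := by
  obtain ⟨Pp₁, Pm₁, hd₁, hr₁⟩ := hF₁
  obtain ⟨Pp₂, Pm₂, hd₂, hr₂⟩ := hF₂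
  let _ := fundNormed hd₁
  let _ := fundInner hd₁
  let _ := fundNormed hd₂
  let _ := fundInner hd₂
  have := hd₁.completeSpace
  have := hd₂.completeSpace
  have := hd₁.finite
  have := hd₂.finite
  exact IsKreinNorm.exists_isometry hd₁.isKreinNorm hd₂.isKreinNorm (hr₁.trans hr₂.symm) X hX hdense

/-- A subspace without orthogonal vectors contains a negative definite subspace of full
dimension. -/
theorem IsPontryaginSpace.exists_negDef {E : Type*} [AddCommGroup E] [Module ℍ[ℝ]ᵐᵒᵖ E]
    {F : HermForm E} {κ : ℕ} (hF : IsPontryaginSpace F κ) {D : Submodule ℍ[ℝ]ᵐᵒᵖ E}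
    (hD : ∀ x, (∀ y ∈ D, F.toFun x y = 0) → x = 0) :
    ∃ N ≤ D, Module.Finite ℍ[ℝ]ᵐᵒᵖ N ∧ F.NegDef N ∧ Module.finrank ℍ[ℝ]ᵐᵒᵖ N = κ := by
  obtain ⟨Pp, Pm, hd, hr⟩ := hF
  let _ := fundNormed hd
  let _ := fundInner hd
  have := hd.completeSpace
  have := hd.finite
  have K := hd.isKreinNorm
  rw [← hr]
  exact K.exists_negDef hD

theorem IsPontryaginSpace.finrank_le {E : Type*} [AddCommGroup E] [Module ℍ[ℝ]ᵐᵒᵖ E]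
    {F : HermForm E} {κ : ℕ} (hF : IsPontryaginSpace F κ) {N : Submodule ℍ[ℝ]ᵐᵒᵖ E}
    (hN : F.NegDef N) : Module.finrank ℍ[ℝ]ᵐᵒᵖ N ≤ κ := by
  obtain ⟨Pp, Pm, hd, rfl⟩ := hF
  have := hd.finite
  exact hN.finrank_le hd.nonneg hd.isCompl.symm

theorem IsPontryaginSpace.eq_zero {E : Type*} [AddCommGroup E] [Module ℍ[ℝ]ᵐᵒᵖ E]
    {F : HermForm E} {κ : ℕ} (hF : IsPontryaginSpace F κ) {x : E}
    (hx : ∀ y, F.toFun x y = 0) : x = 0 := by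
  obtain ⟨Pp, Pm, hd, -⟩ := hF
  let _ := fundNormed hd
  let _ := fundInner hd
  exact hd.isKreinNorm.eq_zero fun y => by rw [hx y]; rfl

end Isometry

/-! ### Operators with an adjoint: boundedness and resolvents at small real points -/

section Adjointable

/-- An everywhere defined operator with an everywhere defined adjoint has a closed graph. -/
theorem IsKreinNorm.continuous_of_adjoint {E₁ E₂ : Type*}
    [NormedAddCommGroup E₁] [InnerProductSpace ℝ E₁] [CompleteSpace E₁] [Module ℍ[ℝ]ᵐᵒᵖ E₁]
    [NormedAddCommGroup E₂] [InnerProductSpace ℝ E₂] [CompleteSpace E₂] [Module ℍ[ℝ]ᵐᵒᵖ E₂]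
    {F₁ : HermForm E₁} {Pp₁ Pm₁ : Submodule ℍ[ℝ]ᵐᵒᵖ E₁} {h₁ : IsCompl Pp₁ Pm₁}
    {F₂ : HermForm E₂} {Pp₂ Pm₂ : Submodule ℍ[ℝ]ᵐᵒᵖ E₂} {h₂ : IsCompl Pp₂ Pm₂}
    (K₁ : IsKreinNorm F₁ h₁) (K₂ : IsKreinNorm F₂ h₂) (T : E₁ →ₗ[ℍ[ℝ]ᵐᵒᵖ] E₂) (S : E₂ → E₁)
    (hS : ∀ x y, F₂.toFun (T x) y = F₁.toFun x (S y)) : Continuous T := by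
  have := K₁.tower
  have := K₂.tower
  refine LinearMap.continuous_of_seq_closed_graph (T.restrictScalars ℝ) fun u x y hu hy => ?_
  refine sub_eq_zero.mp (K₂.eq_zero fun z => ?_)
  have h1 := ((K₁.continuous_left (S z)).tendsto x).comp hu
  have h2 := ((K₂.continuous_left z).tendsto y).comp hy
  have h3 : ((fun v => F₂.toFun v z) ∘ ((T.restrictScalars ℝ) ∘ u))
      = (fun v => F₁.toFun v (S z)) ∘ u := by
    funext n
    exact hS (u n) z
  rw [h3] at h2
  rw [F₂.sub_left, tendsto_nhds_unique h2 h1]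
  change (F₁.toFun x (S z) - F₂.toFun (T x) z).re = 0
  rw [hS, sub_self]; rfl

theorem IsKreinNorm.continuous_output {E : Type*} [NormedAddCommGroup E] [InnerProductSpace ℝ E]
    [Module ℍ[ℝ]ᵐᵒᵖ E] {F : HermForm E} {Pp Pm : Submodule ℍ[ℝ]ᵐᵒᵖ E} {h : IsCompl Pp Pm}
    (K : IsKreinNorm F h) {M : ℕ} (C : E →ₗ[ℍ[ℝ]ᵐᵒᵖ] (Fin M → ℍ[ℝ])) (C' : (Fin M → ℍ[ℝ]) → E)
    (hC : ∀ x c, star c ⬝ᵥ C x = F.toFun x (C' c)) : Continuous C := by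
  refine continuous_pi fun i => ?_
  have : (fun y => C y i) = fun y => F.toFun y (C' (Pi.single i 1)) := by
    funext y
    rw [← hC, Pi.star_single, star_one, single_one_dotProduct]
  rw [this]
  exact K.continuous_left _

variable {P : Type*} [AddCommGroup P] [Module ℍ[ℝ]ᵐᵒᵖ P] {M N : ℕ}

/-- At a real point `|p|² A² - 2 Re(p) A + I` is the square of `I - tA`. -/
theorem sOperator_coe (A : P →ₗ[ℍ[ℝ]ᵐᵒᵖ] P) (t : ℝ) (x : P) :
    sOperator A (t : ℍ[ℝ]) x
      = (x - A x <• (t : ℍ[ℝ])) - A (x - A x <• (t : ℍ[ℝ])) <• (t : ℍ[ℝ]) := by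
  have h1 : ((‖(t : ℍ[ℝ])‖ ^ 2 : ℝ) : ℍ[ℝ]) = (t : ℍ[ℝ]) * (t : ℍ[ℝ]) := by
    rw [Quaternion.norm_coe, Real.norm_eq_abs, sq_abs, sq, Quaternion.coe_mul]
  have h2 : ((2 * (t : ℍ[ℝ]).re : ℝ) : ℍ[ℝ]) = (t : ℍ[ℝ]) + (t : ℍ[ℝ]) := by
    rw [Quaternion.re_coe, two_mul, Quaternion.coe_add]
  change A (A x) <• ((‖(t : ℍ[ℝ])‖ ^ 2 : ℝ) : ℍ[ℝ])
    - A x <• ((2 * (t : ℍ[ℝ]).re : ℝ) : ℍ[ℝ]) + x = _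
  rw [h1, h2, map_sub, map_smul, MulOpposite.op_mul, MulOpposite.op_add, mul_smul, add_smul,
    smul_sub]
  abel

/-- Neumann series: `I - tA` is invertible for small real `t` when `A` has an adjoint. -/
theorem IsPontryaginSpace.exists_bijective {F : HermForm P} {κ : ℕ} (hF : IsPontryaginSpace F κ)
    (A : P →ₗ[ℍ[ℝ]ᵐᵒᵖ] P) (A' : P → P) (hA : ∀ x y, F.toFun (A x) y = F.toFun x (A' y)) :
    ∃ ρ > 0, ∀ t : ℝ, |t| < ρ → Function.Bijective fun x => x - A x <• (t : ℍ[ℝ]) := by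
  obtain ⟨Pp, Pm, hd, -⟩ := hF
  let _ := fundNormed hd
  let _ := fundInner hd
  have := hd.completeSpace
  have K := hd.isKreinNorm
  have := K.tower
  have hc := K.continuous_of_adjoint K A A' hA
  let A₁ : P →L[ℝ] P := ⟨A.restrictScalars ℝ, hc⟩
  refine ⟨(1 + ‖A₁‖)⁻¹, by positivity, fun t ht => ?_⟩
  have h1 : ‖t • A₁‖ < 1 := by
    rw [norm_smul, Real.norm_eq_abs]
    have h0 : 0 < 1 + ‖A₁‖ := by positivity
    have h2 : |t| * (1 + ‖A₁‖) < 1 := by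
      rwa [← lt_div_iff₀ h0, one_div]
    nlinarith [abs_nonneg t, norm_nonneg A₁]
  have h2 := (isUnit_one_sub_of_norm_lt_one h1)
  rw [ContinuousLinearMap.isUnit_iff_bijective] at h2
  convert h2 using 1
  funext x
  change _ = x - t • A x
  rw [real_smul_eq]

/-- If the vectors `C (I - tA)⁻¹ x` vanish for all small `t > 0`, so does the limit `C x`. -/
theorem IsPontryaginSpace.apply_eq_zero {F : HermForm P} {κ : ℕ} (hF : IsPontryaginSpace F κ)
    (A : P →ₗ[ℍ[ℝ]ᵐᵒᵖ] P) (A' : P → P) (hA : ∀ x y, F.toFun (A x) y = F.toFun x (A' y))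
    (C : P →ₗ[ℍ[ℝ]ᵐᵒᵖ] (Fin M → ℍ[ℝ])) (C' : (Fin M → ℍ[ℝ]) → P)
    (hC : ∀ x c, star c ⬝ᵥ C x = F.toFun x (C' c)) {ρ : ℝ} (hρ : 0 < ρ) (x : P)
    (hx : ∀ t : ℝ, 0 < t → t < ρ → ∃ g, g - A g <• (t : ℍ[ℝ]) = x ∧ C g = 0) : C x = 0 := by
  obtain ⟨Pp, Pm, hd, -⟩ := hF
  let _ := fundNormed hd
  let _ := fundInner hd
  have := hd.completeSpace
  have K := hd.isKreinNorm
  have := K.tower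
  have hAc := K.continuous_of_adjoint K A A' hA
  let A₁ : P →L[ℝ] P := ⟨A.restrictScalars ℝ, hAc⟩
  have hCc := K.continuous_output C C' hC
  -- evaluate along `t = ρ / (n + 2)`, which lies in `(0, ρ)` and tends to `0`
  have hex : ∀ n : ℕ, ∃ g, g - A g <• ((ρ / (n + 2) : ℝ) : ℍ[ℝ]) = x ∧ C g = 0 := fun n =>
    hx _ (by positivity) (div_lt_self hρ (by linarith [(n.cast_nonneg : (0 : ℝ) ≤ n)]))
  choose g hg hCg using hex
  have ht : Filter.Tendsto (fun n : ℕ => ρ / ((n : ℝ) + 2)) Filter.atTop (nhds 0) :=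
    Filter.Tendsto.const_div_atTop
      (Filter.tendsto_atTop_add_const_right _ _ tendsto_natCast_atTop_atTop) ρ
  have hgx : ∀ n, g n - x = (ρ / ((n : ℝ) + 2)) • A₁ (g n) := fun n => by
    have h1 := hg n
    change g n - x = (ρ / ((n : ℝ) + 2)) • A (g n)
    rw [real_smul_eq, ← h1]
    abel
  have hbd : ∀ᶠ n in Filter.atTop, ‖g n‖ ≤ 2 * ‖x‖ := by
    have h1 : ∀ᶠ n : ℕ in Filter.atTop, ρ / ((n : ℝ) + 2) < (2 * (1 + ‖A₁‖))⁻¹ :=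
      ht.eventually (gt_mem_nhds (by positivity))
    filter_upwards [h1] with n hn
    have h2 : 0 < ρ / ((n : ℝ) + 2) := by positivity
    have h3 : ‖g n‖ ≤ ‖x‖ + ‖g n - x‖ := by
      have := norm_add_le x (g n - x)
      rwa [add_sub_cancel] at this
    have h4 : ‖g n - x‖ ≤ 1 / 2 * ‖g n‖ := by
      rw [hgx, norm_smul, Real.norm_of_nonneg h2.le]
      have h5 := A₁.le_opNorm (g n)
      have h6 : ρ / ((n : ℝ) + 2) * (1 + ‖A₁‖) ≤ 1 / 2 := by
        have : (2 * (1 + ‖A₁‖))⁻¹ * (1 + ‖A₁‖) = 1 / 2 := by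
          field_simp
        rw [← this]
        gcongr
      calc ρ / ((n : ℝ) + 2) * ‖A₁ (g n)‖ ≤ ρ / ((n : ℝ) + 2) * ((1 + ‖A₁‖) * ‖g n‖) := by
            gcongr
            nlinarith [norm_nonneg (g n)]
        _ = (ρ / ((n : ℝ) + 2) * (1 + ‖A₁‖)) * ‖g n‖ := by ring
        _ ≤ _ := by gcongr
    linarith
  have hlim : Filter.Tendsto g Filter.atTop (nhds x) := by
    rw [tendsto_iff_norm_sub_tendsto_zero]
    have h1 := ht.mul_const (‖A₁‖ * (2 * ‖x‖))
    rw [zero_mul] at h1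
    refine squeeze_zero' (Filter.Eventually.of_forall fun n => norm_nonneg _) ?_ h1
    filter_upwards [hbd] with n hn
    have h2 : 0 < ρ / ((n : ℝ) + 2) := by positivity
    rw [hgx, norm_smul, Real.norm_of_nonneg h2.le]
    gcongr
    exact (A₁.le_opNorm _).trans (by gcongr)
  have h1 := (hCc.tendsto x).comp hlim
  have h2 : (C ∘ g) = fun _ => 0 := funext hCg
  rw [h2] at h1
  exact (tendsto_nhds_unique h1 tendsto_const_nhds)

/-- The functions `t ↦ C (I - tA)⁻¹ x` at small `t > 0` determine all the moments `C Aⁿ x`. -/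
theorem IsPontryaginSpace.moments_eq_zero {F : HermForm P} {κ : ℕ} (hF : IsPontryaginSpace F κ)
    (A : P →ₗ[ℍ[ℝ]ᵐᵒᵖ] P) (A' : P → P) (hA : ∀ x y, F.toFun (A x) y = F.toFun x (A' y))
    (C : P →ₗ[ℍ[ℝ]ᵐᵒᵖ] (Fin M → ℍ[ℝ])) (C' : (Fin M → ℍ[ℝ]) → P)
    (hC : ∀ x c, star c ⬝ᵥ C x = F.toFun x (C' c)) {ρ : ℝ} (hρ : 0 < ρ) (n : ℕ) :
    ∀ x : P, (∀ t : ℝ, 0 < t → t < ρ → ∃ g, g - A g <• (t : ℍ[ℝ]) = x ∧ C g = 0) →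
      C ((A ^ n) x) = 0 := by
  induction n with
  | zero => intro x hx; exact hF.apply_eq_zero A A' hA C C' hC hρ x hx
  | succ n ih =>
    intro x hx
    rw [pow_succ]
    -- since `C x = 0`, the vectors `C (I - tA)⁻¹ A x = t⁻¹ C ((I - tA)⁻¹ x - x)` vanish as well
    refine ih (A x) fun t ht htρ => ?_
    obtain ⟨g, hg, hCg⟩ := hx t ht htρ
    refine ⟨A g, ?_, ?_⟩
    · rw [← hg, map_sub, map_smul]
    · have h0 := hF.apply_eq_zero A A' hA C C' hC hρ x hx
      have h1 : C (A g <• (t : ℍ[ℝ])) = 0 := by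
        have : A g <• (t : ℍ[ℝ]) = g - x := by rw [← hg]; abel
        rw [this, map_sub, hCg, h0, sub_zero]
      rw [map_smul] at h1
      refine (smul_eq_zero.mp h1).resolve_left fun h => ?_
      rw [MulOpposite.op_eq_zero_iff] at h
      exact ht.ne' (Quaternion.coe_injective h)

/-- A colligation with an adjoint is bounded. -/
theorem IsPontryaginSpace.isBoundedOp {F : HermForm P} {κ : ℕ} (hF : IsPontryaginSpace F κ)
    {A : P →ₗ[ℍ[ℝ]ᵐᵒᵖ] P} {B : (Fin N → ℍ[ℝ]) →ₗ[ℍ[ℝ]ᵐᵒᵖ] P}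
    {C : P →ₗ[ℍ[ℝ]ᵐᵒᵖ] (Fin M → ℍ[ℝ])} {D : Matrix (Fin M) (Fin N) ℍ[ℝ]}
    (A' : P → P) (hA : ∀ x y, F.toFun (A x) y = F.toFun x (A' y))
    (C' : (Fin M → ℍ[ℝ]) → P)
    (hC : ∀ x c, star c ⬝ᵥ C x = F.toFun x (C' c)) :
    IsBoundedOp F (colligation A B C D) := by
  obtain ⟨Pp, Pm, hd, -⟩ := hF
  refine ⟨Pp, Pm, hd, ?_⟩
  let _ := fundNormed hd
  let _ := fundInner hd
  have := hd.completeSpace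
  have K := hd.isKreinNorm
  have := K.tower
  have hAc := K.continuous_of_adjoint K A A' hA
  let A₁ : P →L[ℝ] P := ⟨A.restrictScalars ℝ, hAc⟩
  have hCc := K.continuous_output C C' hC
  let C₁ : P →L[ℝ] (Fin M → ℍ[ℝ]) := ⟨C.restrictScalars ℝ, hCc⟩
  let B₁ : (Fin N → ℍ[ℝ]) →L[ℝ] P := LinearMap.toContinuousLinearMap (B.restrictScalars ℝ)
  let D₁ : (Fin N → ℍ[ℝ]) →L[ℝ] (Fin M → ℍ[ℝ]) := LinearMap.toContinuousLinearMap
    { toFun := fun u => D.mulVec u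
      map_add' := fun u v => Matrix.mulVec_add _ _ _
      map_smul' := fun r u => Matrix.mulVec_smul _ _ _ }
  refine ⟨2 * ‖A₁‖ ^ 2 + 2 * ‖B₁‖ ^ 2 + M * (2 * ‖C₁‖ ^ 2 + 2 * ‖D₁‖ ^ 2), fun x => ?_⟩
  rw [← K.norm_sq, ← K.norm_sq]
  set s := ∑ j, ‖x.2 j‖ ^ 2 with hs
  have hs0 : 0 ≤ s := Finset.sum_nonneg fun j _ => by positivity
  have hu : ‖x.2‖ ^ 2 ≤ s := by
    have h1 : ‖x.2‖ ≤ Real.sqrt s := by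
      refine (pi_norm_le_iff_of_nonneg (Real.sqrt_nonneg _)).mpr fun j => ?_
      refine Real.le_sqrt_of_sq_le ?_
      exact Finset.single_le_sum (f := fun j => ‖x.2 j‖ ^ 2) (fun j _ => by positivity)
        (Finset.mem_univ j)
    calc ‖x.2‖ ^ 2 ≤ Real.sqrt s ^ 2 := by gcongr
      _ = s := Real.sq_sqrt hs0
  have h1 : ‖A x.1 + B x.2‖ ^ 2 ≤ 2 * ‖A₁‖ ^ 2 * ‖x.1‖ ^ 2 + 2 * ‖B₁‖ ^ 2 * s := by
    have h2 : ‖A x.1 + B x.2‖ ≤ ‖A₁‖ * ‖x.1‖ + ‖B₁‖ * ‖x.2‖ :=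
      (norm_add_le _ _).trans (add_le_add (A₁.le_opNorm _) (B₁.le_opNorm _))
    calc ‖A x.1 + B x.2‖ ^ 2 ≤ (‖A₁‖ * ‖x.1‖ + ‖B₁‖ * ‖x.2‖) ^ 2 := by gcongr
      _ ≤ 2 * ‖A₁‖ ^ 2 * ‖x.1‖ ^ 2 + 2 * ‖B₁‖ ^ 2 * ‖x.2‖ ^ 2 := by
        nlinarith [sq_nonneg (‖A₁‖ * ‖x.1‖ - ‖B₁‖ * ‖x.2‖)]
      _ ≤ _ := by gcongr
  have h2 : ∀ i, ‖(C x.1 + D.mulVec x.2) i‖ ^ 2 ≤ 2 * ‖C₁‖ ^ 2 * ‖x.1‖ ^ 2 + 2 * ‖D₁‖ ^ 2 * s := by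
    intro i
    have h2 : ‖(C x.1 + D.mulVec x.2) i‖ ≤ ‖C₁‖ * ‖x.1‖ + ‖D₁‖ * ‖x.2‖ :=
      (norm_le_pi_norm _ i).trans
        ((norm_add_le _ _).trans (add_le_add (C₁.le_opNorm _) (D₁.le_opNorm _)))
    calc ‖(C x.1 + D.mulVec x.2) i‖ ^ 2 ≤ (‖C₁‖ * ‖x.1‖ + ‖D₁‖ * ‖x.2‖) ^ 2 := by gcongr
      _ ≤ 2 * ‖C₁‖ ^ 2 * ‖x.1‖ ^ 2 + 2 * ‖D₁‖ ^ 2 * ‖x.2‖ ^ 2 := by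
        nlinarith [sq_nonneg (‖C₁‖ * ‖x.1‖ - ‖D₁‖ * ‖x.2‖)]
      _ ≤ _ := by gcongr
  have h3 : ∑ i, ‖(C x.1 + D.mulVec x.2) i‖ ^ 2
      ≤ M * (2 * ‖C₁‖ ^ 2 * ‖x.1‖ ^ 2 + 2 * ‖D₁‖ ^ 2 * s) := by
    refine (Finset.sum_le_sum fun i _ => h2 i).trans_eq ?_
    rw [Finset.sum_const, Finset.card_univ, Fintype.card_fin, nsmul_eq_mul]
  change ‖A x.1 + B x.2‖ ^ 2 + ∑ i, ‖(C x.1 + D.mulVec x.2) i‖ ^ 2 ≤ _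
  have e1 : 0 ≤ 2 * ‖A₁‖ ^ 2 * s + 2 * ‖B₁‖ ^ 2 * ‖x.1‖ ^ 2
      + M * (2 * ‖C₁‖ ^ 2 * s + 2 * ‖D₁‖ ^ 2 * ‖x.1‖ ^ 2) := by positivity
  calc _ ≤ _ := add_le_add h1 h3
    _ ≤ _ := le_add_of_nonneg_right e1
    _ = _ := by ring

end Adjointable

/-! ### Quaternionic Hermitian matrices -/

section Matrices

variable {n : ℕ}

theorem coe_sum {ι : Type*} (s : Finset ι) (f : ι → ℝ) :
    ((∑ i ∈ s, f i : ℝ) : ℍ[ℝ]) = ∑ i ∈ s, (f i : ℍ[ℝ]) :=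
  map_sum (algebraMap ℝ ℍ[ℝ]) f s

instance finite_quaternion_op : Module.Finite ℍ[ℝ]ᵐᵒᵖ ℍ[ℝ] :=
  ⟨⟨{1}, by
    rw [eq_top_iff]
    intro a _
    rw [Finset.coe_singleton, Submodule.mem_span_singleton]
    exact ⟨MulOpposite.op a, by simp⟩⟩⟩

theorem star_dotProduct_self (v : Fin n → ℍ[ℝ]) : star v ⬝ᵥ v = ((∑ i, ‖v i‖ ^ 2 : ℝ) : ℍ[ℝ]) := by
  rw [dotProduct, coe_sum]
  refine Finset.sum_congr rfl fun i _ => ?_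
  rw [Pi.star_apply, Quaternion.star_mul_self, Quaternion.normSq_eq_norm_mul_self, sq]

theorem star_dotProduct_smul_op (v w : Fin n → ℍ[ℝ]) (a b : ℍ[ℝ]) :
    star (w <• b) ⬝ᵥ (v <• a) = star b * (star w ⬝ᵥ v) * a := by
  simp only [dotProduct, Finset.mul_sum, Finset.sum_mul, Pi.star_apply, Pi.smul_apply,
    MulOpposite.smul_eq_mul_unop, MulOpposite.unop_op, star_mul, mul_assoc]

theorem star_dotProduct_conjTranspose {m : ℕ} (A : Matrix (Fin m) (Fin n) ℍ[ℝ])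
    (v : Fin n → ℍ[ℝ]) (w : Fin m → ℍ[ℝ]) :
    star w ⬝ᵥ A.mulVec v = star (A.conjTranspose.mulVec w) ⬝ᵥ v := by
  rw [Matrix.star_mulVec, Matrix.conjTranspose_conjTranspose, Matrix.dotProduct_mulVec]

/-- The Hermitian form `w^* A v` of a Hermitian matrix. -/
def matForm (A : Matrix (Fin n) (Fin n) ℍ[ℝ]) (hA : A.conjTranspose = A) :
    HermForm (Fin n → ℍ[ℝ]) where
  toFun v w := star w ⬝ᵥ A.mulVec v
  add_left u v w := by rw [Matrix.mulVec_add, dotProduct_add]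
  smul_smul v w a b := by rw [Matrix.mulVec_smul, star_dotProduct_smul_op]
  conj_symm v w := by
    rw [star_dotProduct_conjTranspose, hA, ← Matrix.star_dotProduct_star, star_star]

theorem matForm_apply (A : Matrix (Fin n) (Fin n) ℍ[ℝ]) (hA : A.conjTranspose = A)
    (v w : Fin n → ℍ[ℝ]) : (matForm A hA).toFun v w = star w ⬝ᵥ A.mulVec v := rfl

theorem mem_rightEigenspace {A : Matrix (Fin n) (Fin n) ℍ[ℝ]} {t : ℝ} {v : Fin n → ℍ[ℝ]} :
    v ∈ rightEigenspace A t ↔ A.mulVec v = v <• (t : ℍ[ℝ]) := Iff.rfl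

theorem star_dotProduct_eq_zero_of_eigen {A : Matrix (Fin n) (Fin n) ℍ[ℝ]}
    (hA : A.conjTranspose = A) {s t : ℝ} (hst : s ≠ t) {v w : Fin n → ℍ[ℝ]}
    (hv : v ∈ rightEigenspace A s) (hw : w ∈ rightEigenspace A t) : star w ⬝ᵥ v = 0 := by
  have h1 := star_dotProduct_conjTranspose A v w
  rw [hA, mem_rightEigenspace.mp hv, mem_rightEigenspace.mp hw] at h1
  have h2 := star_dotProduct_smul_op v w (s : ℍ[ℝ]) 1
  have h3 := star_dotProduct_smul_op v w 1 (t : ℍ[ℝ])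
  simp only [MulOpposite.op_one, one_smul, star_one, one_mul, mul_one, Quaternion.star_coe] at h2 h3
  rw [h2, h3, ← Quaternion.coe_commutes, ← sub_eq_zero, ← sub_mul, ← Quaternion.coe_sub] at h1
  rcases mul_eq_zero.mp h1 with h | h
  swap
  · exact h
  · exact absurd (sub_eq_zero.mp (Quaternion.coe_injective h)) hst

/-- A vector `v` in a sum of eigenspaces has components `v_t` with `v^* A v = ∑ t |v_t|²`. -/
theorem exists_eigen_decomposition {A : Matrix (Fin n) (Fin n) ℍ[ℝ]}
    (hA : A.conjTranspose = A) (S : Set ℝ) {v : Fin n → ℍ[ℝ]}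
    (hv : v ∈ ⨆ t : S, rightEigenspace A (t : ℝ)) :
    ∃ f : S →₀ (Fin n → ℍ[ℝ]), (f.sum fun _ x => x) = v ∧
      (star v ⬝ᵥ A.mulVec v).re = ∑ t ∈ f.support, (t : ℝ) * ∑ i, ‖f t i‖ ^ 2 := by
  obtain ⟨f, hf, hfv⟩ := (Submodule.mem_iSup_iff_exists_finsupp _ _).mp hv
  refine ⟨f, hfv, ?_⟩
  have h1 : ∀ t, A.mulVec (f t) = f t <• ((t : ℝ) : ℍ[ℝ]) := fun t => hf t
  have h2 : (matForm A hA).toFun v v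
      = ∑ t ∈ f.support, (((t : ℝ) * ∑ i, ‖f t i‖ ^ 2 : ℝ) : ℍ[ℝ]) := by
    conv_lhs => rw [← hfv]
    rw [Finsupp.sum, HermForm.sum_left]
    refine Finset.sum_congr rfl fun t ht => ?_
    rw [HermForm.sum_right, Finset.sum_eq_single_of_mem t ht]
    · have h3 := star_dotProduct_smul_op (f t) (f t) ((t : ℝ) : ℍ[ℝ]) 1
      simp only [MulOpposite.op_one, one_smul, star_one, one_mul] at h3
      rw [matForm_apply, h1, h3, star_dotProduct_self, ← Quaternion.coe_mul, mul_comm]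
    · intro s hs hst
      have h3 := star_dotProduct_smul_op (f t) (f s) ((t : ℝ) : ℍ[ℝ]) 1
      simp only [MulOpposite.op_one, one_smul, star_one, one_mul] at h3
      rw [matForm_apply, h1, h3, star_dotProduct_eq_zero_of_eigen hA
        (fun h => hst (Subtype.ext h.symm)) (hf t) (hf s), zero_mul]
  rw [← matForm_apply A hA, h2, ← coe_sum, Quaternion.re_coe]

/-- The spectral theorem for the real symmetric operator underlying a quaternionic Hermitian
matrix: the eigenspaces for negative and for nonnegative eigenvalues span everything. -/
theorem iSup_rightEigenspace {A : Matrix (Fin n) (Fin n) ℍ[ℝ]} (hA : A.conjTranspose = A) :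
    (⨆ t : Set.Iio (0 : ℝ), rightEigenspace A (t : ℝ)) ⊔
      (⨆ t : Set.Ici (0 : ℝ), rightEigenspace A (t : ℝ)) = ⊤ := by
  set W := (⨆ t : Set.Iio (0 : ℝ), rightEigenspace A (t : ℝ)) ⊔
      (⨆ t : Set.Ici (0 : ℝ), rightEigenspace A (t : ℝ)) with hW
  let E := PiLp 2 fun _ : Fin n => ℍ[ℝ]
  let T : E →ₗ[ℝ] E :=
    { toFun := fun x => WithLp.toLp 2 (A.mulVec (WithLp.ofLp x))
      map_add' := fun x y => by rw [WithLp.ofLp_add, Matrix.mulVec_add, WithLp.toLp_add]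
      map_smul' := fun r x => by
        rw [WithLp.ofLp_smul, Matrix.mulVec_smul, WithLp.toLp_smul, RingHom.id_apply] }
  have hinner : ∀ x y : E, inner ℝ x y = (star (WithLp.ofLp y) ⬝ᵥ WithLp.ofLp x).re := by
    intro x y
    have hre : ∀ f : Fin n → ℍ[ℝ], (∑ i, f i).re = ∑ i, (f i).re := fun f =>
      map_sum (⟨⟨fun q : ℍ[ℝ] => q.re, rfl⟩, fun _ _ => rfl⟩ : ℍ[ℝ] →+ ℝ) f Finset.univ
    rw [PiLp.inner_apply, dotProduct, hre]
    refine Finset.sum_congr rfl fun i _ => ?_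
    rw [Quaternion.inner_def]
    simp
    ring
  have hT : T.IsSymmetric := by
    intro x y
    rw [hinner, hinner]
    change (star (WithLp.ofLp y) ⬝ᵥ A.mulVec (WithLp.ofLp x)).re
      = (star (A.mulVec (WithLp.ofLp y)) ⬝ᵥ WithLp.ofLp x).re
    rw [star_dotProduct_conjTranspose, hA]
  have htop : (⨆ t : ℝ, Module.End.eigenspace T t) = ⊤ := by
    rw [← Submodule.orthogonal_eq_bot_iff]
    exact hT.orthogonalComplement_iSup_eigenspaces_eq_bot
  rw [eq_top_iff]
  intro v _
  have hle : (⨆ t : ℝ, Module.End.eigenspace T t)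
      ≤ (W.restrictScalars ℝ).comap (WithLp.linearEquiv 2 ℝ (Fin n → ℍ[ℝ])).toLinearMap := by
    refine iSup_le fun t x hx => ?_
    have hx' : A.mulVec (WithLp.ofLp x) = (WithLp.ofLp x) <• (t : ℍ[ℝ]) := by
      have h1 := congrArg WithLp.ofLp (Module.End.mem_eigenspace_iff.mp hx)
      change A.mulVec (WithLp.ofLp x) = t • WithLp.ofLp x at h1
      rw [h1, real_smul_eq]
    change WithLp.ofLp x ∈ W
    rcases lt_or_ge t 0 with ht | ht
    · exact Submodule.mem_sup_left (Submodule.mem_iSup_of_mem (⟨t, ht⟩ : Set.Iio (0 : ℝ)) hx')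
    · exact Submodule.mem_sup_right (Submodule.mem_iSup_of_mem (⟨t, ht⟩ : Set.Ici (0 : ℝ)) hx')
  rw [htop] at hle
  exact hle (x := WithLp.toLp 2 v) trivial

theorem negDef_iSup_rightEigenspace {A : Matrix (Fin n) (Fin n) ℍ[ℝ]} (hA : A.conjTranspose = A) :
    (matForm A hA).NegDef (⨆ t : Set.Iio (0 : ℝ), rightEigenspace A (t : ℝ)) := by
  intro v hv h0
  obtain ⟨f, hfv, hf⟩ := exists_eigen_decomposition hA _ hv
  rw [matForm_apply, hf]
  have hne : f.support.Nonempty := by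
    rw [Finsupp.support_nonempty_iff]
    rintro rfl
    exact h0 (by rw [← hfv]; simp)
  refine Finset.sum_neg (fun t ht => ?_) hne
  refine mul_neg_of_neg_of_pos t.2 ?_
  obtain ⟨i, hi⟩ := Function.ne_iff.mp (Finsupp.mem_support_iff.mp ht)
  refine Finset.sum_pos' (fun i _ => by positivity) ⟨i, Finset.mem_univ i, ?_⟩
  have := norm_pos_iff.mpr hi
  positivity

theorem nonneg_iSup_rightEigenspace {A : Matrix (Fin n) (Fin n) ℍ[ℝ]} (hA : A.conjTranspose = A) :
    ∀ v ∈ (⨆ t : Set.Ici (0 : ℝ), rightEigenspace A (t : ℝ)),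
      0 ≤ ((matForm A hA).toFun v v).re := by
  intro v hv
  obtain ⟨f, -, hf⟩ := exists_eigen_decomposition hA _ hv
  rw [matForm_apply, hf]
  exact Finset.sum_nonneg fun t _ => mul_nonneg t.2 (Finset.sum_nonneg fun i _ => by positivity)

/-- `sqNeg A` is the maximal dimension of a negative definite subspace. -/
theorem finrank_le_sqNeg {A : Matrix (Fin n) (Fin n) ℍ[ℝ]} (hA : A.conjTranspose = A)
    {N : Submodule ℍ[ℝ]ᵐᵒᵖ (Fin n → ℍ[ℝ])} (hN : (matForm A hA).NegDef N) :
    Module.finrank ℍ[ℝ]ᵐᵒᵖ N ≤ sqNeg A :=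
  hN.finrank_le (nonneg_iSup_rightEigenspace hA)
    ⟨(negDef_iSup_rightEigenspace hA).disjoint_of_nonneg (nonneg_iSup_rightEigenspace hA),
      codisjoint_iff.mpr (iSup_rightEigenspace hA)⟩

/-! ### Signature matrices and orthogonal sums -/

theorem IsSignature.mulVec_mulVec {J : Matrix (Fin n) (Fin n) ℍ[ℝ]} (hJ : IsSignature J)
    (v : Fin n → ℍ[ℝ]) : J.mulVec (J.mulVec v) = v := by
  have h := hJ.2
  rw [hJ.1] at h
  rw [Matrix.mulVec_mulVec, h, Matrix.one_mulVec]

/-- The only negative eigenvalue of a signature matrix is `-1`, as `J² = I`. -/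
theorem IsSignature.sqNeg_eq {J : Matrix (Fin n) (Fin n) ℍ[ℝ]} (hJ : IsSignature J) :
    sqNeg J = Module.finrank ℍ[ℝ]ᵐᵒᵖ (rightEigenspace J (-1)) := by
  have : (⨆ t : Set.Iio (0 : ℝ), rightEigenspace J (t : ℝ)) = rightEigenspace J (-1) := by
    refine le_antisymm (iSup_le fun t v hv => ?_)
      (le_iSup_of_le (⟨-1, by simp⟩ : Set.Iio (0 : ℝ)) le_rfl)
    have h1 := mem_rightEigenspace.mp hv
    have h2 := hJ.mulVec_mulVec v
    rw [h1, Matrix.mulVec_smul, h1, smul_smul, ← MulOpposite.op_mul, ← Quaternion.coe_mul] at h2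
    by_cases ht : (t : ℝ) = -1
    · rw [← ht]; exact hv
    · have h3 : v <• (((t : ℝ) * t - 1 : ℝ) : ℍ[ℝ]) = 0 := by
        rw [Quaternion.coe_sub, MulOpposite.op_sub, sub_smul, h2, Quaternion.coe_one,
          MulOpposite.op_one, one_smul, sub_self]
      rcases smul_eq_zero.mp h3 with h4 | h4
      · exfalso
        rw [MulOpposite.op_eq_zero_iff] at h4
        have h5 : ((t : ℝ) * t - 1) = 0 := Quaternion.coe_injective h4
        have h6 : ((t : ℝ) - 1) * (t + 1) = 0 := by linarith
        have ht0 : (t : ℝ) < 0 := t.2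
        rcases mul_eq_zero.mp h6 with h7 | h7
        · linarith
        · exact ht (by linarith)
      · rw [h4]; exact Submodule.zero_mem _
  rw [sqNeg, this]

/-- A signature matrix is diagonalized by the projections `(I ± J) / 2`. -/
theorem IsSignature.isCompl {J : Matrix (Fin n) (Fin n) ℍ[ℝ]} (hJ : IsSignature J) :
    IsCompl (rightEigenspace J 1) (rightEigenspace J (-1)) := by
  have e1 : ∀ v : Fin n → ℍ[ℝ], v <• ((1 : ℝ) : ℍ[ℝ]) = v := fun v => by
    rw [Quaternion.coe_one, MulOpposite.op_one, one_smul]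
  have e2 : ∀ v : Fin n → ℍ[ℝ], v <• ((-1 : ℝ) : ℍ[ℝ]) = -v := fun v => by
    rw [Quaternion.coe_neg, Quaternion.coe_one, MulOpposite.op_neg, MulOpposite.op_one, neg_smul,
      one_smul]
  refine ⟨?_, ?_⟩
  · rw [Submodule.disjoint_def]
    intro v hv hv'
    have h1 := mem_rightEigenspace.mp hv
    rw [mem_rightEigenspace.mp hv', e1, e2] at h1
    have h2 : (2 : ℝ) • v = 0 := by
      rw [two_smul]
      nth_rewrite 1 [← h1]
      rw [neg_add_cancel]
    exact (smul_eq_zero.mp h2).resolve_left two_ne_zero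
  · rw [codisjoint_iff, eq_top_iff]
    intro v _
    have hp : (2⁻¹ : ℝ) • (v + J.mulVec v) ∈ rightEigenspace J 1 := by
      rw [mem_rightEigenspace, e1, Matrix.mulVec_smul, Matrix.mulVec_add, hJ.mulVec_mulVec,
        add_comm]
    have hm : (2⁻¹ : ℝ) • (v - J.mulVec v) ∈ rightEigenspace J (-1) := by
      rw [mem_rightEigenspace, e2, Matrix.mulVec_smul, Matrix.mulVec_sub, hJ.mulVec_mulVec,
        ← smul_neg, neg_sub]
    have h1 : v = (2⁻¹ : ℝ) • (v + J.mulVec v) + (2⁻¹ : ℝ) • (v - J.mulVec v) := by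
      rw [← smul_add, add_add_sub_cancel, ← two_smul ℝ, smul_smul]
      norm_num
    rw [h1]
    exact Submodule.add_mem_sup hp hm

variable {P : Type*} [AddCommGroup P] [Module ℍ[ℝ]ᵐᵒᵖ P]

/-- The form `[x, y] + v^* J u` on `P ⊕ ℍⁿ`. -/
def prodForm (G : HermForm P) (J : Matrix (Fin n) (Fin n) ℍ[ℝ]) (hJ : J.conjTranspose = J) :
    HermForm (P × (Fin n → ℍ[ℝ])) where
  toFun x y := G.toFun x.1 y.1 + (matForm J hJ).toFun x.2 y.2
  add_left u v w := by
    simp only [Prod.fst_add, Prod.snd_add, HermForm.add_left]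
    abel
  smul_smul v w a b := by
    simp only [Prod.smul_fst, Prod.smul_snd, HermForm.smul_smul, mul_add, add_mul]
  conj_symm v w := by
    rw [star_add, ← HermForm.conj_symm, ← HermForm.conj_symm]

theorem prodForm_apply (G : HermForm P) (J : Matrix (Fin n) (Fin n) ℍ[ℝ]) (hJ : J.conjTranspose = J)
    (x y : P × (Fin n → ℍ[ℝ])) :
    (prodForm G J hJ).toFun x y = G.toFun x.1 y.1 + star y.2 ⬝ᵥ J.mulVec x.2 := rfl

/-- Adding `ℍⁿ` with the form of a signature matrix `J` raises the index by `sqNeg J`. -/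
theorem IsPontryaginSpace.prod {G : HermForm P} {κ : ℕ} (hG : IsPontryaginSpace G κ)
    {J : Matrix (Fin n) (Fin n) ℍ[ℝ]} (hJ : IsSignature J) :
    IsPontryaginSpace (prodForm G J hJ.1) (κ + sqNeg J) := by
  obtain ⟨Pp, Pm, hd, hr⟩ := hG
  have hfin := hd.finite
  set Jp := rightEigenspace J 1 with hJp
  set Jm := rightEigenspace J (-1) with hJm
  have hp : ∀ v ∈ Jp, J.mulVec v = v := fun v hv => by
    have h := mem_rightEigenspace.mp hv
    rwa [Quaternion.coe_one, MulOpposite.op_one, one_smul] at h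
  have hm : ∀ v ∈ Jm, J.mulVec v = -v := fun v hv => by
    have h := mem_rightEigenspace.mp hv
    rwa [Quaternion.coe_neg, Quaternion.coe_one, MulOpposite.op_neg, MulOpposite.op_one, neg_smul,
      one_smul] at h
  have hpos : ∀ v ∈ Jp, ((matForm J hJ.1).toFun v v).re = ∑ i, ‖v i‖ ^ 2 := fun v hv => by
    rw [matForm_apply, hp v hv, star_dotProduct_self, Quaternion.re_coe]
  have hneg : ∀ v ∈ Jm, ((matForm J hJ.1).toFun v v).re = -∑ i, ‖v i‖ ^ 2 := fun v hv => by
    rw [matForm_apply, hm v hv, dotProduct_neg, star_dotProduct_self, Quaternion.re_neg,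
      Quaternion.re_coe]
  have hsum : ∀ v : Fin n → ℍ[ℝ], 0 ≤ ∑ i, ‖v i‖ ^ 2 := fun v =>
    Finset.sum_nonneg fun i _ => by positivity
  have hsum0 : ∀ v : Fin n → ℍ[ℝ], v ≠ 0 → 0 < ∑ i, ‖v i‖ ^ 2 := fun v hv => by
    obtain ⟨i, hi⟩ := Function.ne_iff.mp hv
    refine Finset.sum_pos' (fun i _ => by positivity) ⟨i, Finset.mem_univ i, ?_⟩
    have := norm_pos_iff.mpr hi
    positivity
  let e : (Pm.prod Jm) ≃ₗ[ℍ[ℝ]ᵐᵒᵖ] Pm × Jm :=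
    { toFun := fun x => (⟨x.1.1, x.2.1⟩, ⟨x.1.2, x.2.2⟩)
      map_add' := fun _ _ => rfl
      map_smul' := fun _ _ => rfl
      invFun := fun x => ⟨(x.1, x.2), x.1.2, x.2.2⟩
      left_inv := fun _ => rfl
      right_inv := fun _ => rfl }
  refine ⟨Pp.prod Jp, Pm.prod Jm, ⟨?_, ?_, ?_, ?_, ?_, ?_⟩, ?_⟩
  · refine ⟨?_, ?_⟩
    · rw [Submodule.disjoint_def]
      rintro ⟨x, u⟩ ⟨hx, hu⟩ ⟨hx', hu'⟩
      exact Prod.ext (Submodule.disjoint_def.mp hd.isCompl.disjoint x hx hx')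
        (Submodule.disjoint_def.mp hJ.isCompl.disjoint u hu hu')
    · rw [codisjoint_iff, Submodule.prod_sup_prod, hd.isCompl.sup_eq_top, hJ.isCompl.sup_eq_top,
        Submodule.prod_top]
  · rintro ⟨x, u⟩ ⟨hx, hu⟩ ⟨y, v⟩ ⟨hy, hv⟩
    change G.toFun x y + star v ⬝ᵥ J.mulVec u = 0
    have h0 := star_dotProduct_eq_zero_of_eigen hJ.1 (by norm_num : (1 : ℝ) ≠ -1) hu hv
    rw [hd.orthogonal x hx y hy, hp u hu, h0, add_zero]
  · rintro ⟨x, u⟩ ⟨hx, hu⟩ h0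
    change 0 < (G.toFun x x + (matForm J hJ.1).toFun u u).re
    rw [Quaternion.re_add, hpos u hu]
    by_cases hx0 : x = 0
    · have hu0 : u ≠ 0 := fun h => h0 (Prod.ext hx0 h)
      exact add_pos_of_nonneg_of_pos (hd.nonneg x hx) (hsum0 u hu0)
    · exact add_pos_of_pos_of_nonneg (hd.pos x hx hx0) (hsum u)
  · intro u hu hcauchy
    have hre : ∀ x : P × (Fin n → ℍ[ℝ]), x ∈ Pp.prod Jp →
        ((prodForm G J hJ.1).toFun x x).re = (G.toFun x.1 x.1).re + ∑ i, ‖x.2 i‖ ^ 2 :=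
      fun x hx => by
        change (G.toFun x.1 x.1 + (matForm J hJ.1).toFun x.2 x.2).re = _
        rw [Quaternion.re_add, hpos x.2 hx.2]
    obtain ⟨x, hx, hlim⟩ := hd.complete (fun k => (u k).1) (fun k => (hu k).1) (fun ε hε => by
      obtain ⟨k₀, hk⟩ := hcauchy ε hε
      refine ⟨k₀, fun m hm k hk' => lt_of_le_of_lt ?_ (hk m hm k hk')⟩
      rw [hre _ (Submodule.sub_mem _ (hu m) (hu k))]
      exact le_add_of_nonneg_right (hsum _))
    have hcs : CauchySeq fun k => (u k).2 := by
      rw [Metric.cauchySeq_iff]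
      intro ε hε
      obtain ⟨k₀, hk⟩ := hcauchy (ε ^ 2) (by positivity)
      refine ⟨k₀, fun m hm k hk' => ?_⟩
      rw [dist_eq_norm, pi_norm_lt_iff hε]
      intro i
      have h1 := hk m hm k hk'
      rw [hre _ (Submodule.sub_mem _ (hu m) (hu k))] at h1
      have h2 := hd.nonneg _ (Submodule.sub_mem _ (hu m).1 (hu k).1)
      have h3 := Finset.single_le_sum (f := fun i => ‖(u m - u k).2 i‖ ^ 2)
        (fun i _ => by positivity) (Finset.mem_univ i)
      refine lt_of_pow_lt_pow_left₀ 2 hε.le (lt_of_le_of_lt h3 (lt_of_le_of_lt ?_ h1))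
      exact le_add_of_nonneg_left h2
    obtain ⟨w, hw⟩ := cauchySeq_tendsto_of_complete hcs
    have hwJ : w ∈ Jp := by
      have h1 : Filter.Tendsto (fun k => J.mulVec (u k).2) Filter.atTop (nhds (J.mulVec w)) := by
        have hc : Continuous fun v : Fin n → ℍ[ℝ] => J.mulVec v := by fun_prop
        exact (hc.tendsto w).comp hw
      have h2 : (fun k => J.mulVec (u k).2) = fun k => (u k).2 := funext fun k => hp _ (hu k).2
      rw [h2] at h1
      rw [hJp, mem_rightEigenspace, Quaternion.coe_one, MulOpposite.op_one, one_smul]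
      exact tendsto_nhds_unique h1 hw
    refine ⟨(x, w), ⟨hx, hwJ⟩, ?_⟩
    have h1 : (fun k => ((prodForm G J hJ.1).toFun (u k - (x, w)) (u k - (x, w))).re)
        = fun k => (G.toFun ((u k).1 - x) ((u k).1 - x)).re + ∑ i, ‖(u k).2 i - w i‖ ^ 2 :=
      funext fun k => hre _ (Submodule.sub_mem _ (hu k) ⟨hx, hwJ⟩)
    rw [h1]
    have h2 : Filter.Tendsto (fun k => ∑ i, ‖(u k).2 i - w i‖ ^ 2) Filter.atTop
        (nhds (∑ i, ‖w i - w i‖ ^ 2)) := by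
      have hc : Continuous fun v : Fin n → ℍ[ℝ] => ∑ i, ‖v i - w i‖ ^ 2 := by fun_prop
      exact (hc.tendsto w).comp hw
    have h3 : ∑ i, ‖w i - w i‖ ^ 2 = 0 := by simp
    rw [h3] at h2
    have h4 := hlim.add h2
    rwa [add_zero] at h4
  · rintro ⟨x, u⟩ ⟨hx, hu⟩ h0
    change (G.toFun x x + (matForm J hJ.1).toFun u u).re < 0
    rw [Quaternion.re_add, hneg u hu]
    by_cases hx0 : x = 0
    · have hu0 : u ≠ 0 := fun h => h0 (Prod.ext hx0 h)
      have := hsum0 u hu0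
      have := hd.nonpos x hx
      linarith
    · have := hd.neg x hx hx0
      have := hsum u
      linarith
  · exact Module.Finite.equiv e.symm
  · rw [e.finrank_eq, Module.finrank_prod, hr, hJ.sqNeg_eq]

end Matrices

/-! ### Slice hyperholomorphic functions as holomorphic functions -/

section Slice

theorem unitSphere_mul_self {I : ℍ[ℝ]} (hI : I ∈ unitSphere) : I * I = -1 := by
  have h1 : star I = -I := Quaternion.star_eq_neg.mpr hI.1
  have h2 := Quaternion.self_mul_star I
  rw [h1, mul_neg, Quaternion.normSq_eq_norm_mul_self, hI.2, mul_one, Quaternion.coe_one] at h2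
  rw [← h2, neg_neg]

theorem unitSphere_star {I : ℍ[ℝ]} (hI : I ∈ unitSphere) : star I = -I :=
  Quaternion.star_eq_neg.mpr hI.1

/-- The embedding `x + iy ↦ x + Iy` of `ℂ` onto the slice `ℝ + Iℝ`. -/
def sliceEmb (I : ℍ[ℝ]) : ℂ →L[ℝ] ℍ[ℝ] :=
  Complex.reCLM.smulRight (1 : ℍ[ℝ]) + Complex.imCLM.smulRight I

theorem sliceEmb_apply (I : ℍ[ℝ]) (z : ℂ) : sliceEmb I z = (z.re : ℍ[ℝ]) + I * (z.im : ℍ[ℝ]) := by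
  rw [Quaternion.mul_coe_eq_smul]
  change z.re • (1 : ℍ[ℝ]) + z.im • I = _
  rw [← Quaternion.mul_coe_eq_smul (z.re), one_mul]

theorem sliceEmb_ofReal (I : ℍ[ℝ]) (t : ℝ) : sliceEmb I t = (t : ℍ[ℝ]) := by
  rw [sliceEmb_apply, Complex.ofReal_re, Complex.ofReal_im, Quaternion.coe_zero, mul_zero, add_zero]

theorem norm_sliceEmb {I : ℍ[ℝ]} (hI : I ∈ unitSphere) (z : ℂ) : ‖sliceEmb I z‖ = ‖z‖ := by
  have h1 : Quaternion.normSq (sliceEmb I z) = Complex.normSq z := by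
    have h2 : Quaternion.normSq I = 1 := by
      rw [Quaternion.normSq_eq_norm_mul_self, hI.2, mul_one]
    rw [Quaternion.normSq_def'] at h2
    rw [hI.1] at h2
    have hre : (sliceEmb I z) = z.re • (1 : ℍ[ℝ]) + z.im • I := rfl
    rw [hre, Quaternion.normSq_def', Complex.normSq_apply]
    simp [hI.1]
    linear_combination z.im ^ 2 * h2
  rw [Quaternion.normSq_eq_norm_mul_self, Complex.normSq_eq_norm_sq, ← sq] at h1
  exact (pow_left_inj₀ (norm_nonneg _) (norm_nonneg _) two_ne_zero).mp h1

/-- A left inverse of the slice embedding. -/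
theorem sliceEmb_leftInv {I : ℍ[ℝ]} (hI : I ∈ unitSphere) (z : ℂ) :
    (⟨(sliceEmb I z).re, -(I * sliceEmb I z).re⟩ : ℂ) = z := by
  have hre : (sliceEmb I z) = z.re • (1 : ℍ[ℝ]) + z.im • I := rfl
  have h2 : I * sliceEmb I z = z.re • I - z.im • 1 := by
    rw [hre, mul_add, mul_smul_comm, mul_smul_comm, unitSphere_mul_self hI, mul_one, smul_neg,
      sub_eq_add_neg]
  apply Complex.ext
  · rw [hre]; simp [hI.1]
  · rw [h2]; simp [hI.1]

/-- Every quaternion lies on some slice. -/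
theorem exists_sliceEmb (p : ℍ[ℝ]) : ∃ I ∈ unitSphere, ∃ z, sliceEmb I z = p := by
  by_cases h : p.im = 0
  · refine ⟨((Complex.I : ℂ) : ℍ[ℝ]), ⟨by rw [Quaternion.re_coeComplex, Complex.I_re], ?_⟩,
      (p.re : ℂ), ?_⟩
    · have h1 : Quaternion.normSq ((Complex.I : ℂ) : ℍ[ℝ]) = 1 := by
        rw [Quaternion.normSq_def', Quaternion.re_coeComplex, Quaternion.imI_coeComplex,
          Quaternion.imJ_coeComplex, Quaternion.imK_coeComplex, Complex.I_re, Complex.I_im]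
        norm_num
      rw [Quaternion.normSq_eq_norm_mul_self] at h1
      nlinarith [norm_nonneg ((Complex.I : ℂ) : ℍ[ℝ])]
    · rw [sliceEmb_ofReal]
      conv_rhs => rw [← Quaternion.re_add_im p, h, add_zero]
  · have h0 : ‖p.im‖ ≠ 0 := norm_ne_zero_iff.mpr h
    refine ⟨‖p.im‖⁻¹ • p.im, ⟨by simp, ?_⟩, ⟨p.re, ‖p.im‖⟩, ?_⟩
    · rw [norm_smul, norm_inv, norm_norm, inv_mul_cancel₀ h0]
    · rw [sliceEmb_apply, Quaternion.mul_coe_eq_smul, smul_smul, mul_inv_cancel₀ h0, one_smul]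
      exact Quaternion.re_add_im p

/-- The trace of `V` on a slice is a domain of the complex plane. -/
theorem slice_preconnected {V : Set ℍ[ℝ]} (hV : IsSliceDomain V) {I : ℍ[ℝ]} (hI : I ∈ unitSphere) :
    IsPreconnected (sliceEmb I ⁻¹' V) := by
  have h1 := (hV.slice_connected I hI).isPreconnected.image
    (fun q => (⟨q.re, -(I * q).re⟩ : ℂ)) (by
      have : (fun q : ℍ[ℝ] => (⟨q.re, -(I * q).re⟩ : ℂ))
          = fun q => (q.re : ℂ) + ((-(I * q).re : ℝ) : ℂ) * Complex.I := by
        funext q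
        exact (Complex.mk_eq_add_mul_I _ _)
      rw [this]
      refine Continuous.continuousOn ?_
      refine (Complex.continuous_ofReal.comp Quaternion.continuous_re).add
        ((Complex.continuous_ofReal.comp ?_).mul continuous_const)
      exact (Quaternion.continuous_re.comp (continuous_const.mul continuous_id)).neg)
  convert h1 using 1
  ext z
  constructor
  · intro hz
    exact ⟨sliceEmb I z, ⟨hz, z.re, z.im, sliceEmb_apply I z⟩, sliceEmb_leftInv hI z⟩
  · rintro ⟨q, ⟨hq, x, y, rfl⟩, rfl⟩
    have h2 : (x : ℍ[ℝ]) + I * (y : ℍ[ℝ]) = sliceEmb I ⟨x, y⟩ := (sliceEmb_apply I ⟨x, y⟩).symm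
    have h3 := sliceEmb_leftInv hI ⟨x, y⟩
    rw [← h2] at h3
    change sliceEmb I ⟨_, _⟩ ∈ V
    rw [h3, ← h2]
    exact hq

/-- A slice hyperholomorphic function becomes holomorphic when composed with a functional that
turns left multiplication by `I` into multiplication by `i`. -/
theorem SliceRegularOn.differentiableOn {f : ℍ[ℝ] → ℍ[ℝ]} {V : Set ℍ[ℝ]} (hVo : IsOpen V)
    (hf : SliceRegularOn f V) {I : ℍ[ℝ]} (hI : I ∈ unitSphere) (χ : ℍ[ℝ] →ₗ[ℝ] ℂ)
    (hχ : ∀ v, χ (I * v) = Complex.I * χ v) :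
    DifferentiableOn ℂ (fun z => χ (f (sliceEmb I z))) (sliceEmb I ⁻¹' V) := by
  intro z hz
  refine DifferentiableAt.differentiableWithinAt ?_
  have hfd : DifferentiableAt ℝ f (sliceEmb I z) :=
    (hf.1 _ hz).differentiableAt (hVo.mem_nhds hz)
  set L := fderiv ℝ f (sliceEmb I z) with hL
  let χ' : ℍ[ℝ] →L[ℝ] ℂ := LinearMap.toContinuousLinearMap χ
  have hg : HasFDerivAt (fun z => χ (f (sliceEmb I z))) ((χ'.comp L).comp (sliceEmb I)) z :=
    (χ'.hasFDerivAt.comp (sliceEmb I z) hfd.hasFDerivAt).comp z (sliceEmb I).hasFDerivAt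
  rw [differentiableAt_complex_iff_differentiableAt_real]
  refine ⟨hg.differentiableAt, ?_⟩
  rw [hg.fderiv]
  change χ (L (sliceEmb I Complex.I)) = Complex.I * χ (L (sliceEmb I 1))
  have e1 : sliceEmb I 1 = 1 := by
    rw [sliceEmb_apply]; simp
  have e2 : sliceEmb I Complex.I = I := by
    rw [sliceEmb_apply]; simp
  rw [e1, e2, ← hχ]
  congr 1
  have hz' : sliceEmb I z = (z.re : ℍ[ℝ]) + I * (z.im : ℍ[ℝ]) := sliceEmb_apply I z
  have h1 := hf.2 I hI z.re z.im (hz' ▸ hz)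
  have hc : ∀ t : ℝ, HasDerivAt (fun t : ℝ => (t : ℍ[ℝ])) 1 t := fun t => by
    have h : (fun t : ℝ => (t : ℍ[ℝ])) = fun t => t • (1 : ℍ[ℝ]) := by
      funext t
      rw [← Quaternion.mul_coe_eq_smul, one_mul]
    rw [h]
    simpa using (hasDerivAt_id t).smul_const (1 : ℍ[ℝ])
  have d1 : HasDerivAt (fun t : ℝ => f ((t : ℍ[ℝ]) + I * (z.im : ℍ[ℝ]))) (L 1) z.re := by
    have := (hc z.re).add_const (I * (z.im : ℍ[ℝ]))
    rw [hz'] at hL hfd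
    exact hL ▸ (hfd.hasFDerivAt.comp_hasDerivAt z.re this)
  have d2 : HasDerivAt (fun t : ℝ => f ((z.re : ℍ[ℝ]) + I * (t : ℍ[ℝ]))) (L I) z.im := by
    have := ((hc z.im).const_mul I).const_add (z.re : ℍ[ℝ])
    rw [mul_one] at this
    rw [hz'] at hL hfd
    exact hL ▸ (hfd.hasFDerivAt.comp_hasDerivAt z.im this)
  rw [d1.deriv, d2.deriv] at h1
  have h2 := (smul_eq_zero.mp h1).resolve_left (by norm_num)
  have h3 : I * (L 1 + I * L I) = 0 := by rw [h2, mul_zero]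
  rw [mul_add, ← mul_assoc, unitSphere_mul_self hI, neg_one_mul, add_neg_eq_zero] at h3
  exact h3.symm

end Slice

/-! ### The space of square summable coefficient sequences -/

/-- Square summable sequences of vectors in `ℍ^ι`. -/
abbrev CoeffSpace (ι : Type) [Fintype ι] := lp (fun _ : ℕ => PiLp 2 (fun _ : ι => ℍ[ℝ])) 2

section CoeffSpace

variable {M : ℕ} {ι : Type} [Fintype ι]

theorem exists_norm_mulVec_le {ι κ : Type*} [Fintype ι] [Fintype κ] (A : Matrix κ ι ℍ[ℝ]) :
    ∃ C, 0 ≤ C ∧ ∀ v : ι → ℍ[ℝ], ‖WithLp.toLp 2 (A.mulVec v)‖ ≤ C * ‖WithLp.toLp 2 v‖ := by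
  let T : PiLp 2 (fun _ : ι => ℍ[ℝ]) →ₗ[ℝ] PiLp 2 (fun _ : κ => ℍ[ℝ]) :=
    { toFun := fun x => WithLp.toLp 2 (A.mulVec (WithLp.ofLp x))
      map_add' := fun x y => by rw [WithLp.ofLp_add, Matrix.mulVec_add, WithLp.toLp_add]
      map_smul' := fun r x => by
        rw [WithLp.ofLp_smul, Matrix.mulVec_smul, WithLp.toLp_smul, RingHom.id_apply] }
  exact ⟨‖LinearMap.toContinuousLinearMap T‖, ContinuousLinearMap.opNorm_nonneg _, fun v =>
    (LinearMap.toContinuousLinearMap T).le_opNorm (WithLp.toLp 2 v)⟩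

theorem norm_toLp_left_mul {ι : Type*} [Fintype ι] (a : ℍ[ℝ]) (v : ι → ℍ[ℝ]) :
    ‖WithLp.toLp 2 (a • v)‖ = ‖a‖ * ‖WithLp.toLp 2 v‖ := by
  rw [WithLp.toLp_smul, norm_smul]

/-- The coefficients decay geometrically, at the rate `|q|`. -/
theorem memℓp_coeff (A : Matrix (Fin M) ι ℍ[ℝ]) {q : ℍ[ℝ]} (hq : ‖q‖ < 1) (c : Fin M → ℍ[ℝ]) :
    Memℓp (fun l : ℕ => WithLp.toLp 2 (A.conjTranspose.mulVec ((star q) ^ l • c))) 2 := by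
  refine memℓp_gen ?_
  obtain ⟨C, hC, hA⟩ := exists_norm_mulVec_le A.conjTranspose
  have hs : Summable fun l : ℕ => (C * ‖WithLp.toLp 2 c‖) ^ 2 * (‖q‖ ^ 2) ^ l :=
    (summable_geometric_of_lt_one (by positivity) (by nlinarith [norm_nonneg q])).mul_left _
  refine Summable.of_nonneg_of_le (fun l => by positivity) (fun l => ?_) hs
  have h1 := hA ((star q) ^ l • c)
  rw [norm_toLp_left_mul, norm_pow, Quaternion.norm_star] at h1
  simp only [ENNReal.toReal_ofNat, Real.rpow_ofNat]
  calc _ ≤ (C * (‖q‖ ^ l * ‖WithLp.toLp 2 c‖)) ^ 2 := by gcongr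
    _ = _ := by ring

/-- The vector `h(q) c = (A^* q̄^l c)_l`; with `A = R(q)` it represents the functional
`(x_l) ↦ c^* ∑ q^l R(q) x_l`. (It is set to `0` outside the unit ball.) -/
def coeffVec (A : Matrix (Fin M) ι ℍ[ℝ]) (q : ℍ[ℝ]) (c : Fin M → ℍ[ℝ]) : CoeffSpace ι :=
  if hq : ‖q‖ < 1 then ⟨_, memℓp_coeff A hq c⟩ else 0

theorem coeffVec_apply (A : Matrix (Fin M) ι ℍ[ℝ]) {q : ℍ[ℝ]} (hq : ‖q‖ < 1) (c : Fin M → ℍ[ℝ])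
    (l : ℕ) : (coeffVec A q c) l = WithLp.toLp 2 (A.conjTranspose.mulVec ((star q) ^ l • c)) := by
  rw [coeffVec, dif_pos hq]

theorem coeffVec_add (A : Matrix (Fin M) ι ℍ[ℝ]) (q : ℍ[ℝ]) (c d : Fin M → ℍ[ℝ]) :
    coeffVec A q (c + d) = coeffVec A q c + coeffVec A q d := by
  by_cases hq : ‖q‖ < 1
  · ext1
    funext l
    rw [lp.coeFn_add, Pi.add_apply, coeffVec_apply A hq, coeffVec_apply A hq, coeffVec_apply A hq,
      smul_add, Matrix.mulVec_add, WithLp.toLp_add]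
  · simp [coeffVec, hq]

theorem coeffVec_smul (A : Matrix (Fin M) ι ℍ[ℝ]) (q : ℍ[ℝ]) (c : Fin M → ℍ[ℝ]) (a : ℍ[ℝ]ᵐᵒᵖ) :
    coeffVec A q (a • c) = a • coeffVec A q c := by
  by_cases hq : ‖q‖ < 1
  · ext1
    funext l
    rw [lp.coeFn_smul, Pi.smul_apply, coeffVec_apply A hq, coeffVec_apply A hq, smul_comm,
      Matrix.mulVec_smul, WithLp.toLp_smul]
  · simp [coeffVec, hq]

/-- The functional represented by `h(q) c`. -/
theorem hasSum_inner_coeffVec (A : Matrix (Fin M) ι ℍ[ℝ]) {q : ℍ[ℝ]} (hq : ‖q‖ < 1)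
    (c : Fin M → ℍ[ℝ]) (x : CoeffSpace ι) :
    HasSum (fun l : ℕ => (star c ⬝ᵥ (q ^ l • A.mulVec (WithLp.ofLp (x l)))).re)
      (inner ℝ x (coeffVec A q c)) := by
  have hre : ∀ f : ι → ℍ[ℝ], (∑ i, f i).re = ∑ i, (f i).re := fun f =>
    map_sum (⟨⟨fun q : ℍ[ℝ] => q.re, rfl⟩, fun _ _ => rfl⟩ : ℍ[ℝ] →+ ℝ) f Finset.univ
  have key : (fun l : ℕ => (star c ⬝ᵥ (q ^ l • A.mulVec (WithLp.ofLp (x l)))).re)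
      = fun l => inner ℝ (x l) ((coeffVec A q c) l) := by
    funext l
    rw [coeffVec_apply A hq, PiLp.inner_apply]
    have h1 : star c ⬝ᵥ (q ^ l • A.mulVec (WithLp.ofLp (x l)))
        = star (A.conjTranspose.mulVec ((star q) ^ l • c)) ⬝ᵥ WithLp.ofLp (x l) := by
      rw [Matrix.star_mulVec, Matrix.conjTranspose_conjTranspose, ← Matrix.dotProduct_mulVec]
      simp only [dotProduct, Pi.star_apply, Pi.smul_apply, smul_eq_mul, star_mul, star_pow,
        star_star, mul_assoc]
    rw [h1, dotProduct, hre]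
    refine Finset.sum_congr rfl fun i _ => ?_
    rw [Quaternion.inner_def]
    simp
    ring
  rw [key]
  exact lp.hasSum_inner (𝕜 := ℝ) x (coeffVec A q c)

end CoeffSpace

/-! ### The identity principle on slices -/

section Identity

variable {M : ℕ} {ι : Type} [Fintype ι]

/-- The real functional `v ↦ Re (c^* v) - i Re (c^* I v)`; it turns left multiplication by `I` into
multiplication by `i`. -/
def sliceFunctional (I : ℍ[ℝ]) (c : Fin M → ℍ[ℝ]) : (Fin M → ℍ[ℝ]) →ₗ[ℝ] ℂ where
  toFun v := ⟨(star c ⬝ᵥ v).re, -(star c ⬝ᵥ (I • v)).re⟩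
  map_add' v w := by
    rw [smul_add, dotProduct_add, dotProduct_add, Quaternion.re_add, Quaternion.re_add, neg_add]
    rfl
  map_smul' r v := by
    rw [smul_comm I r v, dotProduct_smul, dotProduct_smul, Quaternion.re_smul, Quaternion.re_smul]
    apply Complex.ext <;> simp

theorem sliceFunctional_mul {I : ℍ[ℝ]} (hI : I ∈ unitSphere) (c v : Fin M → ℍ[ℝ]) :
    sliceFunctional I c (I • v) = Complex.I * sliceFunctional I c v := by
  have h : I • I • v = -v := by
    rw [smul_smul, unitSphere_mul_self hI, neg_one_smul]
  change (⟨(star c ⬝ᵥ (I • v)).re, -(star c ⬝ᵥ (I • I • v)).re⟩ : ℂ)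
    = Complex.I * ⟨(star c ⬝ᵥ v).re, -(star c ⬝ᵥ (I • v)).re⟩
  rw [h, dotProduct_neg, Quaternion.re_neg, neg_neg]
  apply Complex.ext <;> simp

theorem sliceFunctional_sliceEmb {I : ℍ[ℝ]} (hI : I ∈ unitSphere) (c v : Fin M → ℍ[ℝ]) (z : ℂ) :
    sliceFunctional I c (sliceEmb I z • v) = z * sliceFunctional I c v := by
  have h : sliceEmb I z • v = z.re • v + z.im • (I • v) := by
    have : sliceEmb I z = z.re • (1 : ℍ[ℝ]) + z.im • I := rfl
    rw [this, add_smul, smul_assoc, smul_assoc, one_smul]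
  rw [h, map_add, map_smul, map_smul, sliceFunctional_mul hI]
  conv_rhs => rw [← Complex.re_add_im z]
  simp only [Complex.real_smul]
  ring

theorem sliceFunctional_sliceEmb_pow {I : ℍ[ℝ]} (hI : I ∈ unitSphere) (c v : Fin M → ℍ[ℝ]) (z : ℂ)
    (l : ℕ) : sliceFunctional I c (sliceEmb I z ^ l • v) = z ^ l * sliceFunctional I c v := by
  induction l with
  | zero => simp
  | succ l ih => rw [pow_succ', mul_smul, sliceFunctional_sliceEmb hI, ih, pow_succ', mul_assoc]

theorem differentiableOn_power_series (a : ℕ → ℝ) {C : ℝ} (ha : ∀ l, |a l| ≤ C) :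
    DifferentiableOn ℂ (fun z : ℂ => ∑' l, z ^ l * (a l : ℂ)) (Metric.ball 0 1) := by
  intro z hz
  rw [mem_ball_zero_iff] at hz
  obtain ⟨s, hzs, hs⟩ := exists_between hz
  have hs0 : 0 ≤ s := (norm_nonneg z).trans hzs.le
  have h1 : DifferentiableOn ℂ (fun z : ℂ => ∑' l, z ^ l * (a l : ℂ)) (Metric.ball 0 s) := by
    refine Complex.differentiableOn_tsum_of_summable_norm (u := fun l => s ^ l * C)
      ((summable_geometric_of_lt_one hs0 hs).mul_right C) (fun l => by fun_prop) Metric.isOpen_ball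
      fun l w hw => ?_
    rw [mem_ball_zero_iff] at hw
    rw [norm_mul, norm_pow, Complex.norm_real, Real.norm_eq_abs]
    have := ha l
    gcongr
  exact (h1.differentiableAt (Metric.isOpen_ball.mem_nhds (by simpa using hzs)))
    |>.differentiableWithinAt

theorem summable_power_series (a : ℕ → ℝ) {C : ℝ} (ha : ∀ l, |a l| ≤ C) {z : ℂ} (hz : ‖z‖ < 1) :
    Summable fun l => z ^ l * (a l : ℂ) := by
  refine Summable.of_norm_bounded (g := fun l => ‖z‖ ^ l * C)
    ((summable_geometric_of_lt_one (norm_nonneg z) hz).mul_right C) fun l => ?_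
  rw [norm_mul, norm_pow, Complex.norm_real, Real.norm_eq_abs]
  have := ha l
  gcongr

/-- The coordinates of a quaternion in the basis `1, i, j, k`. -/
theorem exists_quaternion_coords : ∃ (e : Fin 4 → ℍ[ℝ]) (γ : Fin 4 → ℍ[ℝ] → ℝ) (C : ℝ),
    (∀ q, q = ∑ k, γ k q • e k) ∧ ∀ k q, |γ k q| ≤ C * ‖q‖ := by
  let b := QuaternionAlgebra.basisOneIJK (-1 : ℝ) 0 (-1)
  let T : ∀ k, ℍ[ℝ] →L[ℝ] ℝ := fun k => LinearMap.toContinuousLinearMap (b.coord k)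
  refine ⟨b, fun k => b.coord k, ∑ k, ‖T k‖, fun q => (b.sum_repr q).symm, fun k q => ?_⟩
  refine ((T k).le_opNorm q).trans ?_
  gcongr
  exact Finset.single_le_sum (f := fun k => ‖T k‖) (fun k _ => ContinuousLinearMap.opNorm_nonneg _)
    (Finset.mem_univ k)

/-- Identity principle: a continuous functional that annihilates the vectors `h(t) c` for all small
real `t > 0` annihilates all the vectors `h(p) c`. On each slice `p ↦ ⟨x, h(p) c⟩` is the real part
of the holomorphic function `∑ z^l χ(R(p) x_l)`. -/
theorem inner_coeffVec_eq_zero {V : Set ℍ[ℝ]} (h0 : (0 : ℍ[ℝ]) ∈ V) (hV1 : V ⊆ Metric.ball 0 1)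
    (hV : IsSliceDomain V) {R : ℍ[ℝ] → Matrix (Fin M) ι ℍ[ℝ]}
    (hR : ∀ i j, SliceRegularOn (fun p => R p i j) V) {r : ℝ} (hr : 0 < r) (x : CoeffSpace ι)
    (hx : ∀ t : ℝ, 0 < t → t < r → ∀ c, inner ℝ x (coeffVec (R t) (t : ℍ[ℝ]) c) = 0) :
    ∀ p ∈ V, ∀ c, inner ℝ x (coeffVec (R p) p c) = 0 := by
  intro p hp c
  obtain ⟨I, hI, z₀, rfl⟩ := exists_sliceEmb p
  set Ω := sliceEmb I ⁻¹' V with hΩ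
  have hΩo : IsOpen Ω := hV.isOpen.preimage (sliceEmb I).continuous
  have hnorm : ∀ z ∈ Ω, ‖z‖ < 1 := fun z hz => by
    have := hV1 hz
    rwa [mem_ball_zero_iff, norm_sliceEmb hI] at this
  obtain ⟨e, γ, C, hγ, hγC⟩ := exists_quaternion_coords
  set χ := sliceFunctional I c with hχ
  -- `G z = ∑ z^l χ(R x_l)`; its imaginary part is again a pairing, with `I c` in place of `c`
  let G : ℂ → ℂ := fun z => ⟨inner ℝ x (coeffVec (R (sliceEmb I z)) (sliceEmb I z) c),
    inner ℝ x (coeffVec (R (sliceEmb I z)) (sliceEmb I z) (I • c))⟩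
  let ψ : ι → Fin 4 → ℂ → ℂ := fun j k z => χ (fun i => R (sliceEmb I z) i j * e k)
  let a : ι → Fin 4 → ℕ → ℝ := fun j k l => γ k (x l j)
  have hC0 : 0 ≤ C := by
    have h1 := (abs_nonneg _).trans (hγC 0 1)
    rwa [norm_one, mul_one] at h1
  have ha : ∀ j k l, |a j k l| ≤ C * ‖x‖ := fun j k l => by
    refine (hγC k _).trans ?_
    gcongr
    exact (PiLp.norm_apply_le (x l) j).trans (lp.norm_apply_le_norm two_ne_zero x l)
  have hψ : ∀ j k, DifferentiableOn ℂ (ψ j k) Ω := by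
    intro j k
    classical
    have h1 : ψ j k = fun z => ∑ i, (χ ∘ₗ LinearMap.single ℝ (fun _ => ℍ[ℝ]) i ∘ₗ
        LinearMap.mulRight ℝ (e k)) (R (sliceEmb I z) i j) := by
      funext z
      change χ _ = _
      conv_lhs => rw [← Finset.univ_sum_single (fun i => R (sliceEmb I z) i j * e k), map_sum]
      rfl
    rw [h1]
    refine DifferentiableOn.fun_sum fun i _ => ?_
    refine (hR i j).differentiableOn hV.isOpen hI _ fun v => ?_
    change χ (Pi.single i (I * v * e k)) = Complex.I * χ (Pi.single i (v * e k))
    rw [← sliceFunctional_mul hI, ← Pi.single_smul', smul_eq_mul, mul_assoc]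
  have hGsum : ∀ z ∈ Ω, G z = ∑ j, ∑ k, ψ j k z * ∑' l, z ^ l * (a j k l : ℂ) := by
    intro z hz
    have hz1 : ‖sliceEmb I z‖ < 1 := by rw [norm_sliceEmb hI]; exact hnorm z hz
    set A := R (sliceEmb I z) with hA
    have s1 : HasSum (fun l : ℕ => χ (sliceEmb I z ^ l • A.mulVec (WithLp.ofLp (x l)))) (G z) := by
      rw [Complex.hasSum_iff]
      refine ⟨hasSum_inner_coeffVec A hz1 c x, ?_⟩
      convert! hasSum_inner_coeffVec A hz1 (I • c) x using 2 with l
      change -(star c ⬝ᵥ (I • (sliceEmb I z ^ l • A.mulVec (WithLp.ofLp (x l))))).re = _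
      rw [← Quaternion.re_neg, ← dotProduct_neg]
      congr 1
      simp only [dotProduct, Pi.star_apply, Pi.smul_apply, Pi.neg_apply, smul_eq_mul, star_mul,
        unitSphere_star hI, mul_assoc, neg_mul, mul_neg]
      rfl
    have s2 : HasSum (fun l : ℕ => ∑ j, ∑ k, ψ j k z * (z ^ l * (a j k l : ℂ)))
        (∑ j, ∑ k, ψ j k z * ∑' l, z ^ l * (a j k l : ℂ)) :=
      hasSum_sum fun j _ => hasSum_sum fun k _ =>
        (summable_power_series (a j k) (ha j k) (hnorm z hz)).hasSum.mul_left _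
    refine s1.unique ?_
    convert! s2 using 2 with l
    rw [sliceFunctional_sliceEmb_pow hI]
    have h1 : A.mulVec (WithLp.ofLp (x l)) = ∑ j, ∑ k, a j k l • fun i => A i j * e k := by
      funext i
      simp only [Matrix.mulVec, dotProduct, Finset.sum_apply, Pi.smul_apply]
      refine Finset.sum_congr rfl fun j _ => ?_
      conv_lhs => rw [hγ (x l j), Finset.mul_sum]
      refine Finset.sum_congr rfl fun k _ => ?_
      rw [mul_smul_comm]
    rw [← hχ, h1, map_sum, Finset.mul_sum]
    refine Finset.sum_congr rfl fun j _ => ?_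
    rw [map_sum, Finset.mul_sum]
    refine Finset.sum_congr rfl fun k _ => ?_
    rw [map_smul, Complex.real_smul]
    change z ^ l * ((a j k l : ℂ) * ψ j k z) = _
    ring
  have hGd : DifferentiableOn ℂ G Ω := by
    refine DifferentiableOn.congr ?_ hGsum
    refine DifferentiableOn.fun_sum fun j _ => DifferentiableOn.fun_sum fun k _ => ?_
    refine (hψ j k).mul ((differentiableOn_power_series (a j k) (ha j k)).mono fun z hz => ?_)
    rw [mem_ball_zero_iff]
    exact hnorm z hz
  have h0Ω : (0 : ℂ) ∈ Ω := by
    change sliceEmb I 0 ∈ V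
    rwa [map_zero]
  have hfreq : ∃ᶠ z in nhdsWithin (0 : ℂ) {0}ᶜ, G z = 0 := by
    have ht : Filter.Tendsto (fun t : ℝ => (t : ℂ)) (nhdsWithin 0 (Set.Ioi 0))
        (nhdsWithin (0 : ℂ) {0}ᶜ) := by
      refine tendsto_nhdsWithin_iff.mpr ⟨?_, ?_⟩
      · exact (Complex.continuous_ofReal.tendsto' 0 0 rfl).mono_left nhdsWithin_le_nhds
      · filter_upwards [self_mem_nhdsWithin] with t (ht : 0 < t)
        simpa using ht.ne'
    refine ht.frequently (Filter.Eventually.frequently ?_)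
    filter_upwards [Ioo_mem_nhdsGT hr] with t ht'
    have h1 := hx t ht'.1 ht'.2
    apply Complex.ext
    · change inner ℝ x (coeffVec (R (sliceEmb I t)) (sliceEmb I t) c) = 0
      rw [sliceEmb_ofReal]; exact h1 c
    · change inner ℝ x (coeffVec (R (sliceEmb I t)) (sliceEmb I t) (I • c)) = 0
      rw [sliceEmb_ofReal]; exact h1 (I • c)
  -- the zeros on `(0, r)` accumulate at `0`
  have hG0 := (hGd.analyticOnNhd hΩo).eqOn_zero_of_preconnected_of_frequently_eq_zero
    (slice_preconnected hV hI) h0Ω hfreq hp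
  exact congrArg Complex.re hG0

end Identity

/-! ### The kernel as a form on coefficient sequences -/

section CoeffForm

variable {M : ℕ} {ι : Type} [Fintype ι]

theorem exists_norm_form_le (A : Matrix ι ι ℍ[ℝ]) :
    ∃ C, 0 ≤ C ∧ ∀ v w : PiLp 2 (fun _ : ι => ℍ[ℝ]),
      ‖star (WithLp.ofLp w) ⬝ᵥ A.mulVec (WithLp.ofLp v)‖ ≤ C * (‖v‖ * ‖w‖) := by
  obtain ⟨C, hC, hA⟩ := exists_norm_mulVec_le A
  refine ⟨Fintype.card ι * C, by positivity, fun v w => ?_⟩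
  have h1 : ∀ i, ‖star (WithLp.ofLp w) i * (A.mulVec (WithLp.ofLp v)) i‖ ≤ C * (‖v‖ * ‖w‖) := by
    intro i
    have h2 := (PiLp.norm_apply_le (WithLp.toLp 2 (A.mulVec (WithLp.ofLp v))) i).trans (hA _)
    rw [norm_mul, Pi.star_apply, Quaternion.norm_star]
    calc _ ≤ ‖w‖ * (C * ‖v‖) :=
          mul_le_mul (PiLp.norm_apply_le w i) h2 (norm_nonneg _) (norm_nonneg _)
      _ = _ := by ring
  refine (norm_sum_le _ _).trans ((Finset.sum_le_sum fun i _ => h1 i).trans_eq ?_)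
  rw [Finset.sum_const, nsmul_eq_mul, Finset.card_univ, mul_assoc]

theorem summable_coeffForm (A : Matrix ι ι ℍ[ℝ]) (x y : CoeffSpace ι) :
    Summable fun l => star (WithLp.ofLp (y l)) ⬝ᵥ A.mulVec (WithLp.ofLp (x l)) := by
  obtain ⟨C, hC, hA⟩ := exists_norm_form_le A
  have hpq : (2 : ENNReal).toReal.HolderConjugate (2 : ENNReal).toReal := by
    rw [ENNReal.toReal_ofNat]; exact Real.HolderConjugate.two_two
  exact Summable.of_norm_bounded ((lp.summable_mul hpq x y).mul_left C) fun l => hA _ _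

/-- The form `[x, y] = ∑ y_l^* A x_l`. -/
def coeffForm (A : Matrix ι ι ℍ[ℝ]) (hA : A.conjTranspose = A) : HermForm (CoeffSpace ι) where
  toFun x y := ∑' l, star (WithLp.ofLp (y l)) ⬝ᵥ A.mulVec (WithLp.ofLp (x l))
  add_left u v w := by
    rw [← (summable_coeffForm A u w).tsum_add (summable_coeffForm A v w)]
    congr 1
    funext l
    rw [lp.coeFn_add, Pi.add_apply, WithLp.ofLp_add, Matrix.mulVec_add, dotProduct_add]
  smul_smul v w a b := by
    rw [← (summable_coeffForm A v w).tsum_mul_left,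
      ← ((summable_coeffForm A v w).mul_left _).tsum_mul_right]
    congr 1
    funext l
    rw [lp.coeFn_smul, lp.coeFn_smul, Pi.smul_apply, Pi.smul_apply, WithLp.ofLp_smul,
      WithLp.ofLp_smul, Matrix.mulVec_smul]
    simp only [dotProduct, Finset.mul_sum, Finset.sum_mul, Pi.star_apply, Pi.smul_apply,
      MulOpposite.smul_eq_mul_unop, MulOpposite.unop_op, star_mul, mul_assoc]
  conj_symm v w := by
    rw [tsum_star]
    congr 1
    funext l
    rw [← Matrix.star_dotProduct_star, star_star, Matrix.star_mulVec, hA,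
      ← Matrix.dotProduct_mulVec]

theorem exists_norm_coeffForm_le (A : Matrix ι ι ℍ[ℝ]) (hA : A.conjTranspose = A) :
    ∃ C, ∀ x y, ‖(coeffForm A hA).toFun x y‖ ≤ C * (‖x‖ * ‖y‖) := by
  obtain ⟨C, hC, hAC⟩ := exists_norm_form_le A
  have hpq : (2 : ENNReal).toReal.HolderConjugate (2 : ENNReal).toReal := by
    rw [ENNReal.toReal_ofNat]; exact Real.HolderConjugate.two_two
  refine ⟨C, fun x y => ?_⟩
  refine (tsum_of_norm_bounded ((lp.summable_mul hpq x y).mul_left C).hasSum fun l =>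
    hAC _ _).trans ?_
  rw [tsum_mul_left]
  gcongr
  exact lp.tsum_mul_le_mul_norm' hpq x y

theorem abs_re_le_norm (q : ℍ[ℝ]) : |q.re| ≤ ‖q‖ := by
  refine abs_le_of_sq_le_sq ?_ (norm_nonneg q)
  rw [sq ‖q‖, ← Quaternion.normSq_eq_norm_mul_self, Quaternion.normSq_def']
  nlinarith [sq_nonneg q.imI, sq_nonneg q.imJ, sq_nonneg q.imK]

theorem continuous_coeffForm_self (A : Matrix ι ι ℍ[ℝ]) (hA : A.conjTranspose = A) :
    Continuous fun x => ((coeffForm A hA).toFun x x).re := by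
  obtain ⟨C, hC⟩ := exists_norm_coeffForm_le A hA
  let B := (coeffForm A hA).reForm.mkContinuous₂ C fun x y => by
    rw [mul_assoc]
    refine le_trans ?_ (hC x y)
    rw [Real.norm_eq_abs]
    exact abs_re_le_norm _
  have : Continuous fun x => B x x := by fun_prop
  exact this

theorem summable_pow_mul_pow {p q : ℍ[ℝ]} (hp : ‖p‖ < 1) (hq : ‖q‖ < 1) (a : ℍ[ℝ]) :
    Summable fun l : ℕ => p ^ l * a * (star q) ^ l := by
  have hpq : ‖p‖ * ‖q‖ < 1 := by nlinarith [norm_nonneg p, norm_nonneg q]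
  refine Summable.of_norm_bounded (g := fun l => (‖p‖ * ‖q‖) ^ l * ‖a‖)
    ((summable_geometric_of_lt_one (by positivity) hpq).mul_right _) fun l => ?_
  rw [norm_mul, norm_mul, norm_pow, norm_pow, Quaternion.norm_star, mul_pow]
  exact le_of_eq (by ring)

/-- The kernel `∑ p^l (R(p) A S(q)^*) q̄^l` is the form of the vectors `h(q) d` and `h(p) c`. -/
theorem coeffForm_coeffVec (A : Matrix ι ι ℍ[ℝ]) (hA : A.conjTranspose = A)
    (R S : Matrix (Fin M) ι ℍ[ℝ]) {p q : ℍ[ℝ]} (hp : ‖p‖ < 1) (hq : ‖q‖ < 1)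
    (c d : Fin M → ℍ[ℝ]) :
    (coeffForm A hA).toFun (coeffVec S q d) (coeffVec R p c)
      = star c ⬝ᵥ (Matrix.of fun i j => ∑' l : ℕ, p ^ l * (R * A * S.conjTranspose) i j
        * (star q) ^ l).mulVec d := by
  set X := R * A * S.conjTranspose with hX
  have hs : ∀ i j, Summable fun l : ℕ => p ^ l * X i j * (star q) ^ l := fun i j =>
    summable_pow_mul_pow hp hq _
  have h1 : HasSum (fun l : ℕ => ∑ i, star c i * ∑ j, p ^ l * X i j * (star q) ^ l * d j)
      (star c ⬝ᵥ (Matrix.of fun i j => ∑' l : ℕ, p ^ l * X i j * (star q) ^ l).mulVec d) :=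
    hasSum_sum fun i _ => (hasSum_sum fun j _ => ((hs i j).hasSum.mul_right _)).mul_left _
  rw [← h1.tsum_eq]
  change ∑' l, _ = _
  congr 1
  funext l
  rw [coeffVec_apply S hq, coeffVec_apply R hp]
  change star (R.conjTranspose.mulVec ((star p) ^ l • c)) ⬝ᵥ
    A.mulVec (S.conjTranspose.mulVec ((star q) ^ l • d)) = _
  rw [Matrix.star_mulVec, Matrix.conjTranspose_conjTranspose, ← Matrix.dotProduct_mulVec,
    Matrix.mulVec_mulVec, Matrix.mulVec_mulVec, ← hX]
  simp only [dotProduct, Matrix.mulVec, Pi.star_apply, Pi.smul_apply, smul_eq_mul, star_mul,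
    star_pow, star_star, mul_assoc, Finset.mul_sum]

end CoeffForm

/-! ### Negative squares of a kernel and negative subspaces -/

section Gram

variable {E : Type*} [AddCommGroup E] [Module ℍ[ℝ]ᵐᵒᵖ E] {M n : ℕ}

/-- The linear map `x ↦ ∑ v_j x_j`. -/
def combMap (v : Fin n → E) : (Fin n → ℍ[ℝ]) →ₗ[ℍ[ℝ]ᵐᵒᵖ] E where
  toFun x := ∑ j, v j <• x j
  map_add' x y := by
    simp only [Pi.add_apply, MulOpposite.op_add, add_smul, Finset.sum_add_distrib]
  map_smul' a x := by
    simp only [Pi.smul_apply, MulOpposite.smul_eq_mul_unop, MulOpposite.op_mul,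
      MulOpposite.op_unop, mul_smul, Finset.smul_sum, RingHom.id_apply]

theorem combMap_apply (v : Fin n → E) (x : Fin n → ℍ[ℝ]) : combMap v x = ∑ j, v j <• x j := rfl

theorem combMap_mem {v : Fin n → E} {L : Submodule ℍ[ℝ]ᵐᵒᵖ E} (hv : ∀ j, v j ∈ L)
    (x : Fin n → ℍ[ℝ]) : combMap v x ∈ L := by
  rw [combMap_apply]
  exact L.sum_mem fun j _ => L.smul_mem _ (hv j)

theorem combMap_single (v : Fin n → E) (j : Fin n) : combMap v (Pi.single j 1) = v j := by
  rw [combMap_apply, Finset.sum_eq_single j]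
  · simp
  · intro i _ hi
    simp [hi]
  · simp

theorem form_combMap (F : HermForm E) (v : Fin n → E) (x y : Fin n → ℍ[ℝ]) :
    F.toFun (combMap v x) (combMap v y)
      = star y ⬝ᵥ (Matrix.of fun l j => F.toFun (v j) (v l)).mulVec x := by
  simp only [combMap_apply, F.sum_left, F.sum_right, F.smul_smul, dotProduct, Matrix.mulVec,
    Matrix.of_apply, Pi.star_apply, Finset.mul_sum, mul_assoc]
  exact Finset.sum_comm

/-- A finitely generated subspace of the span of `s` consists of combinations of a finite family
in `s`. -/
theorem exists_le_range_combMap {s : Set E} {N : Submodule ℍ[ℝ]ᵐᵒᵖ E} [hN : Module.Finite ℍ[ℝ]ᵐᵒᵖ N]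
    (h : N ≤ Submodule.span ℍ[ℝ]ᵐᵒᵖ s) :
    ∃ (n : ℕ) (v : Fin n → E), (∀ j, v j ∈ s) ∧ N ≤ LinearMap.range (combMap v) := by
  obtain ⟨T, hT⟩ := Module.Finite.iff_fg.mp hN
  have hTs : (T : Set E) ⊆ Submodule.span ℍ[ℝ]ᵐᵒᵖ s :=
    Submodule.subset_span.trans (hT.le.trans h)
  obtain ⟨t, hts, hTt⟩ := Submodule.subset_span_finite_of_subset_span hTs
  refine ⟨t.card, fun j => t.equivFin.symm j, fun j => hts (t.equivFin.symm j).2, ?_⟩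
  rw [← hT, Submodule.span_le]
  refine hTt.trans (Submodule.span_le.mpr fun x hx => ?_)
  refine ⟨Pi.single (t.equivFin ⟨x, hx⟩) 1, ?_⟩
  rw [combMap_single, Equiv.symm_apply_apply]

variable (F : HermForm E) (K : ℍ[ℝ] → ℍ[ℝ] → Matrix (Fin M) (Fin M) ℍ[ℝ])
  (k : ℍ[ℝ] → (Fin M → ℍ[ℝ]) → E) {V : Set ℍ[ℝ]}

/-- The span of the vectors `k p c` for `p ∈ V`. -/
def kernelSpan (k : ℍ[ℝ] → (Fin M → ℍ[ℝ]) → E) (V : Set ℍ[ℝ]) : Submodule ℍ[ℝ]ᵐᵒᵖ E :=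
  Submodule.span ℍ[ℝ]ᵐᵒᵖ {x | ∃ p ∈ V, ∃ c, k p c = x}

variable {F K k}

theorem mem_kernelSpan {p : ℍ[ℝ]} (hp : p ∈ V) (c : Fin M → ℍ[ℝ]) : k p c ∈ kernelSpan k V :=
  Submodule.subset_span ⟨p, hp, c, rfl⟩

theorem kernelSpan_mono {W : Set ℍ[ℝ]} (h : W ⊆ V) : kernelSpan k W ≤ kernelSpan k V :=
  Submodule.span_mono fun _ ⟨p, hp, c, hx⟩ => ⟨p, h hp, c, hx⟩

section

variable (hk : ∀ p ∈ V, ∀ q ∈ V, ∀ c d, F.toFun (k q d) (k p c) = star c ⬝ᵥ (K p q).mulVec d)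
include hk

theorem kernel_hermitian {p q : ℍ[ℝ]} (hp : p ∈ V) (hq : q ∈ V) :
    K p q = (K q p).conjTranspose := by
  have h1 : ∀ p ∈ V, ∀ q ∈ V, ∀ i j,
      F.toFun (k q (Pi.single j 1)) (k p (Pi.single i 1)) = K p q i j := by
    intro p hp q hq i j
    rw [hk p hp q hq, Matrix.mulVec_single_one, ← Pi.single_star, star_one, single_one_dotProduct]
    rfl
  ext1 i j
  rw [Matrix.conjTranspose_apply, ← h1 p hp q hq, ← h1 q hq p hp, ← F.conj_symm]

theorem kernelGram_eq {z : Fin n → ℍ[ℝ]} (hz : ∀ j, z j ∈ V) (c : Fin n → Fin M → ℍ[ℝ]) :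
    kernelGram K z c = Matrix.of fun l j => F.toFun (k (z j) (c j)) (k (z l) (c l)) := by
  ext1 l j
  rw [Matrix.of_apply, hk _ (hz l) _ (hz j)]
  rfl

theorem kernelGram_conjTranspose {z : Fin n → ℍ[ℝ]} (hz : ∀ j, z j ∈ V) (c : Fin n → Fin M → ℍ[ℝ]) :
    (kernelGram K z c).conjTranspose = kernelGram K z c := by
  rw [kernelGram_eq hk hz]
  ext1 l j
  rw [Matrix.conjTranspose_apply, Matrix.of_apply, Matrix.of_apply, ← F.conj_symm]

theorem form_combMap_kernel {z : Fin n → ℍ[ℝ]} (hz : ∀ j, z j ∈ V) (c : Fin n → Fin M → ℍ[ℝ])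
    (x y : Fin n → ℍ[ℝ]) :
    F.toFun (combMap (fun j => k (z j) (c j)) x) (combMap (fun j => k (z j) (c j)) y)
      = (matForm _ (kernelGram_conjTranspose hk hz c)).toFun x y := by
  rw [form_combMap, matForm_apply, kernelGram_eq hk hz]

/-- The negative eigenvectors of a Gram matrix span a negative subspace of the same dimension. -/
theorem exists_negDef_of_kernelGram {z : Fin n → ℍ[ℝ]} (hz : ∀ j, z j ∈ V)
    (c : Fin n → Fin M → ℍ[ℝ]) :
    ∃ N ≤ kernelSpan k V, Module.Finite ℍ[ℝ]ᵐᵒᵖ N ∧ F.NegDef N ∧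
      Module.finrank ℍ[ℝ]ᵐᵒᵖ N = sqNeg (kernelGram K z c) := by
  have hG := kernelGram_conjTranspose hk hz c
  have hneg := negDef_iSup_rightEigenspace hG
  set Q := ⨆ t : Set.Iio (0 : ℝ), rightEigenspace (kernelGram K z c) (t : ℝ)
  let f := combMap (fun j => k (z j) (c j))
  have hf : ∀ x ∈ Q, f x = 0 → x = 0 := by
    intro x hx h0
    by_contra hne
    have h1 := hneg x hx hne
    rw [← form_combMap_kernel hk hz] at h1
    change (F.toFun (f x) (f x)).re < 0 at h1
    rw [h0, F.zero_left] at h1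
    exact lt_irrefl _ h1
  refine ⟨Q.map f, ?_, inferInstance, ?_, ?_⟩
  · rintro _ ⟨x, -, rfl⟩
    exact combMap_mem (fun j => mem_kernelSpan (hz j) _) x
  · rintro _ ⟨x, hx, rfl⟩ h0
    rw [form_combMap_kernel hk hz]
    exact hneg x hx fun h => h0 (by rw [h, map_zero])
  · refine (LinearEquiv.finrank_eq (LinearEquiv.ofBijective (f.submoduleMap Q)
      ⟨?_, f.submoduleMap_surjective Q⟩)).symm
    rw [← LinearMap.ker_eq_bot, LinearMap.ker_eq_bot']
    intro m hm
    exact Subtype.ext (hf m m.2 (congrArg Subtype.val hm))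

/-- A negative subspace of the span is detected by a Gram matrix. -/
theorem exists_kernelGram_of_negDef {N : Submodule ℍ[ℝ]ᵐᵒᵖ E} [Module.Finite ℍ[ℝ]ᵐᵒᵖ N]
    (hN : F.NegDef N) (hNk : N ≤ kernelSpan k V) :
    ∃ (n : ℕ) (z : Fin n → ℍ[ℝ]) (c : Fin n → Fin M → ℍ[ℝ]), (∀ j, z j ∈ V) ∧
      Module.finrank ℍ[ℝ]ᵐᵒᵖ N ≤ sqNeg (kernelGram K z c) := by
  obtain ⟨n, v, hv, hle⟩ := exists_le_range_combMap hNk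
  choose z hz c hc using hv
  obtain rfl : (fun j => k (z j) (c j)) = v := funext hc
  refine ⟨n, z, c, hz, ?_⟩
  let f := combMap (fun j => k (z j) (c j))
  have hG := kernelGram_conjTranspose hk hz c
  let X : Submodule ℍ[ℝ]ᵐᵒᵖ (E × (Fin n → ℍ[ℝ])) :=
    LinearMap.range (f.prod LinearMap.id)
  obtain ⟨τ, -, hinj, hneg⟩ := exists_negDef_transfer (F₁ := F) (F₂ := matForm _ hG) X (by
    rintro _ ⟨x, rfl⟩
    exact congrArg (fun q : ℍ[ℝ] => q.re) (form_combMap_kernel hk hz c x x)) N (by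
    intro m hm
    obtain ⟨x, hx⟩ := hle hm
    exact ⟨(f x, x), ⟨x, rfl⟩, hx⟩) hN
  rw [← LinearMap.finrank_range_of_inj hinj]
  exact finrank_le_sqNeg hG hneg

/-- A kernel represented as `K(p, q) = k_p^* k_q` in a space with a Hermitian form has `κ` negative
squares iff `κ` is the largest dimension of a negative definite subspace of the span of the
vectors `k_q d`. -/
theorem hasNegativeSquares_iff {κ : ℕ} : HasNegativeSquares K V κ ↔
    (∀ N ≤ kernelSpan k V, Module.Finite ℍ[ℝ]ᵐᵒᵖ N → F.NegDef N → Module.finrank ℍ[ℝ]ᵐᵒᵖ N ≤ κ) ∧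
    ∃ N ≤ kernelSpan k V, Module.Finite ℍ[ℝ]ᵐᵒᵖ N ∧ F.NegDef N ∧ Module.finrank ℍ[ℝ]ᵐᵒᵖ N = κ := by
  constructor
  · intro h
    refine ⟨fun N hN hfin hneg => ?_, ?_⟩
    · obtain ⟨n, z, c, hz, hle⟩ := exists_kernelGram_of_negDef hk hneg hN
      exact hle.trans (h.le n z c hz)
    · obtain ⟨n, z, c, hz, rfl⟩ := h.attained
      exact exists_negDef_of_kernelGram hk hz c
  · rintro ⟨hle, N, hN, hfin, hneg, hdim⟩
    have hle' : ∀ (n : ℕ) (z : Fin n → ℍ[ℝ]) (c : Fin n → Fin M → ℍ[ℝ]),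
        (∀ i, z i ∈ V) → sqNeg (kernelGram K z c) ≤ κ := by
      intro n z c hz
      obtain ⟨N', hN', hfin', hneg', hdim'⟩ := exists_negDef_of_kernelGram hk hz c
      exact hdim' ▸ hle N' hN' hfin' hneg'
    refine ⟨fun p hp q hq => kernel_hermitian hk hp hq, hle', ?_⟩
    obtain ⟨n, z, c, hz, h1⟩ := exists_kernelGram_of_negDef hk hneg hN
    exact ⟨n, z, c, hz, le_antisymm (hle' n z c hz) (hdim ▸ h1)⟩

end

end Gram

/-! ### Completion of a space of finite negative index -/

section Completion

/-- A quaternion is determined by the real parts of its right multiples. -/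
theorem eq_of_re_mul {p q : ℍ[ℝ]} (h : ∀ a, (p * a).re = (q * a).re) : p = q := by
  have h1 : ((p - q) * star (p - q)).re = 0 := by
    rw [sub_mul, Quaternion.re_sub, h, sub_self]
  rw [Quaternion.self_mul_star, Quaternion.re_coe, Quaternion.normSq_eq_zero] at h1
  exact sub_eq_zero.mp h1

theorem re_mul_comm (p q : ℍ[ℝ]) : (p * q).re = (q * p).re := by
  rw [Quaternion.re_mul, Quaternion.re_mul]
  ring

/-- The quaternion unit `i`. -/
@[simps] def quatI : ℍ[ℝ] := ⟨0, 1, 0, 0⟩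

/-- The quaternion unit `j`. -/
@[simps] def quatJ : ℍ[ℝ] := ⟨0, 0, 1, 0⟩

/-- The quaternion unit `k`. -/
@[simps] def quatK : ℍ[ℝ] := ⟨0, 0, 0, 1⟩

theorem quaternion_eq_units (a : ℍ[ℝ]) :
    a = a.re • (1 : ℍ[ℝ]) + a.imI • quatI + a.imJ • quatJ + a.imK • quatK := by
  apply Quaternion.ext <;> simp

section OfReal

variable {E : Type*} [AddCommGroup E] [Module ℍ[ℝ]ᵐᵒᵖ E] [Module ℝ E] [IsScalarTower ℝ ℍ[ℝ]ᵐᵒᵖ E]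

/-- The quaternion `q` with `Re (q e) = B (x e) y` for the basis quaternions `e`. -/
def quatLift (B : E →ₗ[ℝ] E →ₗ[ℝ] ℝ) (x y : E) : ℍ[ℝ] :=
  ⟨B x y, -B (x <• quatI) y, -B (x <• quatJ) y, -B (x <• quatK) y⟩

theorem re_quatLift_mul (B : E →ₗ[ℝ] E →ₗ[ℝ] ℝ) (x y : E) (a : ℍ[ℝ]) :
    (quatLift B x y * a).re = B (x <• a) y := by
  have h1 : x <• a = a.re • x + a.imI • (x <• quatI) + a.imJ • (x <• quatJ)
      + a.imK • (x <• quatK) := by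
    conv_lhs => rw [quaternion_eq_units a]
    simp only [MulOpposite.op_add, MulOpposite.op_smul, add_smul, smul_assoc, MulOpposite.op_one,
      one_smul]
  rw [h1, Quaternion.re_mul]
  simp only [map_add, map_smul, LinearMap.add_apply, LinearMap.smul_apply, smul_eq_mul, quatLift]
  ring

/-- The Hermitian form with a given real part. -/
def HermForm.ofReal (B : E →ₗ[ℝ] E →ₗ[ℝ] ℝ) (hs : ∀ x y, B x y = B y x)
    (ha : ∀ x y (a : ℍ[ℝ]), B (x <• a) y = B x (y <• star a)) : HermForm E where
  toFun := quatLift B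
  add_left u v w := eq_of_re_mul fun a => by
    rw [add_mul, Quaternion.re_add, re_quatLift_mul, re_quatLift_mul, re_quatLift_mul, smul_add,
      map_add, LinearMap.add_apply]
  smul_smul v w a b := eq_of_re_mul fun c => by
    have h1 := ha (v <• a <• c) w (star b)
    rw [star_star] at h1
    rw [re_quatLift_mul, ← h1, _root_.smul_smul, _root_.smul_smul, ← MulOpposite.op_mul,
      ← MulOpposite.op_mul, ← re_quatLift_mul,
      mul_assoc (star b), mul_assoc (star b), re_mul_comm (star b)]
    simp only [mul_assoc]
  conj_symm v w := eq_of_re_mul fun a => by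
    have h1 : ∀ q : ℍ[ℝ], (star q * a).re = (q * star a).re := fun q => by
      rw [Quaternion.re_mul, Quaternion.re_mul]
      simp
    rw [h1, re_quatLift_mul, re_quatLift_mul, ha, hs]

end OfReal

theorem finiteDimensional_restrictScalars {E : Type*} [AddCommGroup E] [Module ℍ[ℝ]ᵐᵒᵖ E]
    [Module ℝ E] [IsScalarTower ℝ ℍ[ℝ]ᵐᵒᵖ E] (W : Submodule ℍ[ℝ]ᵐᵒᵖ E)
    [Module.Finite ℍ[ℝ]ᵐᵒᵖ W] : FiniteDimensional ℝ (W.restrictScalars ℝ) := by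
  have : FiniteDimensional ℝ W := Module.Finite.trans ℍ[ℝ]ᵐᵒᵖ W
  exact this

/-- Reversing the sign of the inner product on a finite dimensional subspace `W` of a Hilbert
space produces a Pontryagin space. -/
theorem exists_isPontryaginSpace {E : Type*} [NormedAddCommGroup E] [InnerProductSpace ℝ E]
    [CompleteSpace E] [Module ℍ[ℝ]ᵐᵒᵖ E] [IsScalarTower ℝ ℍ[ℝ]ᵐᵒᵖ E]
    (hE : ∀ (x y : E) (a : ℍ[ℝ]), inner ℝ (x <• a) y = inner ℝ x (y <• star a))
    (W : Submodule ℍ[ℝ]ᵐᵒᵖ E) [Module.Finite ℍ[ℝ]ᵐᵒᵖ W]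
    [(W.restrictScalars ℝ).HasOrthogonalProjection] :
    ∃ G : HermForm E, IsPontryaginSpace G (Module.finrank ℍ[ℝ]ᵐᵒᵖ W) ∧ ∀ x y,
      (G.toFun x y).re = inner ℝ (x - (2 : ℝ) • (W.restrictScalars ℝ).starProjection x) y := by
  set W' := W.restrictScalars ℝ with hW'
  set Q := W'.starProjection with hQ
  have hQa : ∀ (x : E) (a : ℍ[ℝ]), Q (x <• a) = Q x <• a := fun x a => by
    refine Submodule.eq_starProjection_of_mem_of_inner_eq_zero
      (W.smul_mem _ (W'.starProjection_apply_mem x)) fun w hw => ?_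
    rw [← smul_sub, hE]
    exact W'.starProjection_inner_eq_zero x _ (W.smul_mem _ hw)
  let B : E →ₗ[ℝ] E →ₗ[ℝ] ℝ := (innerₗ E).comp (LinearMap.id - (2 : ℝ) • (Q : E →ₗ[ℝ] E))
  have hB : ∀ x y, B x y = inner ℝ (x - (2 : ℝ) • Q x) y := fun x y => rfl
  let G := HermForm.ofReal B (fun x y => by
      rw [hB, hB, inner_sub_left, inner_sub_left, real_inner_smul_left, real_inner_smul_left,
        hQ, Submodule.inner_starProjection_left_eq_right, real_inner_comm y x,
        real_inner_comm _ x]) (fun x y a => by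
      rw [hB, hB, hQa, ← hE, smul_comm, ← smul_sub])
  refine ⟨G, ?_, hB⟩
  let Wp : Submodule ℍ[ℝ]ᵐᵒᵖ E :=
    { W'ᗮ with
      smul_mem' := fun a x hx => by
        refine (W'.mem_orthogonal' _).mpr fun w hw => ?_
        have h1 := hE x w a.unop
        rw [MulOpposite.op_unop] at h1
        rw [h1]
        exact (W'.mem_orthogonal' _).mp hx _ (W.smul_mem _ hw) }
  have hWp : ∀ {x}, x ∈ Wp ↔ x ∈ W'ᗮ := Iff.rfl
  have hre : ∀ x y, (G.toFun x y).re = inner ℝ (x - (2 : ℝ) • Q x) y := hB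
  have hp : ∀ x ∈ Wp, ∀ y, (G.toFun x y).re = inner ℝ x y := fun x hx y => by
    rw [hre, (W'.starProjection_apply_eq_zero_iff).mpr hx, smul_zero, sub_zero]
  have hm : ∀ x ∈ W, ∀ y, (G.toFun x y).re = -inner ℝ x y := fun x hx y => by
    rw [hre, W'.starProjection_eq_self_iff.mpr hx, two_smul, sub_add_cancel_left, inner_neg_left]
  refine ⟨Wp, W, ⟨?_, ?_, ?_, ?_, ?_, inferInstance⟩, rfl⟩
  · have h1 := W'.isCompl_orthogonal
    refine ⟨?_, ?_⟩
    · rw [Submodule.disjoint_def]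
      exact fun x hx hx' => Submodule.disjoint_def.mp h1.disjoint x hx' hx
    · rw [codisjoint_iff, eq_top_iff]
      intro x _
      have hx := Submodule.add_mem_sup (S := W) (T := Wp) (W'.starProjection_apply_mem x)
        (W'.sub_starProjection_mem_orthogonal x)
      rw [add_sub_cancel] at hx
      rwa [sup_comm]
  · intro v hv
    refine G.eq_zero_of_re W v fun w hw => ?_
    rw [hp v hv]
    exact (W'.mem_orthogonal' _).mp hv w hw
  · intro v hv h0
    rw [hp v hv, real_inner_self_eq_norm_sq]
    have := norm_pos_iff.mpr h0
    positivity
  · intro u hu hc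
    have h1 : CauchySeq u := by
      refine Metric.cauchySeq_iff.mpr fun ε hε => ?_
      obtain ⟨n₀, hn₀⟩ := hc (ε ^ 2) (by positivity)
      refine ⟨n₀, fun m hm n hn => ?_⟩
      have h2 := hn₀ m hm n hn
      rw [hp _ (Wp.sub_mem (hu m) (hu n)), real_inner_self_eq_norm_sq] at h2
      rw [dist_eq_norm]
      exact lt_of_pow_lt_pow_left₀ 2 hε.le h2
    obtain ⟨v, hv⟩ := cauchySeq_tendsto_of_complete h1
    have hvW : v ∈ Wp :=
      hWp.mpr (W'.isClosed_orthogonal.mem_of_tendsto hv (Filter.Eventually.of_forall hu))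
    refine ⟨v, hvW, ?_⟩
    have h2 : ∀ n, (G.toFun (u n - v) (u n - v)).re = ‖u n - v‖ ^ 2 := fun n => by
      rw [hp _ (Wp.sub_mem (hu n) hvW), real_inner_self_eq_norm_sq]
    simp only [h2]
    have h3 := (tendsto_iff_norm_sub_tendsto_zero.mp hv).pow 2
    rwa [zero_pow two_ne_zero] at h3
  · intro v hv h0
    rw [hm v hv, real_inner_self_eq_norm_sq, neg_lt_zero]
    have := norm_pos_iff.mpr h0
    positivity

universe u

/-- A space whose form has a maximal negative subspace `N` maps isometrically onto a dense subspace
of a Pontryagin space: complete for the semi-inner product that reverses the sign of the form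
on `N`. The last clause is the continuity of the map for this seminorm. -/
theorem exists_pontryagin_completion {L : Type u} [AddCommGroup L] [Module ℍ[ℝ]ᵐᵒᵖ L]
    {F : HermForm L} {N : Submodule ℍ[ℝ]ᵐᵒᵖ L} [Module.Finite ℍ[ℝ]ᵐᵒᵖ N] (hN : F.NegDef N)
    (hpos : ∀ v ∈ F.orth N, 0 ≤ (F.toFun v v).re) :
    ∃ (P : Type u) (_ : AddCommGroup P) (_ : Module ℍ[ℝ]ᵐᵒᵖ P) (G : HermForm P)
      (j : L →ₗ[ℍ[ℝ]ᵐᵒᵖ] P), IsPontryaginSpace G (Module.finrank ℍ[ℝ]ᵐᵒᵖ N) ∧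
        (∀ x y, G.toFun (j x) (j y) = F.toFun x y) ∧
        (∀ f, (∀ x, G.toFun f (j x) = 0) → f = 0) ∧
        ∀ f, ∃ C, ∀ x, |(G.toFun f (j x)).re| ≤ C * √(hilbertNormSq F hN.isCompl_orth.symm x) := by
  have h := hN.isCompl_orth.symm
  have ho : ∀ v ∈ F.orth N, ∀ w ∈ N, F.toFun v w = 0 := fun v hv w hw => hv w hw
  have hneg : ∀ v ∈ N, (F.toFun v v).re ≤ 0 := fun v hv => by
    by_cases h0 : v = 0
    · rw [h0]; simp
    · exact (hN v hv h0).le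
  let _ := realModule L
  have _ := realModule_isScalarTower L
  let core := fundPreCore h ho hpos hneg
  let _ : SeminormedAddCommGroup L :=
    @InnerProductSpace.Core.toSeminormedAddCommGroup ℝ L _ _ _ core
  let _ : InnerProductSpace ℝ L := InnerProductSpace.ofCore core
  have hinner : ∀ x y : L, inner ℝ x y = (F.toFun x (fundSymm h y)).re := fun x y => rfl
  have hadj : ∀ (x y : L) (a : ℍ[ℝ]), inner ℝ (x <• a) y = inner ℝ x (y <• star a) := by
    intro x y a
    rw [hinner, hinner, map_smul, F.smul_left, F.smul_right, star_star, re_mul_comm]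
  have hnorm : ∀ x : L, ‖x‖ ^ 2 = hilbertNormSq F h x := fun x => by
    rw [← real_inner_self_eq_norm_sq, hinner, hilbertNormSq_eq h ho]
  have : IsBoundedSMul ℍ[ℝ]ᵐᵒᵖ L := IsBoundedSMul.of_norm_smul_le fun a x => by
    have h1 : ‖a • x‖ ^ 2 = (‖a‖ * ‖x‖) ^ 2 := by
      have h2 := hadj x (x <• a.unop) a.unop
      rw [smul_smul, ← MulOpposite.op_mul, Quaternion.self_mul_star,
        Quaternion.normSq_eq_norm_mul_self, ← real_smul_eq, inner_smul_right,
        real_inner_self_eq_norm_sq, real_inner_self_eq_norm_sq, MulOpposite.op_unop] at h2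
      rw [h2, mul_pow, sq ‖a‖]
      rfl
    exact le_of_eq ((pow_left_inj₀ (norm_nonneg _) (by positivity) two_ne_zero).mp h1)
  -- the completion also divides out the null vectors of the seminorm
  let P := UniformSpace.Completion L
  have hP : ∀ (x y : P) (a : ℍ[ℝ]), inner ℝ (x <• a) y = inner ℝ x (y <• star a) := by
    intro x y a
    induction x, y using UniformSpace.Completion.induction_on₂ with
    | hp =>
      refine isClosed_eq ?_ ?_
      · exact Continuous.inner (f := fun x : P × P => x.1 <• a)
          ((continuous_const_smul (MulOpposite.op a)).comp continuous_fst)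
          continuous_snd
      · exact Continuous.inner (g := fun x : P × P => x.2 <• star a) continuous_fst
          ((continuous_const_smul (MulOpposite.op (star a))).comp continuous_snd)
    | ih x y =>
      rw [← UniformSpace.Completion.coe_smul, ← UniformSpace.Completion.coe_smul,
        UniformSpace.Completion.inner_coe, UniformSpace.Completion.inner_coe, hadj]
  let j : L →ₗ[ℍ[ℝ]ᵐᵒᵖ] P :=
    { toFun := fun x => x
      map_add' := UniformSpace.Completion.coe_add
      map_smul' := UniformSpace.Completion.coe_smul }
  have hj : ∀ x y, inner ℝ (j x) (j y) = inner ℝ x y := UniformSpace.Completion.inner_coe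
  have : IsScalarTower ℝ ℍ[ℝ]ᵐᵒᵖ P := inferInstance
  let W := N.map j
  have := finiteDimensional_restrictScalars W
  obtain ⟨G, hG, hGre⟩ := exists_isPontryaginSpace hP W
  -- the Hilbert space projection onto `j N` restricts to the projection of `L` onto `N`
  have hQ : ∀ x, (W.restrictScalars ℝ).starProjection (j x)
      = j (N.projection (F.orth N) h.symm x) := by
    intro x
    refine Submodule.eq_starProjection_of_mem_of_inner_eq_zero
      ⟨_, Submodule.projection_apply_mem h.symm x, rfl⟩ ?_
    rintro _ ⟨n, hn, rfl⟩
    rw [← map_sub, hj, hinner, sub_eq_of_eq_add (proj_add_proj h x).symm, fundSymm_apply,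
      (Submodule.projection_apply_eq_zero_iff h).mpr hn, zero_sub,
      Submodule.projection_apply_of_mem_left h.symm hn, F.neg_right,
      ho _ (Submodule.projection_apply_mem h x) n hn, neg_zero]
    rfl
  have hsymm : ∀ f x, (G.toFun (j f) (j x)).re = (F.toFun f x).re := by
    intro f x
    have h1 : f - (2 : ℝ) • N.projection (F.orth N) h.symm f = fundSymm h f := by
      rw [fundSymm_apply, eq_sub_of_add_eq (proj_add_proj h f), two_smul]
      abel
    rw [hGre, hQ]
    have h2 : j f - (2 : ℝ) • j (N.projection (F.orth N) h.symm f) = j (fundSymm h f) := by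
      rw [← h1, map_sub]
      congr 1
      exact (UniformSpace.Completion.coe_smul _ _).symm
    rw [h2, hj, real_inner_comm, hinner, fundSymm_fundSymm, F.re_symm]
  have hGF : ∀ x y, G.toFun (j x) (j y) = F.toFun x y := fun x y => eq_of_re_mul fun a => by
    rw [← G.smul_left, ← F.smul_left, ← map_smul, hsymm]
  have hdim : Module.finrank ℍ[ℝ]ᵐᵒᵖ W = Module.finrank ℍ[ℝ]ᵐᵒᵖ N := by
    refine (LinearEquiv.finrank_eq (LinearEquiv.ofBijective (j.submoduleMap N)
      ⟨?_, j.submoduleMap_surjective N⟩)).symm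
    rw [← LinearMap.ker_eq_bot, LinearMap.ker_eq_bot']
    intro m hm
    have hm' : j m = 0 := congrArg Subtype.val hm
    by_contra h0
    have h1 := hN m m.2 fun h => h0 (Subtype.ext h)
    rw [← hGF, hm', G.zero_left] at h1
    exact lt_irrefl _ h1
  refine ⟨P, inferInstance, inferInstance, G, j, hdim ▸ hG, hGF, fun f hf => ?_, fun f => ?_⟩
  · set Q := (W.restrictScalars ℝ).starProjection
    have h1 : ∀ y : P, inner ℝ (f - (2 : ℝ) • Q f) y = 0 := by
      intro y
      induction y using UniformSpace.Completion.induction_on with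
      | hp => exact isClosed_eq (continuous_const.inner continuous_id) continuous_const
      | ih y =>
        rw [← hGre]
        exact congrArg (fun q : ℍ[ℝ] => q.re) (hf y)
    have h2 : f - (2 : ℝ) • Q f = 0 := inner_self_eq_zero.mp (h1 _)
    have h3 : Q f - (2 : ℝ) • Q f = 0 := by
      have := congrArg Q h2
      rwa [map_sub, map_smul, map_zero, Submodule.starProjection_eq_self_iff.mpr
        (Submodule.starProjection_apply_mem _ f)] at this
    rw [two_smul, sub_add_cancel_left, neg_eq_zero] at h3
    rwa [h3, smul_zero, sub_zero] at h2
  · refine ⟨‖f - (2 : ℝ) • (W.restrictScalars ℝ).starProjection f‖, fun x => ?_⟩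
    rw [hGre, ← hnorm, Real.sqrt_sq (norm_nonneg x),
      ← UniformSpace.Completion.norm_coe (E := L)]
    exact abs_real_inner_le_norm _ _

end Completion

/-! ### The reproducing kernel space of a generalized Schur function -/

section Model

/-- For a bounded form, the seminorm that reverses the sign of the form on a finite dimensional
negative definite subspace `N` is bounded: the projection onto `N` is, since the form is uniformly
negative on `N`. -/
theorem exists_hilbertNormSq_le {E : Type*} [NormedAddCommGroup E] [NormedSpace ℝ E]
    [Module ℍ[ℝ]ᵐᵒᵖ E] [IsScalarTower ℝ ℍ[ℝ]ᵐᵒᵖ E] {F : HermForm E} {C : ℝ}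
    (hC : ∀ x y, ‖F.toFun x y‖ ≤ C * (‖x‖ * ‖y‖)) (hF : Continuous fun x => (F.toFun x x).re)
    {N : Submodule ℍ[ℝ]ᵐᵒᵖ E} [Module.Finite ℍ[ℝ]ᵐᵒᵖ N] (hN : F.NegDef N) :
    ∃ C', ∀ x, hilbertNormSq F hN.isCompl_orth.symm x ≤ C' * ‖x‖ ^ 2 := by
  obtain ⟨ε, hε, -, hneg⟩ := hN.uniformly_neg hF
  have h := hN.isCompl_orth.symm
  have ho : ∀ v ∈ F.orth N, ∀ w ∈ N, F.toFun v w = 0 := fun v hv w hw => hv w hw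
  refine ⟨C + 2 * (C ^ 2 / ε), fun x => ?_⟩
  have hxx : (F.toFun x x).re ≤ C * ‖x‖ ^ 2 := by
    refine (le_abs_self _).trans ((abs_re_le_norm _).trans ((hC x x).trans_eq ?_))
    ring
  set n := N.projection (F.orth N) h.symm x with hn
  have hnN : n ∈ N := Submodule.projection_apply_mem h.symm x
  have hself := congrArg (fun q : ℍ[ℝ] => q.re) (form_self h ho x)
  have hxn : F.toFun x n = F.toFun n n := by
    conv_lhs =>
      rw [← proj_add_proj h x, F.add_left, ho _ (Submodule.projection_apply_mem h x) n hnN]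
    rw [zero_add]
  have h1 : -(F.toFun n n).re ≤ C * (‖x‖ * ‖n‖) := by
    rw [← hxn]
    exact (neg_le_abs _).trans ((abs_re_le_norm _).trans (hC x n))
  have h2 := hneg n hnN
  have h3 : ‖n‖ * (ε * ‖n‖) ≤ ‖n‖ * (C * ‖x‖) := by nlinarith
  have h4 : -(F.toFun n n).re ≤ C ^ 2 / ε * ‖x‖ ^ 2 := by
    rcases (norm_nonneg n).eq_or_lt with h0 | h0
    · rw [← h0] at h1
      refine (h1.trans_eq (by ring)).trans (b := 0) (by positivity)
    · have h5 := le_of_mul_le_mul_left h3 h0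
      have h6 : 0 ≤ C * ‖x‖ := le_trans (by positivity) h5
      rw [div_mul_eq_mul_div, le_div_iff₀ hε]
      calc -(F.toFun n n).re * ε ≤ C * (‖x‖ * ‖n‖) * ε := by gcongr
        _ = C * ‖x‖ * (ε * ‖n‖) := by ring
        _ ≤ C * ‖x‖ * (C * ‖x‖) := by gcongr
        _ = _ := by ring
  have h7 : hilbertNormSq F h x = (F.toFun x x).re - 2 * (F.toFun n n).re := by
    rw [Quaternion.re_add] at hself
    change _ - _ = _
    linarith
  rw [h7]
  linarith

variable {M N : ℕ}

/-- The matrix `diag(J₂, -J₁)`. -/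
def schurMatrix (J₁ : Matrix (Fin N) (Fin N) ℍ[ℝ]) (J₂ : Matrix (Fin M) (Fin M) ℍ[ℝ]) :
    Matrix (Fin M ⊕ Fin N) (Fin M ⊕ Fin N) ℍ[ℝ] :=
  Matrix.fromBlocks J₂ 0 0 (-J₁)

theorem schurMatrix_conjTranspose {J₁ : Matrix (Fin N) (Fin N) ℍ[ℝ]}
    {J₂ : Matrix (Fin M) (Fin M) ℍ[ℝ]} (hJ₁ : J₁.conjTranspose = J₁) (hJ₂ : J₂.conjTranspose = J₂) :
    (schurMatrix J₁ J₂).conjTranspose = schurMatrix J₁ J₂ := by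
  rw [schurMatrix, Matrix.fromBlocks_conjTranspose, hJ₂, Matrix.conjTranspose_neg, hJ₁,
    Matrix.conjTranspose_zero, Matrix.conjTranspose_zero]

/-- The matrix `(I, A)`. -/
def schurRow (A : Matrix (Fin M) (Fin N) ℍ[ℝ]) : Matrix (Fin M) (Fin M ⊕ Fin N) ℍ[ℝ] :=
  Matrix.fromCols (1 : Matrix (Fin M) (Fin M) ℍ[ℝ]) A

/-- The vector `h(p) c = (R(p)^* p̄^l c)_l` with `R(p) = (I, Θ(p))`. -/
def schurVec (Θ : ℍ[ℝ] → Matrix (Fin M) (Fin N) ℍ[ℝ]) (p : ℍ[ℝ]) (c : Fin M → ℍ[ℝ]) :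
    CoeffSpace (Fin M ⊕ Fin N) :=
  coeffVec (schurRow (Θ p)) p c

theorem schurRow_mul_schurMatrix (J₁ : Matrix (Fin N) (Fin N) ℍ[ℝ])
    (J₂ : Matrix (Fin M) (Fin M) ℍ[ℝ]) (A B : Matrix (Fin M) (Fin N) ℍ[ℝ]) :
    schurRow A * schurMatrix J₁ J₂ * (schurRow B).conjTranspose
      = J₂ - A * J₁ * B.conjTranspose := by
  rw [schurRow, schurRow, schurMatrix, Matrix.fromCols_mul_fromBlocks,
    Matrix.conjTranspose_fromCols_eq_fromRows_conjTranspose,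
    Matrix.fromCols_mul_fromRows]
  simp [sub_eq_add_neg]

theorem coeffForm_schurVec {J₁ : Matrix (Fin N) (Fin N) ℍ[ℝ]}
    {J₂ : Matrix (Fin M) (Fin M) ℍ[ℝ]} (hJ : (schurMatrix J₁ J₂).conjTranspose = schurMatrix J₁ J₂)
    (Θ : ℍ[ℝ] → Matrix (Fin M) (Fin N) ℍ[ℝ]) {p q : ℍ[ℝ]} (hp : ‖p‖ < 1) (hq : ‖q‖ < 1)
    (c d : Fin M → ℍ[ℝ]) :
    (coeffForm (schurMatrix J₁ J₂) hJ).toFun (schurVec Θ q d) (schurVec Θ p c)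
      = star c ⬝ᵥ (schurKernel J₁ J₂ Θ p q).mulVec d := by
  rw [schurVec, schurVec, coeffForm_coeffVec _ _ _ _ hp hq, schurRow_mul_schurMatrix]
  rfl

/-- The points of the real interval `(0, r)`. -/
def realSegment (r : ℝ) : Set ℍ[ℝ] := {p | ∃ t : ℝ, 0 < t ∧ t < r ∧ (t : ℍ[ℝ]) = p}

theorem exists_realSegment_subset {V : Set ℍ[ℝ]} (hV : IsOpen V) (h0 : (0 : ℍ[ℝ]) ∈ V) :
    ∃ r > 0, realSegment r ⊆ V := by
  obtain ⟨r, hr, hrV⟩ := Metric.isOpen_iff.mp hV 0 h0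
  refine ⟨r, hr, ?_⟩
  rintro _ ⟨t, ht, htr, rfl⟩
  refine hrV ?_
  rw [mem_ball_zero_iff, Quaternion.norm_coe, Real.norm_eq_abs, abs_of_pos ht]
  exact htr

theorem realSegment_mono {r s : ℝ} (h : r ≤ s) : realSegment r ⊆ realSegment s :=
  fun _ ⟨t, ht, htr, hp⟩ => ⟨t, ht, htr.trans_le h, hp⟩

theorem SliceRegularOn.const (a : ℍ[ℝ]) (V : Set ℍ[ℝ]) : SliceRegularOn (fun _ => a) V := by
  refine ⟨differentiableOn_const a, fun I _ x y _ => ?_⟩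
  simp

/-- By the identity principle the vectors `h(t) c` at small positive reals span a dense subspace. -/
theorem kernelSpan_subset_closure {V : Set ℍ[ℝ]} (h0 : (0 : ℍ[ℝ]) ∈ V)
    (hV1 : V ⊆ Metric.ball 0 1) (hV : IsSliceDomain V)
    {Θ : ℍ[ℝ] → Matrix (Fin M) (Fin N) ℍ[ℝ]} (hΘ : MatrixSliceRegularOn Θ V) {r : ℝ} (hr : 0 < r) :
    (kernelSpan (schurVec Θ) V : Set (CoeffSpace (Fin M ⊕ Fin N))) ⊆
      closure (kernelSpan (schurVec Θ) (realSegment r)) := by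
  set D := kernelSpan (schurVec Θ) (realSegment r)
  change kernelSpan (schurVec Θ) V ≤ D.topologicalClosure
  refine Submodule.span_le.mpr ?_
  rintro _ ⟨p, hp, c, rfl⟩
  have h1 : schurVec Θ p c ∈ (D.restrictScalars ℝ).topologicalClosure := by
    rw [← Submodule.orthogonal_orthogonal_eq_closure, Submodule.mem_orthogonal]
    intro x hx
    refine inner_coeffVec_eq_zero h0 hV1 hV (R := fun p => schurRow (Θ p)) ?_ hr x ?_ p hp c
    · rintro i (j | j)
      · exact SliceRegularOn.const _ V
      · exact hΘ i j
    · intro t ht htr c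
      exact (Submodule.mem_orthogonal' _ _).mp hx _
        (mem_kernelSpan (V := realSegment r) ⟨t, ht, htr, rfl⟩ c)
  exact h1

end Model

section ReproducingSpace

/-- The restriction of a Hermitian form to a subspace. -/
def HermForm.restrict {E : Type*} [AddCommGroup E] [Module ℍ[ℝ]ᵐᵒᵖ E] (F : HermForm E)
    (L : Submodule ℍ[ℝ]ᵐᵒᵖ E) : HermForm L where
  toFun x y := F.toFun x y
  add_left u v w := F.add_left u v w
  smul_smul v w a b := F.smul_smul v w a b
  conj_symm v w := F.conj_symm v w

variable {M N : ℕ}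

/-- The linear map `schurVec Θ p` into the span of its values. -/
def schurVecₗ (Θ : ℍ[ℝ] → Matrix (Fin M) (Fin N) ℍ[ℝ]) (V : Set ℍ[ℝ]) (p : ℍ[ℝ]) (hp : p ∈ V) :
    (Fin M → ℍ[ℝ]) →ₗ[ℍ[ℝ]ᵐᵒᵖ] kernelSpan (schurVec Θ) V where
  toFun c := ⟨schurVec Θ p c, mem_kernelSpan hp c⟩
  map_add' c d := Subtype.ext (coeffVec_add _ p c d)
  map_smul' a c := Subtype.ext (coeffVec_smul _ p c a)

/-- The kernel of a generalized Schur function is the reproducing kernel of a Pontryagin space: the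
completion of the span of the vectors `h(p) c`. By the identity principle, the kernel vectors at
small positive reals already span a dense subspace. -/
theorem exists_reproducing_space {J₁ : Matrix (Fin N) (Fin N) ℍ[ℝ]}
    {J₂ : Matrix (Fin M) (Fin M) ℍ[ℝ]} (hJ₁ : IsSignature J₁) (hJ₂ : IsSignature J₂)
    {V : Set ℍ[ℝ]} (h0 : (0 : ℍ[ℝ]) ∈ V) (hV1 : V ⊆ Metric.ball 0 1) (hV : IsSliceDomain V)
    {Θ : ℍ[ℝ] → Matrix (Fin M) (Fin N) ℍ[ℝ]} (hΘ : MatrixSliceRegularOn Θ V) {κ : ℕ}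
    (hκ : HasNegativeSquares (schurKernel J₁ J₂ Θ) V κ) :
    ∃ (P : Type) (_ : AddCommGroup P) (_ : Module ℍ[ℝ]ᵐᵒᵖ P) (G : HermForm P)
      (k : ℍ[ℝ] → ((Fin M → ℍ[ℝ]) →ₗ[ℍ[ℝ]ᵐᵒᵖ] P)), IsPontryaginSpace G κ ∧
        (∀ p ∈ V, ∀ q ∈ V, ∀ c d,
          G.toFun (k q d) (k p c) = star c ⬝ᵥ (schurKernel J₁ J₂ Θ p q).mulVec d) ∧
        ∀ r > 0, ∀ f, (∀ t : ℝ, 0 < t → t < r → ∀ c, G.toFun f (k t c) = 0) → f = 0 := by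
  classical
  have hJ := schurMatrix_conjTranspose hJ₁.1 hJ₂.1
  have hnorm : ∀ p ∈ V, ‖p‖ < 1 := fun p hp => mem_ball_zero_iff.mp (hV1 hp)
  set F := coeffForm (schurMatrix J₁ J₂) hJ with hF
  have hk : ∀ p ∈ V, ∀ q ∈ V, ∀ c d, F.toFun (schurVec Θ q d) (schurVec Θ p c)
      = star c ⬝ᵥ (schurKernel J₁ J₂ Θ p q).mulVec d := fun p hp q hq c d =>
    coeffForm_schurVec hJ Θ (hnorm p hp) (hnorm q hq) c d
  obtain ⟨hmax, N₀, hN₀L, hfin, hneg, hdim⟩ := (hasNegativeSquares_iff hk).mp hκ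
  set L := kernelSpan (schurVec Θ) V with hL
  let FL := F.restrict L
  let N₁ : Submodule ℍ[ℝ]ᵐᵒᵖ L := N₀.comap L.subtype
  have e : N₁ ≃ₗ[ℍ[ℝ]ᵐᵒᵖ] N₀ := Submodule.comapSubtypeEquivOfLe hN₀L
  have hfin₁ : Module.Finite ℍ[ℝ]ᵐᵒᵖ N₁ := Module.Finite.equiv e.symm
  have hdim₁ : Module.finrank ℍ[ℝ]ᵐᵒᵖ N₁ = κ := e.finrank_eq.trans hdim
  have hneg₁ : FL.NegDef N₁ := fun v hv hv0 => hneg v hv fun h => hv0 (Subtype.ext h)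
  have hpos := hneg₁.nonneg_of_maximal fun N' hN' hneg' => by
    rw [hdim₁, (Submodule.equivSubtypeMap L N').finrank_eq]
    refine hmax _ (Submodule.map_subtype_le L N') inferInstance ?_
    rintro _ ⟨v, hv, rfl⟩ hv0
    exact hneg' v hv fun h => hv0 (by rw [h]; rfl)
  obtain ⟨P, _, _, G, j, hG, hGF, htriv, hcont⟩ := exists_pontryagin_completion hneg₁ hpos
  rw [hdim₁] at hG
  obtain ⟨C, hC⟩ := exists_norm_coeffForm_le (schurMatrix J₁ J₂) hJ
  obtain ⟨C', hC'⟩ := exists_hilbertNormSq_le (F := FL) (C := C) (fun x y => hC x y)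
    ((continuous_coeffForm_self _ hJ).comp continuous_subtype_val) hneg₁
  obtain ⟨r₀, hr₀, hr₀V⟩ := exists_realSegment_subset hV.isOpen h0
  let k : ℍ[ℝ] → ((Fin M → ℍ[ℝ]) →ₗ[ℍ[ℝ]ᵐᵒᵖ] P) := fun p =>
    if hp : p ∈ V then j ∘ₗ schurVecₗ Θ V p hp else 0
  have hkV : ∀ p (hp : p ∈ V) c, k p c = j ⟨schurVec Θ p c, mem_kernelSpan hp c⟩ := fun p hp c => by
    simp only [k, dif_pos hp]
    rfl
  refine ⟨P, inferInstance, inferInstance, G, k, hG, ?_, ?_⟩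
  · intro p hp q hq c d
    rw [hkV p hp, hkV q hq, hGF]
    exact hk p hp q hq c d
  · intro r hr f hf
    -- `f` is orthogonal to the span over `(0, min r r₀)`, dense in `L`, and pairing with `f` is
    -- continuous for the norm of `L`
    have hW : realSegment (min r r₀) ⊆ V := (realSegment_mono (min_le_right _ _)).trans hr₀V
    have hle : kernelSpan (schurVec Θ) (realSegment (min r r₀)) ≤ L := kernelSpan_mono hW
    have h1 : ∀ y (hy : y ∈ kernelSpan (schurVec Θ) (realSegment (min r r₀))),
        G.toFun f (j ⟨y, hle hy⟩) = 0 := by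
      intro y hy
      induction hy using Submodule.span_induction with
      | mem y hy =>
        obtain ⟨p, hp, c, rfl⟩ := hy
        have hpV := hW hp
        obtain ⟨t, ht, htr, rfl⟩ := hp
        have := hf t ht (htr.trans_le (min_le_left _ _)) c
        rwa [hkV _ hpV] at this
      | zero =>
        have : (⟨0, hle (Submodule.zero_mem _)⟩ : L) = 0 := rfl
        rw [this, map_zero, G.zero_right]
      | add y z hy hz ihy ihz =>
        have : (⟨y + z, hle (Submodule.add_mem _ hy hz)⟩ : L) = ⟨y, hle hy⟩ + ⟨z, hle hz⟩ := rfl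
        rw [this, map_add, G.add_right, ihy, ihz, add_zero]
      | smul a y hy ih =>
        have : (⟨a • y, hle (Submodule.smul_mem _ a hy)⟩ : L) = a • ⟨y, hle hy⟩ := rfl
        have h2 := G.smul_right f (j ⟨y, hle hy⟩) a.unop
        rw [MulOpposite.op_unop] at h2
        rw [this, map_smul, h2, ih, mul_zero]
    obtain ⟨C₁, hC₁⟩ := hcont f
    let φ : L →+ ℝ :=
      { toFun := fun x => (G.toFun f (j x)).re
        map_zero' := by rw [map_zero, G.zero_right]; rfl
        map_add' := fun x y => by rw [map_add, G.add_right]; rfl }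
    have hφ : Continuous φ := by
      refine (φ.mkNormedAddGroupHom (|C₁| * √|C'|) fun x => ?_).continuous
      refine (hC₁ x).trans ?_
      have h2 : √(hilbertNormSq FL hneg₁.isCompl_orth.symm x) ≤ √|C'| * ‖x‖ := by
        rw [← Real.sqrt_sq (norm_nonneg x), ← Real.sqrt_mul (abs_nonneg _)]
        refine Real.sqrt_le_sqrt ((hC' x).trans ?_)
        gcongr
        exact le_abs_self C'
      rw [mul_assoc]
      gcongr
      exact le_abs_self C₁
    refine htriv f fun x => G.eq_zero_of_re (LinearMap.range j) f ?_ _ ⟨x, rfl⟩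
    rintro _ ⟨x, rfl⟩
    obtain ⟨u, hu, hux⟩ := mem_closure_iff_seq_limit.mp
      (kernelSpan_subset_closure h0 hV1 hV hΘ (lt_min hr hr₀) x.2)
    have h3 : Filter.Tendsto (fun n => (⟨u n, hle (hu n)⟩ : L)) Filter.atTop (nhds x) :=
      tendsto_subtype_rng.mpr hux
    have h4 := (hφ.tendsto x).comp h3
    refine tendsto_nhds_unique h4 ?_
    refine tendsto_const_nhds.congr fun n => ?_
    exact (congrArg (fun q : ℍ[ℝ] => q.re) (h1 _ (hu n))).symm

end ReproducingSpace

/-! ### From the kernel to a realization -/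

section Realization

variable {M N : ℕ}

theorem star_smul_dotProduct {n : ℕ} (a : ℍ[ℝ]) (v w : Fin n → ℍ[ℝ]) :
    star (star a • v) ⬝ᵥ w = star v ⬝ᵥ (a • w) := by
  simp only [dotProduct, Pi.star_apply, Pi.smul_apply, smul_eq_mul, star_mul, star_star, mul_assoc]

theorem eq_of_star_dotProduct {n : ℕ} {v w : Fin n → ℍ[ℝ]}
    (h : ∀ c : Fin n → ℍ[ℝ], star c ⬝ᵥ v = star c ⬝ᵥ w) : v = w := by
  funext i
  have := h (Pi.single i 1)
  rwa [← Pi.single_star, star_one, single_one_dotProduct, single_one_dotProduct] at this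

/-- The structural identity `K(p, q) - p K(p, q) q̄ = J₂ - Θ(p) J₁ Θ(q)^*` of the kernel. -/
theorem schurKernel_shift (J₁ : Matrix (Fin N) (Fin N) ℍ[ℝ]) (J₂ : Matrix (Fin M) (Fin M) ℍ[ℝ])
    (Θ : ℍ[ℝ] → Matrix (Fin M) (Fin N) ℍ[ℝ]) {p q : ℍ[ℝ]} (hp : ‖p‖ < 1) (hq : ‖q‖ < 1)
    (c d : Fin M → ℍ[ℝ]) :
    star c ⬝ᵥ (schurKernel J₁ J₂ Θ p q).mulVec d
      = star (star p • c) ⬝ᵥ (schurKernel J₁ J₂ Θ p q).mulVec (star q • d)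
        + star c ⬝ᵥ (J₂ - Θ p * J₁ * (Θ q).conjTranspose).mulVec d := by
  set X := J₂ - Θ p * J₁ * (Θ q).conjTranspose with hX
  have hs : ∀ i j, Summable fun l : ℕ => p ^ l * X i j * (star q) ^ l := fun i j =>
    summable_pow_mul_pow hp hq _
  have h1 : ∀ i j, schurKernel J₁ J₂ Θ p q i j
      = p * schurKernel J₁ J₂ Θ p q i j * star q + X i j := by
    intro i j
    change ∑' l : ℕ, p ^ l * X i j * (star q) ^ l
      = p * (∑' l : ℕ, p ^ l * X i j * (star q) ^ l) * star q + X i j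
    rw [← (hs i j).tsum_mul_left, ← ((hs i j).mul_left p).tsum_mul_right]
    conv_lhs => rw [(hs i j).tsum_eq_zero_add]
    rw [pow_zero, pow_zero, one_mul, mul_one, add_comm]
    congr 2
    funext l
    rw [pow_succ', pow_succ]
    simp only [mul_assoc]
  rw [star_smul_dotProduct, ← dotProduct_add]
  congr 1
  funext i
  simp only [Matrix.mulVec, dotProduct, Pi.add_apply, Pi.smul_apply, smul_eq_mul, Finset.mul_sum,
    ← Finset.sum_add_distrib]
  refine Finset.sum_congr rfl fun j _ => ?_
  conv_lhs => rw [h1]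
  simp only [add_mul, mul_assoc]

variable {P : Type*} [AddCommGroup P] [Module ℍ[ℝ]ᵐᵒᵖ P]

/-- The powers of an operator with an adjoint grow at most geometrically. -/
theorem IsPontryaginSpace.exists_form_pow_le {F : HermForm P} {κ : ℕ} (hF : IsPontryaginSpace F κ)
    (A : P →ₗ[ℍ[ℝ]ᵐᵒᵖ] P) (A' : P → P) (hA : ∀ x y, F.toFun (A x) y = F.toFun x (A' y)) :
    ∃ a > 0, ∀ x y, ∃ b, ∀ n : ℕ, ‖F.toFun ((A ^ n) x) y‖ ≤ a ^ n * b := by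
  obtain ⟨Pp, Pm, hd, -⟩ := hF
  let _ := fundNormed hd
  let _ := fundInner hd
  have := hd.completeSpace
  have K := hd.isKreinNorm
  have := K.tower
  have hc := K.continuous_of_adjoint K A A' hA
  let A₁ : P →L[ℝ] P := ⟨A.restrictScalars ℝ, hc⟩
  refine ⟨1 + ‖A₁‖, by positivity, fun x y => ⟨‖x‖ * ‖y‖, fun n => ?_⟩⟩
  refine (K.norm_form_le _ _).trans ?_
  rw [← mul_assoc]
  gcongr
  induction n with
  | zero => simp
  | succ n ih =>
    have h1 : (A ^ (n + 1)) x = A₁ ((A ^ n) x) := by rw [pow_succ']; rfl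
    calc ‖(A ^ (n + 1)) x‖ ≤ ‖A₁‖ * ‖(A ^ n) x‖ := by rw [h1]; exact A₁.le_opNorm _
      _ ≤ (1 + ‖A₁‖) * ((1 + ‖A₁‖) ^ n * ‖x‖) := by gcongr; linarith
      _ = _ := by ring

section Adjoint

variable {F : HermForm P} {A : P →ₗ[ℍ[ℝ]ᵐᵒᵖ] P} {B : (Fin N → ℍ[ℝ]) →ₗ[ℍ[ℝ]ᵐᵒᵖ] P}
    {C : P →ₗ[ℍ[ℝ]ᵐᵒᵖ] (Fin M → ℍ[ℝ])} {D : Matrix (Fin M) (Fin N) ℍ[ℝ]}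
    {S : P × (Fin M → ℍ[ℝ]) → P × (Fin N → ℍ[ℝ])}

/-- The state component of the adjoint is an adjoint of `A`. -/
theorem IsAdjointOp.state (h : IsAdjointOp F (colligation A B C D) S) (x y : P) :
    F.toFun (A x) y = F.toFun x (S (y, 0)).1 := by
  simpa [sumForm, colligation] using h (x, 0) (y, 0)

/-- The adjoint of `C` is a component of the adjoint of the colligation. -/
theorem IsAdjointOp.output (h : IsAdjointOp F (colligation A B C D) S) (x : P)
    (c : Fin M → ℍ[ℝ]) : star c ⬝ᵥ C x = F.toFun x (S (0, c)).1 := by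
  simpa [sumForm, colligation] using h (x, 0) (0, c)

end Adjoint

/-- The function `w ↦ x̂(w)` with `c^* x̂(w) = [x, k_w c]`. -/
def transform (G : HermForm P) (k : (Fin M → ℍ[ℝ]) →ₗ[ℍ[ℝ]ᵐᵒᵖ] P) (x : P) : Fin M → ℍ[ℝ] :=
  fun i => G.toFun x (k (Pi.single i 1))

theorem star_dotProduct_transform (G : HermForm P) (k : (Fin M → ℍ[ℝ]) →ₗ[ℍ[ℝ]ᵐᵒᵖ] P) (x : P)
    (c : Fin M → ℍ[ℝ]) : star c ⬝ᵥ transform G k x = G.toFun x (k c) := by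
  have h1 : k c = ∑ i, k (Pi.single i 1) <• c i := by
    conv_lhs => rw [← Finset.univ_sum_single c, map_sum]
    refine Finset.sum_congr rfl fun i _ => ?_
    rw [← map_smul, ← Pi.single_smul']
    simp
  rw [h1, G.sum_right]
  refine Finset.sum_congr rfl fun i _ => ?_
  rw [G.smul_right]
  rfl

theorem transform_add (G : HermForm P) (k : (Fin M → ℍ[ℝ]) →ₗ[ℍ[ℝ]ᵐᵒᵖ] P) (x y : P) :
    transform G k (x + y) = transform G k x + transform G k y :=
  funext fun _ => G.add_left x y _

theorem transform_sub (G : HermForm P) (k : (Fin M → ℍ[ℝ]) →ₗ[ℍ[ℝ]ᵐᵒᵖ] P) (x y : P) :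
    transform G k (x - y) = transform G k x - transform G k y :=
  funext fun _ => G.sub_left x y _

theorem transform_smul_coe (G : HermForm P) (k : (Fin M → ℍ[ℝ]) →ₗ[ℍ[ℝ]ᵐᵒᵖ] P) (x : P) (r : ℝ) :
    transform G k (x <• (r : ℍ[ℝ])) = (r : ℍ[ℝ]) • transform G k x := by
  funext i
  change G.toFun _ _ = (r : ℍ[ℝ]) * G.toFun _ _
  rw [G.smul_left, Quaternion.coe_commutes]

end Realization

section Coisometry

variable {M N : ℕ} {P : Type*} [AddCommGroup P] [Module ℍ[ℝ]ᵐᵒᵖ P]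

theorem IsSignature.star_dotProduct {n : ℕ} {J : Matrix (Fin n) (Fin n) ℍ[ℝ]} (hJ : IsSignature J)
    (v w : Fin n → ℍ[ℝ]) : star (J.mulVec w) ⬝ᵥ v = star w ⬝ᵥ J.mulVec v := by
  rw [star_dotProduct_conjTranspose J v w, hJ.1]

/-- The kernel identity makes `(k_w (w̄ c), J₂ c) ↦ (k_w c, J₁ Θ(w)^* c)` an isometry between dense
subspaces of Pontryagin spaces of equal index. It extends to an isometry with adjoint `T`, and
`T` satisfies `w (T(x, u))₁^(w) + (T(x, u))₂ = x̂(w) + Θ(w) u`. -/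
theorem exists_coisometry {J₁ : Matrix (Fin N) (Fin N) ℍ[ℝ]} {J₂ : Matrix (Fin M) (Fin M) ℍ[ℝ]}
    (hJ₁ : IsSignature J₁) (hJ₂ : IsSignature J₂) (hJ : sqNeg J₁ = sqNeg J₂)
    {V : Set ℍ[ℝ]} (h0 : (0 : ℍ[ℝ]) ∈ V) (hV1 : V ⊆ Metric.ball 0 1) (hVo : IsOpen V)
    {Θ : ℍ[ℝ] → Matrix (Fin M) (Fin N) ℍ[ℝ]} {κ : ℕ} {G : HermForm P}
    (hG : IsPontryaginSpace G κ) {k : ℍ[ℝ] → ((Fin M → ℍ[ℝ]) →ₗ[ℍ[ℝ]ᵐᵒᵖ] P)}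
    (hk : ∀ p ∈ V, ∀ q ∈ V, ∀ c d,
      G.toFun (k q d) (k p c) = star c ⬝ᵥ (schurKernel J₁ J₂ Θ p q).mulVec d)
    (hdense : ∀ r > 0, ∀ f, (∀ t : ℝ, 0 < t → t < r → ∀ c, G.toFun f (k t c) = 0) → f = 0) :
    ∃ (T : P × (Fin N → ℍ[ℝ]) →ₗ[ℍ[ℝ]ᵐᵒᵖ] P × (Fin M → ℍ[ℝ])), IsCoisometric G J₁ J₂ T ∧
      ∀ w ∈ V, ∀ x, w • transform G (k w) (T x).1 + (T x).2
        = transform G (k w) x.1 + (Θ w).mulVec x.2 := by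
  have hnorm : ∀ p ∈ V, ‖p‖ < 1 := fun p hp => mem_ball_zero_iff.mp (hV1 hp)
  have hP₁ := hG.prod hJ₂
  have hP₂ := hG.prod hJ₁
  rw [hJ] at hP₂
  set F₁ := prodForm G J₂ hJ₂.1 with hF₁
  set F₂ := prodForm G J₁ hJ₁.1 with hF₂
  let s : Set ((P × (Fin M → ℍ[ℝ])) × (P × (Fin N → ℍ[ℝ]))) :=
    {y | ∃ w ∈ V, ∃ c, ((k w (star w • c), J₂.mulVec c),
      (k w c, J₁.mulVec ((Θ w).conjTranspose.mulVec c))) = y}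
  have hiso := isometric_span (F₁ := F₁) (F₂ := F₂) (s := s) (by
    rintro _ ⟨w, hw, c, rfl⟩ _ ⟨z, hz, d, rfl⟩
    rw [hF₁, hF₂, prodForm_apply, prodForm_apply]
    dsimp only
    rw [hk z hz w hw, hk z hz w hw, hJ₂.mulVec_mulVec, hJ₁.mulVec_mulVec, hJ₂.star_dotProduct,
      hJ₁.star_dotProduct, schurKernel_shift J₁ J₂ Θ (hnorm z hz) (hnorm w hw) d c, add_assoc]
    congr 1
    rw [Matrix.sub_mulVec, dotProduct_sub, Matrix.star_mulVec, Matrix.conjTranspose_conjTranspose,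
      ← Matrix.dotProduct_mulVec, Matrix.mulVec_mulVec, Matrix.mulVec_mulVec,
      sub_add_cancel])
  have htest : ∀ v : P × (Fin M → ℍ[ℝ]), ∀ w c, F₁.toFun v (k w (star w • c), J₂.mulVec c)
      = star c ⬝ᵥ (w • transform G (k w) v.1 + v.2) := by
    intro v w c
    rw [hF₁, prodForm_apply, hJ₂.star_dotProduct, hJ₂.mulVec_mulVec, dotProduct_add,
      ← star_smul_dotProduct, star_dotProduct_transform]
  have hdense' : ∀ v, (∀ x ∈ Submodule.span ℍ[ℝ]ᵐᵒᵖ s, F₁.toFun v x.1 = 0) → v = 0 := by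
    intro v hv
    have h1 : ∀ w ∈ V, w • transform G (k w) v.1 + v.2 = 0 := by
      intro w hw
      refine eq_of_star_dotProduct fun c => ?_
      rw [← htest, dotProduct_zero]
      exact hv _ (Submodule.subset_span ⟨w, hw, c, rfl⟩)
    -- at `w = 0` this is `v.2 = 0`; then the values at small reals `w = t > 0` give `v.1 = 0`
    have h2 : v.2 = 0 := by
      have := h1 0 h0
      rwa [zero_smul, zero_add] at this
    obtain ⟨r, hr, hrV⟩ := exists_realSegment_subset hVo h0
    have h3 : v.1 = 0 := hdense r hr v.1 fun t ht htr c => by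
      have := h1 t (hrV ⟨t, ht, htr, rfl⟩)
      rw [h2, add_zero] at this
      have ht' : (t : ℍ[ℝ]) ≠ 0 := by
        rw [← Quaternion.coe_zero]
        exact fun h => ht.ne' (Quaternion.coe_injective h)
      rw [← star_dotProduct_transform, (smul_eq_zero.mp this).resolve_left ht', dotProduct_zero]
    exact Prod.ext h3 h2
  obtain ⟨S, T, hSX, hS, hT⟩ := hP₁.exists_isometry hP₂ (Submodule.span ℍ[ℝ]ᵐᵒᵖ s) hiso hdense'
  -- in the indefinite forms `T` is the adjoint of the isometry `S`; conjugating `S` with the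
  -- signature matrices gives the adjoint for the standard inner products
  have hTS : ∀ x, T (S x) = x := fun x => by
    refine sub_eq_zero.mp (hP₁.eq_zero fun y => ?_)
    rw [F₁.sub_left, hT, hS, sub_self]
  refine ⟨T, ⟨fun y => diagOp J₁ (S (diagOp J₂ y)), fun x y => ?_, fun y => ?_⟩, fun w hw x => ?_⟩
  · have h1 := hT x (diagOp J₂ y)
    rw [hF₁, hF₂, prodForm_apply, prodForm_apply] at h1
    rw [sumForm, sumForm]
    dsimp only [diagOp] at h1 ⊢
    rwa [hJ₂.star_dotProduct, hJ₂.mulVec_mulVec, ← hJ₁.star_dotProduct] at h1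
  · have h1 : ∀ z : P × (Fin N → ℍ[ℝ]), diagOp J₁ (diagOp J₁ z) = z := fun z =>
      Prod.ext rfl (hJ₁.mulVec_mulVec z.2)
    dsimp only
    rw [h1, hTS]
  · refine eq_of_star_dotProduct fun c => ?_
    rw [← htest, hT, hSX _ (Submodule.subset_span ⟨w, hw, c, rfl⟩), hF₂, prodForm_apply,
      hJ₁.star_dotProduct, hJ₁.mulVec_mulVec, dotProduct_add, star_dotProduct_transform,
      star_dotProduct_conjTranspose]

/-- The state space realization. Evaluating the functional equation of `T` on `(x, 0)` gives
`x̂(p) = C x + p (A x)^(p)`, which determines the resolvent and yields observability. -/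
theorem exists_realization {J₁ : Matrix (Fin N) (Fin N) ℍ[ℝ]} {J₂ : Matrix (Fin M) (Fin M) ℍ[ℝ]}
    {V : Set ℍ[ℝ]} (h0 : (0 : ℍ[ℝ]) ∈ V) (hVo : IsOpen V)
    {Θ : ℍ[ℝ] → Matrix (Fin M) (Fin N) ℍ[ℝ]} {κ : ℕ} {G : HermForm P}
    (hG : IsPontryaginSpace G κ) {k : ℍ[ℝ] → ((Fin M → ℍ[ℝ]) →ₗ[ℍ[ℝ]ᵐᵒᵖ] P)}
    (hdense : ∀ r > 0, ∀ f, (∀ t : ℝ, 0 < t → t < r → ∀ c, G.toFun f (k t c) = 0) → f = 0)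
    (T : P × (Fin N → ℍ[ℝ]) →ₗ[ℍ[ℝ]ᵐᵒᵖ] P × (Fin M → ℍ[ℝ])) (hT : IsCoisometric G J₁ J₂ T)
    (hTk : ∀ w ∈ V, ∀ x, w • transform G (k w) (T x).1 + (T x).2
        = transform G (k w) x.1 + (Θ w).mulVec x.2) :
    ∃ (A : P →ₗ[ℍ[ℝ]ᵐᵒᵖ] P) (B : (Fin N → ℍ[ℝ]) →ₗ[ℍ[ℝ]ᵐᵒᵖ] P)
      (C : P →ₗ[ℍ[ℝ]ᵐᵒᵖ] (Fin M → ℍ[ℝ])) (D : Matrix (Fin M) (Fin N) ℍ[ℝ]),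
        IsBoundedOp G (colligation A B C D) ∧ IsObservable C A ∧
        IsCoisometric G J₁ J₂ (colligation A B C D) ∧ IsRealizationOn V Θ A B C D := by
  let A : P →ₗ[ℍ[ℝ]ᵐᵒᵖ] P := LinearMap.fst _ _ _ ∘ₗ T ∘ₗ LinearMap.inl _ _ _
  let B : (Fin N → ℍ[ℝ]) →ₗ[ℍ[ℝ]ᵐᵒᵖ] P := LinearMap.fst _ _ _ ∘ₗ T ∘ₗ LinearMap.inr _ _ _
  let C : P →ₗ[ℍ[ℝ]ᵐᵒᵖ] (Fin M → ℍ[ℝ]) := LinearMap.snd _ _ _ ∘ₗ T ∘ₗ LinearMap.inl _ _ _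
  have htr0 : ∀ w, transform G (k w) 0 = 0 := fun w => funext fun _ => G.zero_left _
  have hA : ∀ w ∈ V, ∀ x, C x = transform G (k w) x - w • transform G (k w) (A x) := by
    intro w hw x
    have h1 := hTk w hw (x, 0)
    rw [Matrix.mulVec_zero, add_zero] at h1
    exact eq_sub_of_add_eq' h1
  have hB : ∀ w ∈ V, ∀ u, (Θ w).mulVec u = (T (0, u)).2 + w • transform G (k w) (B u) := by
    intro w hw u
    have h1 := hTk w hw (0, u)
    rw [htr0, zero_add] at h1
    rw [← h1, add_comm]
    rfl
  have hD : ∀ u, (T (0, u)).2 = (Θ 0).mulVec u := fun u => by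
    rw [hB 0 h0, zero_smul, add_zero]
  have hcol : colligation A B C (Θ 0) = T := by
    funext x
    have h1 : x = (x.1, 0) + (0, x.2) := by simp
    conv_rhs => rw [h1, map_add]
    refine Prod.ext rfl ?_
    rw [Prod.snd_add, hD]
    rfl
  have hco : IsCoisometric G J₁ J₂ (colligation A B C (Θ 0)) := hcol ▸ hT
  obtain ⟨S, hS, -⟩ := hco
  refine ⟨A, B, C, Θ 0, hG.isBoundedOp _ hS.state _ hS.output, ?_, hcol ▸ hT, ?_⟩
  · intro x hx
    obtain ⟨a, ha, hpow⟩ := hG.exists_form_pow_le A _ hS.state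
    obtain ⟨r, hr, hrV⟩ := exists_realSegment_subset hVo h0
    refine hdense (min r a⁻¹) (lt_min hr (inv_pos.mpr ha)) x fun t ht htr c => ?_
    have htV := hrV ⟨t, ht, htr.trans_le (min_le_left _ _), rfl⟩
    have hta : t * a < 1 := by
      have := mul_lt_mul_of_pos_right (htr.trans_le (min_le_right _ _)) ha
      rwa [inv_mul_cancel₀ ha.ne'] at this
    -- `C Aⁿ x = 0` for all `n` gives `x̂(t) = tⁿ (Aⁿ x)^(t)`, which tends to `0` for `t a < 1`
    have h1 : ∀ n : ℕ, transform G (k t) x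
        = ((t ^ n : ℝ) : ℍ[ℝ]) • transform G (k t) ((A ^ n) x) := by
      intro n
      induction n with
      | zero => simp
      | succ n ih =>
        have h2 := hA t htV ((A ^ n) x)
        rw [hx n, eq_comm, sub_eq_zero] at h2
        rw [ih, h2, smul_smul, ← Quaternion.coe_mul, ← pow_succ, pow_succ' A]
        rfl
    obtain ⟨b, hb⟩ := hpow x (k t c)
    have h3 : ∀ n : ℕ, ‖G.toFun x (k t c)‖ ≤ (t * a) ^ n * b := by
      intro n
      have h4 : G.toFun x (k t c) = ((t ^ n : ℝ) : ℍ[ℝ]) * G.toFun ((A ^ n) x) (k t c) := by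
        rw [← star_dotProduct_transform, h1 n, ← star_dotProduct_transform,
          ← transform_smul_coe, star_dotProduct_transform, star_dotProduct_transform, G.smul_left,
          Quaternion.coe_commutes]
      rw [h4, norm_mul, Quaternion.norm_coe, Real.norm_eq_abs, abs_of_pos (pow_pos ht n), mul_pow,
        mul_assoc]
      exact mul_le_mul_of_nonneg_left (hb n) (pow_pos ht n).le
    have h5 : Filter.Tendsto (fun n : ℕ => (t * a) ^ n * b) Filter.atTop (nhds (0 * b)) :=
      (tendsto_pow_atTop_nhds_zero_of_lt_one (by positivity) hta).mul_const b
    rw [zero_mul] at h5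
    exact norm_le_zero_iff.mp (ge_of_tendsto' h5 h3)
  · intro p hp h u
    rw [hB p hp, hD]
    congr 2
    set g := (LinearEquiv.ofBijective (sOperator A p) h).symm (B u) with hg
    have hgx : sOperator A p g = B u :=
      (LinearEquiv.ofBijective (sOperator A p) h).apply_symm_apply (B u)
    change _ = C g - star p • C (A g)
    rw [← hgx, hA p hp g, hA p hp (A g)]
    -- with `g = R B u` both sides are `ĝ(p) - (p + p̄) (A g)^(p) + |p|² (A² g)^(p)`
    change transform G (k p)
      (A (A g) <• ((‖p‖ ^ 2 : ℝ) : ℍ[ℝ]) - A g <• ((2 * p.re : ℝ) : ℍ[ℝ]) + g) = _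
    rw [transform_add, transform_sub, transform_smul_coe, transform_smul_coe, smul_sub, smul_smul]
    have e1 : star p * p = ((‖p‖ ^ 2 : ℝ) : ℍ[ℝ]) := by
      rw [Quaternion.star_mul_self, Quaternion.normSq_eq_norm_mul_self, sq]
    have e2 : ((2 * p.re : ℝ) : ℍ[ℝ]) = p + star p := by
      rw [Quaternion.self_add_star']
    rw [e1, e2, add_smul]
    abel

end Coisometry

/-! ### From a realization to the kernel -/

section Converse

variable {M N : ℕ} {P : Type*} [AddCommGroup P] [Module ℍ[ℝ]ᵐᵒᵖ P] {F : HermForm P} {κ : ℕ}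

theorem IsPontryaginSpace.ext_right (hF : IsPontryaginSpace F κ) {x y : P}
    (h : ∀ z, F.toFun z x = F.toFun z y) : x = y := by
  refine sub_eq_zero.mp (hF.eq_zero fun z => ?_)
  rw [F.conj_symm z, F.sub_right, h, sub_self, star_zero]

theorem IsPontryaginSpace.sumForm_ext (hF : IsPontryaginSpace F κ) {x y : P × (Fin N → ℍ[ℝ])}
    (h : ∀ z, sumForm F (z, 0) x = sumForm F (z, 0) y)
    (h' : ∀ u, sumForm F (0, u) x = sumForm F (0, u) y) : x = y := by
  refine Prod.ext (hF.ext_right fun z => by simpa [sumForm] using h z) ?_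
  refine eq_of_star_dotProduct fun c => ?_
  have := congrArg star (h' c)
  simpa [sumForm, ← Matrix.star_dotProduct_star] using this

/-- An adjoint is linear. -/
theorem IsPontryaginSpace.exists_adjoint_eq (hF : IsPontryaginSpace F κ) (A : P →ₗ[ℍ[ℝ]ᵐᵒᵖ] P)
    {A' : P → P} (hA : ∀ x y, F.toFun (A x) y = F.toFun x (A' y)) :
    ∃ A₁ : P →ₗ[ℍ[ℝ]ᵐᵒᵖ] P, ∀ x, A₁ x = A' x :=
  ⟨{ toFun := A'
     map_add' := fun x y => hF.ext_right fun z => by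
       rw [F.add_right, ← hA, ← hA, ← hA, F.add_right]
     map_smul' := fun a x => hF.ext_right fun z => by
       have h1 := F.smul_right (A z) x a.unop
       have h2 := F.smul_right z (A' x) a.unop
       rw [MulOpposite.op_unop] at h1 h2
       rw [RingHom.id_apply, ← hA, h1, h2, hA] }, fun _ => rfl⟩

variable {A : P →ₗ[ℍ[ℝ]ᵐᵒᵖ] P} {B : (Fin N → ℍ[ℝ]) →ₗ[ℍ[ℝ]ᵐᵒᵖ] P}
    {C : P →ₗ[ℍ[ℝ]ᵐᵒᵖ] (Fin M → ℍ[ℝ])} {D : Matrix (Fin M) (Fin N) ℍ[ℝ]}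

theorem coe_smul_eq {n : ℕ} (t : ℝ) (v : Fin n → ℍ[ℝ]) : (t : ℍ[ℝ]) • v = v <• (t : ℍ[ℝ]) :=
  funext fun i => Quaternion.coe_commutes t (v i)

/-- At a real point the realization is the classical one, `Θ(t) = D + t C (I - tA)⁻¹ B`. -/
theorem IsRealizationOn.mulVec_coe {V : Set ℍ[ℝ]} {Θ : ℍ[ℝ] → Matrix (Fin M) (Fin N) ℍ[ℝ]}
    (h : IsRealizationOn V Θ A B C D) {t : ℝ} (ht : (t : ℍ[ℝ]) ∈ V)
    (hb : Function.Bijective fun x => x - A x <• (t : ℍ[ℝ])) (u : Fin N → ℍ[ℝ]) :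
    ∃ g, g - A g <• (t : ℍ[ℝ]) = B u ∧ (Θ t).mulVec u = D.mulVec u + (t : ℍ[ℝ]) • C g := by
  have hs : Function.Bijective (sOperator A (t : ℍ[ℝ])) := by
    have : ⇑(sOperator A (t : ℍ[ℝ])) = (fun x => x - A x <• (t : ℍ[ℝ])) ∘
        fun x => x - A x <• (t : ℍ[ℝ]) := funext fun x => sOperator_coe A t x
    rw [this]
    exact hb.comp hb
  set y := (LinearEquiv.ofBijective (sOperator A (t : ℍ[ℝ])) hs).symm (B u) with hy
  have hyu : sOperator A (t : ℍ[ℝ]) y = B u :=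
    (LinearEquiv.ofBijective (sOperator A (t : ℍ[ℝ])) hs).apply_symm_apply (B u)
  refine ⟨y - A y <• (t : ℍ[ℝ]), by rw [← hyu, sOperator_coe], ?_⟩
  rw [h t ht hs u]
  congr 2
  change C y - star (t : ℍ[ℝ]) • C (A y) = _
  rw [map_sub, map_smul, Quaternion.star_coe]
  rw [coe_smul_eq]

variable {J₁ : Matrix (Fin N) (Fin N) ℍ[ℝ]} {J₂ : Matrix (Fin M) (Fin M) ℍ[ℝ]}
  {S : P × (Fin M → ℍ[ℝ]) → P × (Fin N → ℍ[ℝ])}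

/-- The kernel vector `k = (I - tA^*)⁻¹ C^* c` satisfies `T^*(k t, c) = (k, Θ(t)^* c)`. -/
theorem adjoint_kernelVec (hF : IsPontryaginSpace F κ) (hS : IsAdjointOp F (colligation A B C D) S)
    {V : Set ℍ[ℝ]} {Θ : ℍ[ℝ] → Matrix (Fin M) (Fin N) ℍ[ℝ]}
    (h : IsRealizationOn V Θ A B C D) {t : ℝ}
    (ht : (t : ℍ[ℝ]) ∈ V) (hb : Function.Bijective fun x => x - A x <• (t : ℍ[ℝ])) {k : P}
    {c : Fin M → ℍ[ℝ]} (hk : k - (S (k, 0)).1 <• (t : ℍ[ℝ]) = (S (0, c)).1) :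
    S (k <• (t : ℍ[ℝ]), c) = (k, (Θ t).conjTranspose.mulVec c) := by
  have hsm : ∀ x y, F.toFun x (y <• (t : ℍ[ℝ])) = (t : ℍ[ℝ]) * F.toFun x y := fun x y => by
    rw [F.smul_right, Quaternion.star_coe]
  have hout : ∀ x, star c ⬝ᵥ C x = F.toFun (x - A x <• (t : ℍ[ℝ])) k := fun x => by
    rw [hS.output, ← hk, F.sub_right, hsm, ← hS.state, F.sub_left, F.smul_left,
      Quaternion.coe_commutes]
  refine hF.sumForm_ext (fun x => ?_) fun u => ?_
  · rw [← hS]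
    change F.toFun (A x + B 0) (k <• (t : ℍ[ℝ])) + star c ⬝ᵥ (C x + D.mulVec 0)
      = F.toFun x k + _ ⬝ᵥ 0
    rw [map_zero, add_zero, Matrix.mulVec_zero, add_zero, hout, dotProduct_zero, add_zero, hsm,
      F.sub_left, F.smul_left, Quaternion.coe_commutes]
    abel
  · obtain ⟨g, hg, hΘ⟩ := h.mulVec_coe ht hb u
    rw [← hS]
    change F.toFun (A 0 + B u) (k <• (t : ℍ[ℝ])) + star c ⬝ᵥ (C 0 + D.mulVec u)
      = F.toFun 0 k + star ((Θ t).conjTranspose.mulVec c) ⬝ᵥ u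
    rw [← star_dotProduct_conjTranspose, hΘ, map_zero, map_zero, zero_add, zero_add, F.zero_left,
      zero_add, dotProduct_add, hsm, ← hg, ← hout, add_comm]
    congr 1
    simp only [dotProduct, Finset.mul_sum, Pi.smul_apply, smul_eq_mul]
    refine Finset.sum_congr rfl fun i _ => ?_
    rw [← mul_assoc, ← mul_assoc, Quaternion.coe_commutes]

/-- The form of the kernel vectors at real points is the kernel. -/
theorem form_kernelVec (hF : IsPontryaginSpace F κ) (hS : IsAdjointOp F (colligation A B C D) S)
    (hT : ∀ y, colligation A B C D (diagOp J₁ (S y)) = diagOp J₂ y)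
    {V : Set ℍ[ℝ]} (hV1 : V ⊆ Metric.ball 0 1)
    {Θ : ℍ[ℝ] → Matrix (Fin M) (Fin N) ℍ[ℝ]} (h : IsRealizationOn V Θ A B C D) {s t : ℝ}
    (hs : (s : ℍ[ℝ]) ∈ V) (ht : (t : ℍ[ℝ]) ∈ V)
    (hbs : Function.Bijective fun x => x - A x <• (s : ℍ[ℝ]))
    (hbt : Function.Bijective fun x => x - A x <• (t : ℍ[ℝ])) {k l : P} {c d : Fin M → ℍ[ℝ]}
    (hk : k - (S (k, 0)).1 <• (t : ℍ[ℝ]) = (S (0, c)).1)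
    (hl : l - (S (l, 0)).1 <• (s : ℍ[ℝ]) = (S (0, d)).1) :
    F.toFun k l = star d ⬝ᵥ (schurKernel J₁ J₂ Θ s t).mulVec c := by
  have hs1 : ‖(s : ℍ[ℝ])‖ < 1 := mem_ball_zero_iff.mp (hV1 hs)
  have ht1 : ‖(t : ℍ[ℝ])‖ < 1 := mem_ball_zero_iff.mp (hV1 ht)
  have h1 := hS (diagOp J₁ (S (k <• (t : ℍ[ℝ]), c))) (l <• (s : ℍ[ℝ]), d)
  rw [hT, adjoint_kernelVec hF hS h ht hbt hk, adjoint_kernelVec hF hS h hs hbs hl] at h1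
  have h2 : F.toFun (k <• (t : ℍ[ℝ])) (l <• (s : ℍ[ℝ])) + star d ⬝ᵥ J₂.mulVec c
      = F.toFun k l + star ((Θ s).conjTranspose.mulVec d) ⬝ᵥ
        J₁.mulVec ((Θ t).conjTranspose.mulVec c) := h1
  rw [← star_dotProduct_conjTranspose, Matrix.mulVec_mulVec, Matrix.mulVec_mulVec, F.smul_smul,
    Quaternion.star_coe] at h2
  have h3 := schurKernel_shift J₁ J₂ Θ hs1 ht1 d c
  rw [star_smul_dotProduct, Quaternion.star_coe, Matrix.sub_mulVec,
    dotProduct_sub, coe_smul_eq t c, Matrix.mulVec_smul, coe_smul_eq s, dotProduct_smul,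
    dotProduct_smul] at h3
  set x := F.toFun k l
  set y := star d ⬝ᵥ (schurKernel J₁ J₂ Θ s t).mulVec c
  have h4 : ∀ q : ℍ[ℝ], (s : ℍ[ℝ]) * q * (t : ℍ[ℝ]) = (s * t) • q := fun q => by
    rw [mul_assoc, ← Quaternion.coe_commutes, Quaternion.coe_mul_eq_smul,
      Quaternion.coe_mul_eq_smul, smul_smul]
  have h5 : y <• (t : ℍ[ℝ]) <• (s : ℍ[ℝ]) = (s * t) • y := by
    rw [← h4, mul_assoc, Quaternion.coe_commutes]
    rfl
  rw [h4] at h2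
  rw [h5] at h3
  -- both `x` and `y` solve `q - s t q = d^* (J₂ - Θ(s) J₁ Θ(t)^*) c`
  have h6 : (1 - s * t) • (x - y) = 0 := by
    rw [sub_smul, one_smul, smul_sub, eq_sub_of_add_eq h2]
    nth_rewrite 1 [h3]
    abel
  have hst : 1 - s * t ≠ 0 := by
    rw [Quaternion.norm_coe, Real.norm_eq_abs] at hs1 ht1
    have : |s * t| < 1 := by
      rw [abs_mul]
      nlinarith [abs_nonneg s, abs_nonneg t]
    linarith [(abs_lt.mp this).2]
  exact sub_eq_zero.mp ((smul_eq_zero.mp h6).resolve_left hst)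

/-- A realization produces a kernel with `κ` negative squares: the kernel vectors at small positive
reals are total in the state space by observability, and in the kernel space by the identity
principle. -/
theorem hasNegativeSquares_of_realization (hJ₁ : IsSignature J₁) (hJ₂ : IsSignature J₂)
    {V : Set ℍ[ℝ]} (h0 : (0 : ℍ[ℝ]) ∈ V) (hV1 : V ⊆ Metric.ball 0 1) (hV : IsSliceDomain V)
    {Θ : ℍ[ℝ] → Matrix (Fin M) (Fin N) ℍ[ℝ]} (hΘ : MatrixSliceRegularOn Θ V)
    (hF : IsPontryaginSpace F κ) (hobs : IsObservable C A)
    (hco : IsCoisometric F J₁ J₂ (colligation A B C D)) (hreal : IsRealizationOn V Θ A B C D) :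
    HasNegativeSquares (schurKernel J₁ J₂ Θ) V κ := by
  obtain ⟨S, hS, hT⟩ := hco
  have hJ := schurMatrix_conjTranspose hJ₁.1 hJ₂.1
  have hnorm : ∀ p ∈ V, ‖p‖ < 1 := fun p hp => mem_ball_zero_iff.mp (hV1 hp)
  set H := coeffForm (schurMatrix J₁ J₂) hJ with hH
  have hk : ∀ p ∈ V, ∀ q ∈ V, ∀ c d, H.toFun (schurVec Θ q d) (schurVec Θ p c)
      = star c ⬝ᵥ (schurKernel J₁ J₂ Θ p q).mulVec d := fun p hp q hq c d =>
    coeffForm_schurVec hJ Θ (hnorm p hp) (hnorm q hq) c d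
  obtain ⟨A₁, hA₁⟩ := hF.exists_adjoint_eq A hS.state
  have hA₁' : ∀ x y, F.toFun (A₁ x) y = F.toFun x (A y) := fun x y => by
    rw [F.conj_symm y, hA₁, ← hS.state, ← F.conj_symm]
  obtain ⟨ρ₁, hρ₁, hb⟩ := hF.exists_bijective A _ hS.state
  obtain ⟨ρ₂, hρ₂, hb'⟩ := hF.exists_bijective A₁ _ hA₁'
  obtain ⟨r₀, hr₀, hr₀V⟩ := exists_realSegment_subset hV.isOpen h0
  obtain ⟨r, hr, h1, h2, h3⟩ : ∃ r > 0, r ≤ ρ₁ ∧ r ≤ ρ₂ ∧ r ≤ r₀ :=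
    ⟨min ρ₁ (min ρ₂ r₀), by positivity, min_le_left _ _, (min_le_right _ _).trans (min_le_left _ _),
      (min_le_right _ _).trans (min_le_right _ _)⟩
  have hrV : realSegment r ⊆ V := (realSegment_mono h3).trans hr₀V
  have hbt : ∀ t : ℝ, 0 < t → t < r → Function.Bijective fun x => x - A x <• (t : ℍ[ℝ]) :=
    fun t ht htr => hb t (by rw [abs_of_pos ht]; exact htr.trans_le h1)
  have hkt : ∀ t : ℝ, 0 < t → t < r → ∀ c, ∃ k, k - (S (k, 0)).1 <• (t : ℍ[ℝ]) = (S (0, c)).1 :=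
    fun t ht htr c => by
      obtain ⟨k, hk⟩ := (hb' t (by rw [abs_of_pos ht]; exact htr.trans_le h2)).2 (S (0, c)).1
      refine ⟨k, ?_⟩
      rw [← hk, ← hA₁]
  -- the isometric relation that pairs `h(t) c` with `(I - tA^*)⁻¹ C^* c`
  let s : Set (CoeffSpace (Fin M ⊕ Fin N) × P) :=
    {y | ∃ t : ℝ, 0 < t ∧ t < r ∧ ∃ c, y.1 = schurVec Θ t c ∧
      y.2 - (S (y.2, 0)).1 <• (t : ℍ[ℝ]) = (S (0, c)).1}
  let X := Submodule.span ℍ[ℝ]ᵐᵒᵖ s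
  have hiso : ∀ x ∈ X, ∀ y ∈ X, H.toFun x.1 y.1 = F.toFun x.2 y.2 := by
    refine isometric_span ?_
    rintro ⟨_, k⟩ ⟨t, ht, htr, c, rfl, hkc⟩ ⟨_, l⟩ ⟨u, hu, hur, d, rfl, hld⟩
    have htV := hrV ⟨t, ht, htr, rfl⟩
    have huV := hrV ⟨u, hu, hur, rfl⟩
    dsimp only at hkc hld ⊢
    rw [hk _ huV _ htV, form_kernelVec hF hS hT hV1 hreal huV htV (hbt u hu hur) (hbt t ht htr)
      hkc hld]
  have hfst : X.map (LinearMap.fst _ _ _) = kernelSpan (schurVec Θ) (realSegment r) := by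
    rw [Submodule.map_span]
    congr 1
    ext x
    constructor
    · rintro ⟨y, ⟨t, ht, htr, c, hy, -⟩, rfl⟩
      exact ⟨t, ⟨t, ht, htr, rfl⟩, c, hy.symm⟩
    · rintro ⟨_, ⟨t, ht, htr, rfl⟩, c, rfl⟩
      obtain ⟨k, hk⟩ := hkt t ht htr c
      exact ⟨(schurVec Θ t c, k), ⟨t, ht, htr, c, rfl, hk⟩, rfl⟩
  -- `x` is orthogonal to all `(I - tA^*)⁻¹ C^* c` iff `C (I - tA)⁻¹ x = 0` for small `t`
  have hdense : ∀ x, (∀ y ∈ X.map (LinearMap.snd _ _ _), F.toFun x y = 0) → x = 0 := by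
    intro x hx
    refine hobs x fun n => hF.moments_eq_zero A _ hS.state C _ hS.output hr n x fun t ht htr => ?_
    obtain ⟨g, hg⟩ := (hbt t ht htr).2 x
    refine ⟨g, hg, eq_of_star_dotProduct fun c => ?_⟩
    obtain ⟨k, hk⟩ := hkt t ht htr c
    have h4 := hx k ⟨(schurVec Θ t c, k), Submodule.subset_span ⟨t, ht, htr, c, rfl, hk⟩, rfl⟩
    dsimp only at hg
    rw [dotProduct_zero, hS.output, ← hk, F.sub_right, F.smul_right, ← hS.state,
      Quaternion.star_coe, ← h4, ← hg, F.sub_left, F.smul_left, Quaternion.coe_commutes]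
  refine (hasNegativeSquares_iff hk).mpr ⟨fun Q hQ hfin hneg => ?_, ?_⟩
  · -- move a negative subspace into the span over small reals, then across the relation
    obtain ⟨Q', hQ', hfin', hneg', hdim⟩ := exists_negDef_of_closure
      (continuous_coeffForm_self _ hJ) (kernelSpan (schurVec Θ) (realSegment r)) Q hneg
      (subset_trans hQ (kernelSpan_subset_closure h0 hV1 hV hΘ hr))
    obtain ⟨τ, -, hinj, hneg''⟩ := exists_negDef_transfer (F₂ := F) X
      (fun x hx => by rw [hiso x hx x hx]) Q' (hQ'.trans hfst.ge) hneg'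
    rw [← hdim, ← LinearMap.finrank_range_of_inj hinj]
    exact hF.finrank_le hneg''
  · obtain ⟨Q, hQ, hfin, hneg, hdim⟩ := hF.exists_negDef hdense
    let X' := X.map (LinearEquiv.prodComm ℍ[ℝ]ᵐᵒᵖ _ _ :
      (CoeffSpace (Fin M ⊕ Fin N) × P) ≃ₗ[ℍ[ℝ]ᵐᵒᵖ] _).toLinearMap
    obtain ⟨τ, hτ, hinj, hneg'⟩ := exists_negDef_transfer (F₁ := F) (F₂ := H) X' (by
      rintro _ ⟨x, hx, rfl⟩
      exact congrArg (fun q : ℍ[ℝ] => q.re) (hiso x hx x hx).symm) Q (by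
      intro y hy
      obtain ⟨x, hx, rfl⟩ := hQ hy
      exact ⟨_, ⟨x, hx, rfl⟩, rfl⟩) hneg
    refine ⟨LinearMap.range τ, ?_, inferInstance, hneg',
      (LinearMap.finrank_range_of_inj hinj).trans hdim⟩
    rintro _ ⟨n, rfl⟩
    obtain ⟨x, hx, hxn⟩ := hτ n
    refine kernelSpan_mono hrV (hfst.le ⟨x, hx, ?_⟩)
    exact congrArg Prod.snd hxn

end Converse

end SliceSchur

end

theorem mainTheorem1 {M N : ℕ} (κ : ℕ)
    (J₁ : Matrix (Fin N) (Fin N) ℍ[ℝ]) (J₂ : Matrix (Fin M) (Fin M) ℍ[ℝ])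
    (hJ₁ : SliceSchur.IsSignature J₁) (hJ₂ : SliceSchur.IsSignature J₂)
    (hJ : SliceSchur.sqNeg J₁ = SliceSchur.sqNeg J₂)
    (V : Set ℍ[ℝ]) (h0 : (0 : ℍ[ℝ]) ∈ V) (hV1 : V ⊆ Metric.ball 0 1)
    (hV : SliceSchur.IsSliceDomain V) (hVsymm : SliceSchur.IsAxiallySymmetric V)
    (Θ : ℍ[ℝ] → Matrix (Fin M) (Fin N) ℍ[ℝ]) (hΘ : SliceSchur.MatrixSliceRegularOn Θ V) :
    SliceSchur.IsGeneralizedSchur J₁ J₂ V κ Θ ↔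
      ∃ (P : Type) (_ : AddCommGroup P) (_ : Module ℍ[ℝ]ᵐᵒᵖ P) (F : SliceSchur.HermForm P)
        (A : P →ₗ[ℍ[ℝ]ᵐᵒᵖ] P) (B : (Fin N → ℍ[ℝ]) →ₗ[ℍ[ℝ]ᵐᵒᵖ] P)
        (C : P →ₗ[ℍ[ℝ]ᵐᵒᵖ] (Fin M → ℍ[ℝ])) (D : Matrix (Fin M) (Fin N) ℍ[ℝ]),
        SliceSchur.IsPontryaginSpace F κ ∧
        SliceSchur.IsBoundedOp F (SliceSchur.colligation A B C D) ∧
        SliceSchur.IsObservable C A ∧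
        SliceSchur.IsCoisometric F J₁ J₂ (SliceSchur.colligation A B C D) ∧
        SliceSchur.IsRealizationOn V Θ A B C D := by
  constructor
  · intro h
    obtain ⟨P, _, _, G, k, hG, hk, hdense⟩ :=
      SliceSchur.exists_reproducing_space hJ₁ hJ₂ h0 hV1 hV hΘ h.negativeSquares
    obtain ⟨T, hT, hTk⟩ :=
      SliceSchur.exists_coisometry hJ₁ hJ₂ hJ h0 hV1 hV.isOpen hG hk hdense
    obtain ⟨A, B, C, D, hbd, hobs, hco, hreal⟩ :=
      SliceSchur.exists_realization h0 hV.isOpen hG hdense T hT hTk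
    exact ⟨P, _, _, G, A, B, C, D, hG, hbd, hobs, hco, hreal⟩
  · rintro ⟨P, _, _, F, A, B, C, D, hF, -, hobs, hco, hreal⟩
    exact ⟨hΘ, SliceSchur.hasNegativeSquares_of_realization hJ₁ hJ₂ h0 hV1 hV hΘ hF hobs hco hreal⟩
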